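/- Let $\mathbb F$ be a field of characteristic zero and let $\mathcal V$ be an algebra of differential functions in the variables $u_1,\dots,u_\ell$ which is a domain: a differential $\mathbb F$-algebra $(\mathcal V,\partial)$ extending the algebra of differential polynomials $\mathbb F[u_i^{(n)}\mid 1\le i\le \ell,\ n\ge 0]$ (with $\partial u_i^{(n)}=u_i^{(n+1)}$), endowed with commuting derivations $\frac{\partial}{\partial u_i^{(n)}}$ which extend the usual partial derivatives, such that for every $f\in\mathcal V$ only finitely many $\frac{\partial f}{\partial u_i^{(n)}}$ are non-zero, and $\big[\frac{\partial}{\partial u_i^{(n)}},\partial\big]=\frac{\partial}{\partial u_i^{(n-1)}}$ (which is $0$ for $n=0$). Let $\mathcal K$ be the field of fractions of $\mathcal V$, let $\mathcal K(\partial)$ be the smallest subskewfield of the skewfield of pseudodifferential operators $\mathcal K((\partial^{-1}))$ containing $\mathcal V[\partial]$, and let $\mathcal V(\partial)=\mathcal K(\partial)\cap\mathcal V((\partial^{-1}))$. To $H=(H_{ij})\in\mathrm{Mat}_{\ell\times\ell}\mathcal V(\partial)$ associate the $\lambda$-bracket on $\mathcal V$ $$\{f_\lambda g\}_H=\sum_{i,j=1}^{\ell}\sum_{m,n\ge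 0}\frac{\partial g}{\partial u_j^{(n)}}(\lambda+\partial)^nH_{ji}(\lambda+\partial)(-\lambda-\partial)^m\frac{\partial f}{\partial u_i^{(m)}}\in\mathcal V((\lambda^{-1})),$$ with powers of $\lambda+\partial$ expanded in non-negative powers of $\partial$. $H$ is called a non-local Hamiltonian structure on $\mathcal V$ if it is skewadjoint and, for all $i,j,k$, $$\{{u_i}_\lambda\{{u_j}_\mu u_k\}_H\}_H-\{{u_j}_\mu\{{u_i}_\lambda u_k\}_H\}_H-\{{\{{u_i}_\lambda u_j\}_H}_{\lambda+\mu}u_k\}_H=0$$ in the space $\mathcal V_{\lambda,\mu}=\mathcal V[[\lambda^{-1},\mu^{-1},(\lambda+\mu)^{-1}]][\lambda,\mu]$, i.e. the quotient of $\mathcal V[[\lambda^{-1},\mu^{-1},\nu^{-1}]][\lambda,\mu,\nu]$ by $(\nu-\lambda-\mu)$ times itself, which is embedded by expansion of $(\lambda+\mu)^{-1}$ or $\mu^{-1}$ in $\mathcal V((\lambda^{-1}))((\mu^{-1}))$, $\mathcal V((\mu^{-1}))((\lambda^{-1}))$ and $\mathcal V(((\lambda+\mu)^{-1}))((\lambda^{-1}))$,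 where the three terms respectively lie. A collection of non-local Hamiltonian structures is called compatible if every finite $\mathbb F$-linear combination of its members is again a non-local Hamiltonian structure. **Theorem.** Let $H,K\in\mathrm{Mat}_{\ell\times\ell}\mathcal V(\partial)$ be compatible non-local Hamiltonian structures on $\mathcal V$, and assume that $K$ is an invertible element of the algebra $\mathrm{Mat}_{\ell\times\ell}\mathcal V(\partial)$. Then the sequence of rational matrix pseudodifferential operators with coefficients in $\mathcal V$ $$H^{[0]}=K,\qquad H^{[n]}=(H\circ K^{-1})^{n-1}\circ H\in\mathrm{Mat}_{\ell\times\ell}\mathcal V(\partial),\quad n\ge 1,$$ is a compatible family of non-local Hamiltonian structures on $\mathcal V$. -/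

import Mathlib

/-! ### Finite-sum identities -/

theorem Derivation.iterate_mul_eq {F V : Type*} [Field F] [CommRing V] [Algebra F V]
    (d : Derivation F V V) (n : ℕ) (a b : V) :
    d^[n] (a * b) = ∑ p ∈ Finset.HasAntidiagonal.antidiagonal n, n.choose p.1 • (d^[p.1] a * d^[p.2] b) := by
  induction n with
  | zero => simp
  | succ n ih =>
    rw [Finset.sum_antidiagonal_choose_succ_nsmul (fun i j => d^[i] a * d^[j] b) n,
      Function.iterate_succ_apply', ih, map_sum, ← Finset.sum_add_distrib]
    refine Finset.sum_congr rfl fun p hp => ?_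
    rw [map_nsmul, Derivation.leibniz, ← Nat.choose_symm_of_eq_add (Finset.HasAntidiagonal.mem_antidiagonal.mp hp).symm,
      Function.iterate_succ_apply', Function.iterate_succ_apply', smul_eq_mul, smul_eq_mul,
      smul_add, mul_comm (d^[p.2] b)]

theorem finsum_antidiagonal {M : Type*} [AddCommMonoid M] (f : ℕ × ℕ → M) (X : ℕ)
    (hf : ∀ p, f p ≠ 0 → p.1 + p.2 < X) :
    ∑ᶠ p, f p = ∑ x ∈ Finset.range X, ∑ p ∈ Finset.HasAntidiagonal.antidiagonal x, f p := by
  rw [← Finset.sum_biUnion]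
  · apply finsum_eq_sum_of_support_subset
    intro p hp
    simpa using hf p hp
  · intro x _ y _ hxy
    simp only [Function.onFun, Finset.disjoint_left, Finset.HasAntidiagonal.mem_antidiagonal]
    rintro p rfl h
    exact hxy h

theorem binom_aux {F V : Type*} [Field F] [CommRing V] [Algebra F V]
    (d : Derivation F V V) (m n : ℤ) (b g : V) (x : ℕ) :
    ∑ p ∈ Finset.HasAntidiagonal.antidiagonal x,
      (Ring.choose m p.1 * Ring.choose (m + n - p.1) p.2) • (d^[p.1] b * d^[p.2] g) =
    ∑ p ∈ Finset.HasAntidiagonal.antidiagonal x,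
      (Ring.choose m p.1 * Ring.choose n p.2) • d^[p.1] (b * d^[p.2] g) := by
  have h1 : ∀ p ∈ Finset.HasAntidiagonal.antidiagonal x,
      (Ring.choose m p.1 * Ring.choose (m + n - p.1) p.2) • (d^[p.1] b * d^[p.2] g) =
      ∑ q ∈ Finset.HasAntidiagonal.antidiagonal p.2,
        (Ring.choose m p.1 * (Ring.choose (m - p.1) q.1 * Ring.choose n q.2)) •
          (d^[p.1] b * d^[q.1 + q.2] g) := by
    intro p _
    rw [show m + n - p.1 = (m - p.1) + n by ring, Ring.add_choose_eq _ (Commute.all _ _),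
      Finset.mul_sum, Finset.sum_smul]
    refine Finset.sum_congr rfl fun q hq => ?_
    rw [Finset.HasAntidiagonal.mem_antidiagonal.mp hq]
  have h2 : ∀ p ∈ Finset.HasAntidiagonal.antidiagonal x,
      (Ring.choose m p.1 * Ring.choose n p.2) • d^[p.1] (b * d^[p.2] g) =
      ∑ q ∈ Finset.HasAntidiagonal.antidiagonal p.1,
        (Ring.choose m q.1 * (Ring.choose (m - q.1) q.2 * Ring.choose n p.2)) •
          (d^[q.1] b * d^[q.2 + p.2] g) := by
    intro p _
    rw [Derivation.iterate_mul_eq, Finset.smul_sum]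
    refine Finset.sum_congr rfl fun q hq => ?_
    have hq' := Finset.HasAntidiagonal.mem_antidiagonal.mp hq
    have := Ring.choose_smul_choose m (show q.1 ≤ p.1 by omega)
    rw [show p.1 - q.1 = q.2 by omega] at this
    rw [← mul_assoc, ← this, ← Function.iterate_add_apply, ← natCast_zsmul, smul_smul, nsmul_eq_mul]
    congr 1
    ring
  rw [Finset.sum_congr rfl h1, Finset.sum_congr rfl h2, Finset.sum_sigma', Finset.sum_sigma']
  refine Finset.sum_nbij' (fun s => ⟨(s.1.1 + s.2.1, s.2.2), (s.1.1, s.2.1)⟩)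
    (fun s => ⟨(s.2.1, s.2.2 + s.1.2), (s.2.2, s.1.2)⟩) ?_ ?_ ?_ ?_ ?_ <;>
    simp +contextual [Finset.mem_sigma] <;> omega

/-! ### Pseudodifferential operators -/

/-- Pseudodifferential operators `∑_{n ≤ N} a_n ∂^n` over the differential algebra `(V, d)`. -/
@[ext]
structure PsiDO {F V : Type*} [Field F] [CommRing V] [Algebra F V] (d : Derivation F V V) where
  /-- `A.coeff n` is the coefficient `a_n` of `∂^n`. -/
  coeff : ℤ → V
  bdd : ∃ N : ℤ, ∀ n : ℤ, N < n → coeff n = 0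

namespace PsiDO

section Ring

variable {F V : Type*} [Field F] [CommRing V] [Algebra F V] {d : Derivation F V V}

theorem coeff_injective : Function.Injective (coeff : PsiDO d → ℤ → V) :=
  fun _ _ h => PsiDO.ext h

instance : Zero (PsiDO d) := ⟨⟨0, 0, fun _ _ => rfl⟩⟩

instance : Add (PsiDO d) := ⟨fun A B => ⟨A.coeff + B.coeff, by
  obtain ⟨M, hM⟩ := A.bdd
  obtain ⟨N, hN⟩ := B.bdd
  refine ⟨max M N, fun n hn => ?_⟩
  rw [max_lt_iff] at hn
  simp [hM n hn.1, hN n hn.2]⟩⟩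

instance : Neg (PsiDO d) := ⟨fun A => ⟨-A.coeff, by
  obtain ⟨M, hM⟩ := A.bdd
  exact ⟨M, fun n hn => by simp [hM n hn]⟩⟩⟩

instance : Sub (PsiDO d) := ⟨fun A B => ⟨A.coeff - B.coeff, by
  obtain ⟨M, hM⟩ := A.bdd
  obtain ⟨N, hN⟩ := B.bdd
  refine ⟨max M N, fun n hn => ?_⟩
  rw [max_lt_iff] at hn
  simp [hM n hn.1, hN n hn.2]⟩⟩

instance {R : Type*} [SMulZeroClass R V] : SMul R (PsiDO d) := ⟨fun c A => ⟨c • A.coeff, by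
  obtain ⟨M, hM⟩ := A.bdd
  exact ⟨M, fun n hn => by simp [hM n hn]⟩⟩⟩

@[simp] theorem coeff_zero (n : ℤ) : (0 : PsiDO d).coeff n = 0 := rfl
@[simp] theorem coeff_add (A B : PsiDO d) (n : ℤ) : (A + B).coeff n = A.coeff n + B.coeff n := rfl
@[simp] theorem coeff_neg (A : PsiDO d) (n : ℤ) : (-A).coeff n = -A.coeff n := rfl
@[simp] theorem coeff_sub (A B : PsiDO d) (n : ℤ) : (A - B).coeff n = A.coeff n - B.coeff n := rfl
@[simp] theorem coeff_smul {R : Type*} [SMulZeroClass R V] (c : R) (A : PsiDO d) (n : ℤ) :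
    (c • A).coeff n = c • A.coeff n := rfl

instance : AddCommGroup (PsiDO d) :=
  coeff_injective.addCommGroup _ rfl (fun _ _ => rfl) (fun _ => rfl) (fun _ _ => rfl)
    (fun _ _ => rfl) (fun _ _ => rfl)

/-- The operator `a ∂^n`. -/
def monomial (d : Derivation F V V) (n : ℤ) (a : V) : PsiDO d where
  coeff := Pi.single n a
  bdd := ⟨n, fun m hm => by simp [hm.ne']⟩

/-- The operator of multiplication by `a ∈ V`. -/
def const (d : Derivation F V V) (a : V) : PsiDO d := monomial d 0 a

/-- The operator `∂`. -/
def del (d : Derivation F V V) : PsiDO d := monomial d 1 1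

instance : One (PsiDO d) := ⟨const d 1⟩

theorem coeff_one (n : ℤ) : (1 : PsiDO d).coeff n = if n = 0 then 1 else 0 := by
  change Pi.single (M := fun _ => V) 0 1 n = _
  rw [Pi.single_apply]

theorem iterate_zero' (j : ℕ) : d^[j] (0 : V) = 0 := iterate_map_zero d j

theorem mul_support (a b : ℤ → V) (M N k : ℤ) (ha : ∀ n, M < n → a n = 0)
    (hb : ∀ n, N < n → b n = 0) (q : ℤ × ℕ)
    (hq : Ring.choose q.1 q.2 • (a q.1 * d^[q.2] (b (k - q.1 + q.2))) ≠ 0) :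
    q.1 ≤ M ∧ k - q.1 + q.2 ≤ N := by
  constructor <;> by_contra! h
  · exact hq (by simp [ha _ h])
  · exact hq (by simp [hb _ h])

/-- Composition of operators, determined by `∂^n ∘ a = ∑_j (n choose j) a^{(j)} ∂^{n-j}`: the
coefficient of `∂^k` in `A ∘ B` is `∑_{m ∈ ℤ, j ≥ 0} (m choose j) a_m ∂^j(b_{k-m+j})`, where only
finitely many terms are non-zero. -/
noncomputable instance : Mul (PsiDO d) := ⟨fun A B => ⟨fun k =>
    ∑ᶠ q : ℤ × ℕ, Ring.choose q.1 q.2 • (A.coeff q.1 * d^[q.2] (B.coeff (k - q.1 + q.2))), by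
  obtain ⟨M, hM⟩ := A.bdd
  obtain ⟨N, hN⟩ := B.bdd
  refine ⟨M + N, fun k hk => finsum_eq_zero_of_forall_eq_zero fun q => ?_⟩
  by_contra hq
  have := mul_support _ _ M N k hM hN q hq
  omega⟩⟩

theorem coeff_mul (A B : PsiDO d) (k : ℤ) : (A * B).coeff k =
    ∑ᶠ q : ℤ × ℕ, Ring.choose q.1 q.2 • (A.coeff q.1 * d^[q.2] (B.coeff (k - q.1 + q.2))) := rfl

theorem mul_finite (A B : PsiDO d) (k : ℤ) : Function.HasFiniteSupport fun q : ℤ × ℕ =>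
    Ring.choose q.1 q.2 • (A.coeff q.1 * d^[q.2] (B.coeff (k - q.1 + q.2))) := by
  obtain ⟨M, hM⟩ := A.bdd
  obtain ⟨N, hN⟩ := B.bdd
  refine (Set.finite_Icc ((k - N, 0) : ℤ × ℕ) (M, (M + N - k).toNat)).subset fun q hq => ?_
  have := mul_support _ _ M N k hM hN q hq
  simp only [Set.mem_Icc, Prod.le_def]
  omega

protected theorem mul_add' (A B C : PsiDO d) : A * (B + C) = A * B + A * C := by
  ext k
  rw [coeff_add, coeff_mul, coeff_mul, coeff_mul, ← finsum_add_distrib (mul_finite _ _ _)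
    (mul_finite _ _ _)]
  refine finsum_congr fun q => ?_
  rw [coeff_add, iterate_map_add, mul_add, smul_add]

protected theorem add_mul' (A B C : PsiDO d) : (A + B) * C = A * C + B * C := by
  ext k
  rw [coeff_add, coeff_mul, coeff_mul, coeff_mul, ← finsum_add_distrib (mul_finite _ _ _)
    (mul_finite _ _ _)]
  refine finsum_congr fun q => ?_
  rw [coeff_add, add_mul, smul_add]

theorem iterate_smul (c : F) (a : V) (j : ℕ) : d^[j] (c • a) = c • d^[j] a := by
  induction j with
  | zero => rfl
  | succ j ih => rw [Function.iterate_succ_apply', ih, Function.iterate_succ_apply', d.map_smul]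

theorem iterate_zsmul (c : ℤ) (a : V) (j : ℕ) : d^[j] (c • a) = c • d^[j] a := by
  induction j with
  | zero => rfl
  | succ j ih => rw [Function.iterate_succ_apply', ih, Function.iterate_succ_apply', map_zsmul]

protected theorem one_mul' (A : PsiDO d) : 1 * A = A := by
  ext k
  rw [coeff_mul, finsum_eq_single _ ((0, 0) : ℤ × ℕ)]
  · simp [coeff_one]
  · rintro ⟨m, j⟩ h
    rw [coeff_one]
    dsimp only
    split_ifs with hm
    · subst hm
      rw [Ring.choose_zero_pos ℤ (Nat.pos_of_ne_zero (by rintro rfl; exact h rfl)), zero_smul]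
    · simp

protected theorem mul_one' (A : PsiDO d) : A * 1 = A := by
  ext k
  rw [coeff_mul, finsum_eq_single _ ((k, 0) : ℤ × ℕ)]
  · simp [coeff_one]
  · rintro ⟨m, j⟩ h
    rw [coeff_one]
    dsimp only
    rcases j with _ | j
    · rw [if_neg, iterate_zero']
      · simp
      · intro h'
        apply h
        rw [Prod.mk.injEq]
        exact ⟨by push_cast at h'; omega, rfl⟩
    · rw [Function.iterate_succ_apply]
      split_ifs <;> simp

protected theorem mul_assoc' (A B C : PsiDO d) : A * B * C = A * (B * C) := by
  obtain ⟨a, ha⟩ := A.bdd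
  obtain ⟨b, hb⟩ := B.bdd
  obtain ⟨c, hc⟩ := C.bdd
  ext k
  let f : (ℤ × ℤ) × (ℕ × ℕ) → V := fun x =>
    (Ring.choose x.1.1 x.2.1 * Ring.choose (x.1.1 + x.1.2 - x.2.1) x.2.2) •
      (A.coeff x.1.1 * (d^[x.2.1] (B.coeff x.1.2) *
        d^[x.2.2] (C.coeff (k - x.1.1 - x.1.2 + (x.2.1 + x.2.2 : ℕ)))))
  let g : (ℤ × ℤ) × (ℕ × ℕ) → V := fun x =>
    (Ring.choose x.1.1 x.2.1 * Ring.choose x.1.2 x.2.2) •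
      (A.coeff x.1.1 * d^[x.2.1] (B.coeff x.1.2 *
        d^[x.2.2] (C.coeff (k - x.1.1 - x.1.2 + (x.2.1 + x.2.2 : ℕ)))))
  have hf0 : ∀ x, f x ≠ 0 → x.1.1 ≤ a ∧ x.1.2 ≤ b ∧
      k - x.1.1 - x.1.2 + (x.2.1 + x.2.2 : ℕ) ≤ c := by
    refine fun x hx => ⟨?_, ?_, ?_⟩ <;> by_contra! h
    · exact hx (by simp [f, ha _ h])
    · exact hx (by simp [f, hb _ h])
    · exact hx (by simp only [f, hc _ h]; simp)
  have hg0 : ∀ x, g x ≠ 0 → x.1.1 ≤ a ∧ x.1.2 ≤ b ∧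
      k - x.1.1 - x.1.2 + (x.2.1 + x.2.2 : ℕ) ≤ c := by
    refine fun x hx => ⟨?_, ?_, ?_⟩ <;> by_contra! h
    · exact hx (by simp [g, ha _ h])
    · exact hx (by simp [g, hb _ h])
    · exact hx (by simp only [g, hc _ h]; simp)
  have hfin : ∀ s : Set ((ℤ × ℤ) × (ℕ × ℕ)), (∀ x ∈ s, x.1.1 ≤ a ∧ x.1.2 ≤ b ∧
      k - x.1.1 - x.1.2 + (x.2.1 + x.2.2 : ℕ) ≤ c) → s.Finite := by
    refine fun s hs => (Set.finite_Icc (((k - b - c, k - a - c), (0, 0)) : (ℤ × ℤ) × (ℕ × ℕ))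
      ((a, b), ((a + b + c - k).toNat, (a + b + c - k).toNat))).subset fun x hx => ?_
    have := hs x hx
    simp only [Set.mem_Icc, Prod.le_def]
    omega
  have hff : f.HasFiniteSupport := hfin _ hf0
  have hgf : g.HasFiniteSupport := hfin _ hg0
  have key : ∑ᶠ x, f x = ∑ᶠ x, g x := by
    rw [finsum_curry f hff, finsum_curry g hgf]
    refine finsum_congr fun x => ?_
    rw [finsum_antidiagonal (fun y => f (x, y)) (c - k + x.1 + x.2 + 1).toNat
        (fun p hp => by have := hf0 _ hp; dsimp only at this; omega),
      finsum_antidiagonal (fun y => g (x, y)) (c - k + x.1 + x.2 + 1).toNat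
        (fun p hp => by have := hg0 _ hp; dsimp only at this; omega)]
    refine Finset.sum_congr rfl fun y _ => ?_
    have := congrArg (A.coeff x.1 * ·)
      (binom_aux d x.1 x.2 (B.coeff x.2) (C.coeff (k - x.1 - x.2 + y)) y)
    simp only [Finset.mul_sum, mul_smul_comm] at this
    refine (Finset.sum_congr rfl fun p hp => ?_).trans
      (this.trans (Finset.sum_congr rfl fun p hp => ?_)) <;>
    · rw [Finset.HasAntidiagonal.mem_antidiagonal] at hp
      simp only [f, g, hp]
  -- both sides, as sums over four indices
  let e₁ : (ℤ × ℕ) × (ℤ × ℕ) ≃ (ℤ × ℤ) × (ℕ × ℕ) :=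
    { toFun := fun x => ((x.2.1, x.1.1 - x.2.1 + x.2.2), (x.2.2, x.1.2))
      invFun := fun x => ((x.1.1 + x.1.2 - x.2.1, x.2.2), (x.1.1, x.2.1))
      left_inv := fun x => by ext <;> simp; ring
      right_inv := fun x => by ext <;> simp; ring }
  let e₂ : (ℤ × ℕ) × (ℤ × ℕ) ≃ (ℤ × ℤ) × (ℕ × ℕ) :=
    { toFun := fun x => ((x.1.1, x.2.1), (x.1.2, x.2.2))
      invFun := fun x => ((x.1.1, x.2.1), (x.1.2, x.2.2))
      left_inv := fun x => rfl
      right_inv := fun x => rfl }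
  have h1 : (A * B * C).coeff k = ∑ᶠ x, f x := by
    rw [← finsum_comp_equiv e₁,
      finsum_curry (fun x => f (e₁ x)) (hff.comp_of_injective e₁.injective), coeff_mul]
    refine finsum_congr fun p => ?_
    let φ : V →+ V := AddMonoidHom.mk'
      (fun x => Ring.choose p.1 p.2 • (x * d^[p.2] (C.coeff (k - p.1 + p.2))))
      (fun x y => by rw [add_mul, smul_add])
    change φ ((A * B).coeff p.1) = _
    rw [coeff_mul, map_finsum φ (mul_finite A B p.1)]
    refine finsum_congr fun q => ?_
    simp only [φ, f, e₁, Equiv.coe_fn_mk, AddMonoidHom.mk'_apply]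
    rw [smul_mul_assoc, smul_smul, mul_assoc, mul_comm (Ring.choose p.1 p.2),
      show q.1 + (p.1 - q.1 + q.2) - q.2 = p.1 by ring,
      show k - q.1 - (p.1 - q.1 + q.2) + (q.2 + p.2 : ℕ) = k - p.1 + p.2 by push_cast; ring]
  have h2 : (A * (B * C)).coeff k = ∑ᶠ x, g x := by
    rw [← finsum_comp_equiv e₂,
      finsum_curry (fun x => g (e₂ x)) (hgf.comp_of_injective e₂.injective), coeff_mul]
    refine finsum_congr fun p => ?_
    let φ : V →+ V := AddMonoidHom.mk'
      (fun x => Ring.choose p.1 p.2 • (A.coeff p.1 * d^[p.2] x))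
      (fun x y => by rw [iterate_map_add, mul_add, smul_add])
    change φ ((B * C).coeff (k - p.1 + p.2)) = _
    rw [coeff_mul, map_finsum φ (mul_finite B C _)]
    refine finsum_congr fun q => ?_
    simp only [φ, g, e₂, Equiv.coe_fn_mk, AddMonoidHom.mk'_apply]
    rw [iterate_zsmul, mul_smul_comm, smul_smul,
      show k - p.1 + p.2 - q.1 + q.2 = k - p.1 - q.1 + (p.2 + q.2 : ℕ) by push_cast; ring]
  rw [h1, h2, key]

noncomputable instance : Ring (PsiDO d) :=
  { (inferInstance : AddCommGroup (PsiDO d)) with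
    mul_assoc := PsiDO.mul_assoc'
    one_mul := PsiDO.one_mul'
    mul_one := PsiDO.mul_one'
    left_distrib := PsiDO.mul_add'
    right_distrib := PsiDO.add_mul'
    zero_mul := fun A => by
      have := PsiDO.add_mul' 0 0 A
      rwa [add_zero, left_eq_add] at this
    mul_zero := fun A => by
      have := PsiDO.mul_add' A 0 0
      rwa [add_zero, left_eq_add] at this }

noncomputable instance : Module F (PsiDO d) :=
  coeff_injective.module F ⟨⟨coeff, rfl⟩, fun _ _ => rfl⟩ fun _ _ => rfl

noncomputable instance : Algebra F (PsiDO d) :=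
  Algebra.ofModule
    (fun c A B => by
      ext k
      rw [coeff_smul, coeff_mul, coeff_mul, smul_finsum]
      refine finsum_congr fun q => ?_
      rw [coeff_smul, smul_mul_assoc, smul_comm])
    (fun c A B => by
      ext k
      rw [coeff_smul, coeff_mul, coeff_mul, smul_finsum]
      refine finsum_congr fun q => ?_
      rw [coeff_smul, iterate_smul, mul_smul_comm, smul_comm])

/-- The formal adjoint `A^* = ∑_n (-∂)^n ∘ a_n` of `A = ∑_n a_n ∂^n`: its coefficient at `∂^k` is
`∑_{j ≥ 0} (-1)^{k+j} ((k+j) choose j) ∂^j(a_{k+j})`. -/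
noncomputable def adjoint (A : PsiDO d) : PsiDO d where
  coeff k := ∑ᶠ j : ℕ,
    (((k + j).negOnePow : ℤ) * Ring.choose (k + j) j) • d^[j] (A.coeff (k + j))
  bdd := by
    obtain ⟨N, hN⟩ := A.bdd
    refine ⟨N, fun k hk => finsum_eq_zero_of_forall_eq_zero fun j => ?_⟩
    rw [hN _ (by omega), iterate_zero', smul_zero]

/-- Differential operators, i.e. the elements of `V[∂]`. -/
def IsDifferential (A : PsiDO d) : Prop := ∀ n : ℤ, n < 0 → A.coeff n = 0

end Ring

section Map

variable {F V W : Type*} [Field F] [CommRing V] [Algebra F V] [CommRing W] [Algebra F W]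
  {d : Derivation F V V} {d' : Derivation F W W}

/-- The homomorphism `V((∂⁻¹)) → W((∂⁻¹))` induced by a homomorphism `V → W` of differential
algebras. -/
noncomputable def map (φ : V →ₐ[F] W) (h : ∀ a, φ (d a) = d' (φ a)) : PsiDO d →ₐ[F] PsiDO d' :=
  AlgHom.ofLinearMap
    { toFun := fun A => ⟨fun n => φ (A.coeff n), by
        obtain ⟨N, hN⟩ := A.bdd
        exact ⟨N, fun n hn => by rw [hN n hn, map_zero]⟩⟩
      map_add' := fun A B => by ext n; exact map_add φ _ _
      map_smul' := fun c A => by ext n; exact map_smul φ _ _ }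
    (by
      ext n
      change φ ((1 : PsiDO d).coeff n) = _
      rw [coeff_one, coeff_one]
      split_ifs <;> simp)
    (fun A B => by
      ext n
      change φ ((A * B).coeff n) = _
      rw [coeff_mul, coeff_mul, map_finsum φ (mul_finite A B n)]
      refine finsum_congr fun q => ?_
      rw [map_zsmul, map_mul, Function.Semiconj.iterate_right (f := φ) (ga := d) (gb := d') h]
      rfl)

@[simp]
theorem coeff_map (φ : V →ₐ[F] W) (h : ∀ a, φ (d a) = d' (φ a)) (A : PsiDO d) (n : ℤ) :
    (map φ h A).coeff n = φ (A.coeff n) := rfl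

end Map

end PsiDO

/-! ### The field of fractions of a differential domain -/

section Fraction

variable {F V : Type*} [Field F] [CommRing V] [Algebra F V]

/-- The homomorphism `a ↦ a + a' ε` from `V` to the dual numbers over its field of fractions. -/
noncomputable def fracDual (d : Derivation F V V) :
    V →ₐ[F] TrivSqZeroExt (FractionRing V) (FractionRing V) :=
  AlgHom.ofLinearMap
    { toFun := fun a => TrivSqZeroExt.inl (algebraMap V (FractionRing V) a) +
        TrivSqZeroExt.inr (algebraMap V (FractionRing V) (d a))
      map_add' := fun a b => by
        ext
        · simp only [map_add, TrivSqZeroExt.fst_add, TrivSqZeroExt.fst_inl, TrivSqZeroExt.fst_inr,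
            add_zero]
        · simp only [map_add, TrivSqZeroExt.snd_add, TrivSqZeroExt.snd_inl, TrivSqZeroExt.snd_inr,
            zero_add]
      map_smul' := fun c a => by ext <;> simp [Algebra.algebraMap_eq_smul_one] }
    (by ext <;> simp)
    (fun a b => by
      ext
      · simp
      · simp only [LinearMap.coe_mk, AddHom.coe_mk, TrivSqZeroExt.snd_mul, TrivSqZeroExt.fst_add,
          TrivSqZeroExt.snd_add, TrivSqZeroExt.fst_inl, TrivSqZeroExt.fst_inr,
          TrivSqZeroExt.snd_inl, TrivSqZeroExt.snd_inr, Derivation.leibniz, map_add, map_mul,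
          smul_eq_mul, MulOpposite.smul_eq_mul_unop, MulOpposite.unop_op, add_zero, zero_add]
        ring)

theorem snd_fracDual (d : Derivation F V V) (a : V) :
    (fracDual d a).snd = algebraMap V (FractionRing V) (d a) := by
  change (TrivSqZeroExt.inl (algebraMap V (FractionRing V) a) +
        TrivSqZeroExt.inr (algebraMap V (FractionRing V) (d a))).snd = _
  rw [TrivSqZeroExt.snd_add, TrivSqZeroExt.snd_inl, TrivSqZeroExt.snd_inr, zero_add]

variable [IsDomain V]

theorem fracDual_isUnit (d : Derivation F V V) (y : nonZeroDivisors V) :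
    IsUnit (fracDual d y) := by
  rw [TrivSqZeroExt.isUnit_iff_isUnit_fst]
  simp [fracDual]

/-- The extension of `fracDual d` to the field of fractions. -/
noncomputable def fracDualLift (d : Derivation F V V) :
    FractionRing V →+* TrivSqZeroExt (FractionRing V) (FractionRing V) :=
  IsLocalization.lift (M := nonZeroDivisors V) (g := (fracDual d : V →+* _)) (fracDual_isUnit d)

theorem fracDualLift_algebraMap (d : Derivation F V V) (a : V) :
    fracDualLift d (algebraMap V (FractionRing V) a) = fracDual d a :=
  IsLocalization.lift_eq _ a

theorem fst_fracDualLift (d : Derivation F V V) (x : FractionRing V) :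
    (fracDualLift d x).fst = x := by
  have : ((TrivSqZeroExt.fstHom F (FractionRing V) (FractionRing V) : _ →+* _).comp
      (fracDualLift d)) = RingHom.id _ := by
    refine IsLocalization.ringHom_ext (nonZeroDivisors V) (RingHom.ext fun a => ?_)
    simp [fracDualLift_algebraMap, fracDual]
  exact congrArg (fun f : FractionRing V →+* FractionRing V => f x) this

/-- The unique extension of the derivation `d` of the domain `V` to its field of fractions. -/
noncomputable def fracDerivation (d : Derivation F V V) :
    Derivation F (FractionRing V) (FractionRing V) :=
  Derivation.mk'
    { toFun := fun x => (fracDualLift d x).snd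
      map_add' := fun x y => by rw [map_add, TrivSqZeroExt.snd_add]
      map_smul' := fun c x => by
        rw [Algebra.smul_def, IsScalarTower.algebraMap_apply F V (FractionRing V), map_mul,
          fracDualLift_algebraMap, TrivSqZeroExt.snd_mul, AlgHom.commutes]
        simp [TrivSqZeroExt.algebraMap_eq_inl', Algebra.smul_def] }
    (fun x y => by
      simp [fst_fracDualLift, mul_comm])

theorem fracDerivation_algebraMap (d : Derivation F V V) (a : V) :
    fracDerivation d (algebraMap V (FractionRing V) a) = algebraMap V (FractionRing V) (d a) := by
  change (fracDualLift d (algebraMap V (FractionRing V) a)).snd = _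
  rw [fracDualLift_algebraMap, snd_fracDual]

/-- The embedding `V((∂⁻¹)) → 𝒦((∂⁻¹))`, where `𝒦` is the field of fractions of `V`. -/
noncomputable def PsiDO.toFrac (d : Derivation F V V) : PsiDO d →ₐ[F] PsiDO (fracDerivation d) :=
  PsiDO.map (IsScalarTower.toAlgHom F V (FractionRing V))
    (fun a => (fracDerivation_algebraMap d a).symm)

/-- The skewfield `𝒦(∂)` of rational pseudodifferential operators: the smallest subskewfield of
`𝒦((∂⁻¹))` which contains `V[∂]`. -/
noncomputable def rationalFrac (d : Derivation F V V) : Subalgebra F (PsiDO (fracDerivation d)) :=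
  sInf {S | (∀ A : PsiDO d, A.IsDifferential → PsiDO.toFrac d A ∈ S) ∧
    ∀ A ∈ S, ∀ B, A * B = 1 → B * A = 1 → B ∈ S}

/-- The algebra `V(∂) = 𝒦(∂) ∩ V((∂⁻¹))` of rational pseudodifferential operators with
coefficients in `V`. -/
noncomputable def rational (d : Derivation F V V) : Subalgebra F (PsiDO d) :=
  (rationalFrac d).comap (PsiDO.toFrac d)

end Fraction

/-! ### The space `V_{λ,μ}` -/

section TwoVariables

variable (F V : Type*) [Field F] [AddCommGroup V] [Module F V]

/-- The space `V[[λ⁻¹,μ⁻¹,ν⁻¹]][λ,μ,ν]`: here `a m n p` is the coefficient of `λ^m μ^n ν^p`. -/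
def TriSeries : Submodule F (ℤ → ℤ → ℤ → V) where
  carrier := {a | ∃ N : ℤ, ∀ m n p, a m n p ≠ 0 → m ≤ N ∧ n ≤ N ∧ p ≤ N}
  zero_mem' := ⟨0, fun _ _ _ h => (h rfl).elim⟩
  add_mem' := by
    rintro a b ⟨M, hM⟩ ⟨N, hN⟩
    refine ⟨max M N, fun m n p h => ?_⟩
    by_cases ha : a m n p = 0
    · have := hN m n p (fun hb => h (by simp [ha, hb]))
      omega
    · have := hM m n p ha
      omega
  smul_mem' := by
    rintro c a ⟨M, hM⟩
    exact ⟨M, fun m n p h => hM m n p (fun ha => h (by simp [ha]))⟩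

/-- Multiplication by `ν - λ - μ`. -/
def mulRelation : TriSeries F V →ₗ[F] TriSeries F V where
  toFun a := ⟨fun m n p => a.1 m n (p - 1) - a.1 (m - 1) n p - a.1 m (n - 1) p, by
    obtain ⟨N, hN⟩ := a.2
    refine ⟨N + 1, fun m n p h => ?_⟩
    by_contra h'
    apply h
    have h1 : a.1 m n (p - 1) = 0 := by
      by_contra h0
      have := hN _ _ _ h0
      omega
    have h2 : a.1 (m - 1) n p = 0 := by
      by_contra h0
      have := hN _ _ _ h0
      omega
    have h3 : a.1 m (n - 1) p = 0 := by
      by_contra h0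
      have := hN _ _ _ h0
      omega
    simp only [h1, h2, h3, sub_zero]⟩
  map_add' a b := by
    ext m n p
    simp only [Submodule.coe_add, Pi.add_apply]
    abel
  map_smul' c a := by
    ext m n p
    simp only [Submodule.coe_smul, Pi.smul_apply, RingHom.id_apply, smul_sub]

/-- The space `V_{λ,μ} = V[[λ⁻¹,μ⁻¹,(λ+μ)⁻¹]][λ,μ]`: the quotient of `V[[λ⁻¹,μ⁻¹,ν⁻¹]][λ,μ,ν]` by
the submodule `(ν - λ - μ) V[[λ⁻¹,μ⁻¹,ν⁻¹]][λ,μ,ν]`. -/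
abbrev VLambdaMu : Type _ := TriSeries F V ⧸ LinearMap.range (mulRelation F V)

variable {F V}

theorem TriSeries.finite (a : TriSeries F V) (c : ℤ × ℕ → ℤ) (i j l : ℤ × ℕ → ℤ)
    (h : ∀ N : ℤ, ∃ x y, ∀ q : ℤ × ℕ, i q ≤ N ∧ j q ≤ N ∧ l q ≤ N →
      q ∈ Set.Icc x y) :
    Function.HasFiniteSupport fun q => c q • a.1 (i q) (j q) (l q) := by
  obtain ⟨N, hN⟩ := a.2
  obtain ⟨x, y, hxy⟩ := h N
  refine (Set.finite_Icc x y).subset fun q hq => hxy q (hN _ _ _ fun h0 => hq ?_)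
  simp only [h0, smul_zero]

theorem TriSeries.finite₁ (a : TriSeries F V) (c : ℤ × ℕ → ℤ) (r s : ℤ) :
    Function.HasFiniteSupport fun q => c q • a.1 (r - q.2) (s - q.1 + q.2) q.1 := by
  refine TriSeries.finite a c _ _ _ fun N => ⟨(s - N, 0), (N, (2 * N - s).toNat), fun q hq => ?_⟩
  simp only [Set.mem_Icc, Prod.le_def]
  omega

theorem TriSeries.finite₂ (a : TriSeries F V) (c : ℤ × ℕ → ℤ) (r s : ℤ) :
    Function.HasFiniteSupport fun q => c q • a.1 (r - q.1 + q.2) (s - q.2) q.1 := by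
  refine TriSeries.finite a c _ _ _ fun N => ⟨(r - N, 0), (N, (2 * N - r).toNat), fun q hq => ?_⟩
  simp only [Set.mem_Icc, Prod.le_def]
  omega

theorem TriSeries.finite₃ (a : TriSeries F V) (c : ℤ × ℕ → ℤ) (r s : ℤ) :
    Function.HasFiniteSupport fun q => c q • a.1 (r - q.1 + q.2) q.1 (s - q.2) := by
  refine TriSeries.finite a c _ _ _ fun N => ⟨(r - N, 0), (N, (2 * N - r).toNat), fun q hq => ?_⟩
  simp only [Set.mem_Icc, Prod.le_def]
  omega

theorem finsum_pascal (g : ℤ → ℕ → V) (hg : Function.HasFiniteSupport fun q : ℤ × ℕ => g q.1 q.2) :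
    ∑ᶠ q : ℤ × ℕ, Ring.choose (q.1 + 1) q.2 • g q.1 q.2 =
      ∑ᶠ q : ℤ × ℕ, Ring.choose q.1 q.2 • g q.1 (q.2 + 1) +
        ∑ᶠ q : ℤ × ℕ, Ring.choose q.1 q.2 • g q.1 q.2 := by
  have hinj : Function.Injective fun q : ℤ × ℕ => (q.1, q.2 + 1) := by
    rintro ⟨a, b⟩ ⟨c, e⟩ h
    simpa using h
  have hd : ∀ q : ℤ × ℕ, Ring.choose (q.1 + 1) q.2 • g q.1 q.2 =
      Ring.choose q.1 q.2 • g q.1 q.2 +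
        (Ring.choose (q.1 + 1) q.2 - Ring.choose q.1 q.2) • g q.1 q.2 := fun q => by
    rw [← add_smul]; congr 1; ring
  have h1 : Function.HasFiniteSupport fun q : ℤ × ℕ => Ring.choose q.1 q.2 • g q.1 q.2 :=
    hg.subset fun q hq h => hq (by simp only [h, smul_zero])
  have h2 : Function.HasFiniteSupport fun q : ℤ × ℕ =>
      (Ring.choose (q.1 + 1) q.2 - Ring.choose q.1 q.2) • g q.1 q.2 :=
    hg.subset fun q hq h => hq (by simp only [h, smul_zero])
  rw [finsum_congr hd, finsum_add_distrib h1 h2, add_comm]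
  congr 1
  rw [← finsum_mem_univ, ← finsum_mem_inter_support_eq'
      (s := Set.range fun q : ℤ × ℕ => (q.1, q.2 + 1)),
    finsum_mem_range hinj]
  · refine finsum_congr fun q => ?_
    dsimp only
    rw [Ring.choose_succ_succ, add_sub_cancel_right]
  · rintro ⟨p, k⟩ hq
    simp only [Set.mem_univ, iff_true, Set.mem_range]
    rcases k with _ | k
    · simp at hq
    · exact ⟨(p, k), rfl⟩

theorem finsum_relation (g : ℤ → ℕ → V)
    (hg : Function.HasFiniteSupport fun q : ℤ × ℕ => g q.1 q.2) :
    ∑ᶠ q : ℤ × ℕ, Ring.choose q.1 q.2 • (g (q.1 - 1) q.2 - g q.1 (q.2 + 1) - g q.1 q.2) = 0 := by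
  let e : ℤ × ℕ ≃ ℤ × ℕ := (Equiv.subRight (1 : ℤ)).prodCongr (Equiv.refl ℕ)
  have hinj : Function.Injective fun q : ℤ × ℕ => (q.1, q.2 + 1) := by
    rintro ⟨a, b⟩ ⟨c, e⟩ h
    simpa using h
  have hs : ∀ f : ℤ × ℕ → V, f.HasFiniteSupport →
      Function.HasFiniteSupport fun q => Ring.choose q.1 q.2 • f q := fun f hf =>
    hf.subset fun q hq h => hq (by simp only [h, smul_zero])
  have h1 : Function.HasFiniteSupport fun q : ℤ × ℕ => Ring.choose q.1 q.2 • g (q.1 - 1) q.2 :=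
    hs _ (hg.comp_of_injective e.injective)
  have h2 : Function.HasFiniteSupport fun q : ℤ × ℕ => Ring.choose q.1 q.2 • g q.1 (q.2 + 1) :=
    hs _ (hg.comp_of_injective hinj)
  have h3 := hs _ hg
  simp only [smul_sub]
  rw [finsum_sub_distrib (f := fun q : ℤ × ℕ => Ring.choose q.1 q.2 • g (q.1 - 1) q.2 -
    Ring.choose q.1 q.2 • g q.1 (q.2 + 1)) (h1.sub h2) h3, finsum_sub_distrib h1 h2, sub_sub,
    sub_eq_zero, ← finsum_pascal g hg,
    ← finsum_comp_equiv e (f := fun q => Ring.choose (q.1 + 1) q.2 • g q.1 q.2)]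
  exact finsum_congr fun q => by simp [e]

variable (F V)

/-- The expansion of `∑ a_{m,n,p} λ^m μ^n (λ+μ)^p` in which the powers of `λ + μ` are expanded in
non-negative powers of `λ`; the value at `(r, s)` is the coefficient of `λ^r μ^s`. -/
noncomputable def expandMuLambda : TriSeries F V →ₗ[F] (ℤ × ℤ → V) where
  toFun a x := ∑ᶠ q : ℤ × ℕ,
    Ring.choose q.1 q.2 • a.1 (x.1 - q.2) (x.2 - q.1 + q.2) q.1
  map_add' a b := by
    funext x
    simp only [Pi.add_apply]
    rw [← finsum_add_distrib (TriSeries.finite₁ a _ _ _) (TriSeries.finite₁ b _ _ _)]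
    exact finsum_congr fun q => smul_add _ _ _
  map_smul' c a := by
    funext x
    simp only [Pi.smul_apply, RingHom.id_apply]
    rw [smul_finsum]
    exact finsum_congr fun q => smul_comm _ _ _

theorem expandMuLambda_mulRelation :
    LinearMap.range (mulRelation F V) ≤ LinearMap.ker (expandMuLambda F V) := by
  rintro _ ⟨a, rfl⟩
  rw [LinearMap.mem_ker]
  funext x
  rw [Pi.zero_apply, ← finsum_relation (fun p k => a.1 (x.1 - k) (x.2 - 1 - p + k) p) ?_]
  · refine finsum_congr fun q => ?_
    simp only [mulRelation, LinearMap.coe_mk, AddHom.coe_mk]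
    rw [show x.2 - 1 - (q.1 - 1) + q.2 = x.2 - q.1 + q.2 by ring,
      show x.2 - 1 - q.1 + (q.2 + 1 : ℕ) = x.2 - q.1 + q.2 by push_cast; ring,
      show x.2 - 1 - q.1 + q.2 = x.2 - q.1 + q.2 - 1 by ring,
      show x.1 - (q.2 + 1 : ℕ) = x.1 - q.2 - 1 by push_cast; ring]
  · simpa using TriSeries.finite₁ a (fun _ => 1) x.1 (x.2 - 1)

/-- The expansion of `∑ a_{m,n,p} λ^m μ^n (λ+μ)^p` in which the powers of `λ + μ` are expanded in
non-negative powers of `μ`; the value at `(r, s)` is the coefficient of `λ^r μ^s`. -/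
noncomputable def expandLambdaMu : TriSeries F V →ₗ[F] (ℤ × ℤ → V) where
  toFun a x := ∑ᶠ q : ℤ × ℕ,
    Ring.choose q.1 q.2 • a.1 (x.1 - q.1 + q.2) (x.2 - q.2) q.1
  map_add' a b := by
    funext x
    simp only [Pi.add_apply]
    rw [← finsum_add_distrib (TriSeries.finite₂ a _ _ _) (TriSeries.finite₂ b _ _ _)]
    exact finsum_congr fun q => smul_add _ _ _
  map_smul' c a := by
    funext x
    simp only [Pi.smul_apply, RingHom.id_apply]
    rw [smul_finsum]
    exact finsum_congr fun q => smul_comm _ _ _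

theorem expandLambdaMu_mulRelation :
    LinearMap.range (mulRelation F V) ≤ LinearMap.ker (expandLambdaMu F V) := by
  rintro _ ⟨a, rfl⟩
  rw [LinearMap.mem_ker]
  funext x
  rw [Pi.zero_apply, ← finsum_relation (fun p k => a.1 (x.1 - 1 - p + k) (x.2 - k) p) ?_]
  · refine finsum_congr fun q => ?_
    simp only [mulRelation, LinearMap.coe_mk, AddHom.coe_mk]
    rw [show x.1 - 1 - (q.1 - 1) + q.2 = x.1 - q.1 + q.2 by ring,
      show x.1 - 1 - q.1 + (q.2 + 1 : ℕ) = x.1 - q.1 + q.2 by push_cast; ring,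
      show x.1 - 1 - q.1 + q.2 = x.1 - q.1 + q.2 - 1 by ring,
      show x.2 - (q.2 + 1 : ℕ) = x.2 - q.2 - 1 by push_cast; ring]
    module
  · simpa using TriSeries.finite₂ a (fun _ => 1) (x.1 - 1) x.2

/-- With `ν = λ + μ`, the expansion of `∑ a_{m,n,p} λ^m μ^n ν^p` in which the powers of
`μ = -λ + ν` are expanded in non-negative powers of `ν`; the value at `(r, s)` is the coefficient of
`λ^r ν^s`. -/
noncomputable def expandLambdaNu : TriSeries F V →ₗ[F] (ℤ × ℤ → V) where
  toFun a x := ∑ᶠ q : ℤ × ℕ,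
    (((q.1 - q.2).negOnePow : ℤ) * Ring.choose q.1 q.2) •
      a.1 (x.1 - q.1 + q.2) q.1 (x.2 - q.2)
  map_add' a b := by
    funext x
    simp only [Pi.add_apply]
    rw [← finsum_add_distrib (TriSeries.finite₃ a _ _ _) (TriSeries.finite₃ b _ _ _)]
    exact finsum_congr fun q => smul_add _ _ _
  map_smul' c a := by
    funext x
    simp only [Pi.smul_apply, RingHom.id_apply]
    rw [smul_finsum]
    exact finsum_congr fun q => smul_comm _ _ _

theorem expandLambdaNu_mulRelation :
    LinearMap.range (mulRelation F V) ≤ LinearMap.ker (expandLambdaNu F V) := by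
  rintro _ ⟨a, rfl⟩
  rw [LinearMap.mem_ker]
  funext x
  rw [Pi.zero_apply, ← finsum_relation (fun n k => ((n - k).negOnePow : ℤ) • a.1 (x.1 - 1 - n + k) n (x.2 - k)) ?_]
  · refine finsum_congr fun q => ?_
    simp only [mulRelation, LinearMap.coe_mk, AddHom.coe_mk]
    have e1 : (((q.1 - 1 - q.2).negOnePow : ℤˣ) : ℤ) = -((q.1 - q.2).negOnePow : ℤ) := by
      rw [sub_right_comm, Int.negOnePow_sub]; simp
    have e2 : (((q.1 - (q.2 + 1 : ℕ)).negOnePow : ℤˣ) : ℤ) = -((q.1 - q.2).negOnePow : ℤ) := by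
      rw [Nat.cast_succ, ← sub_sub, Int.negOnePow_sub]; simp
    rw [e1, e2, mul_comm, mul_smul]
    congr 1
    rw [show x.1 - 1 - (q.1 - 1) + q.2 = x.1 - q.1 + q.2 by ring,
      show x.1 - 1 - q.1 + (q.2 + 1 : ℕ) = x.1 - q.1 + q.2 by push_cast; ring,
      show x.1 - 1 - q.1 + q.2 = x.1 - q.1 + q.2 - 1 by ring,
      show x.2 - (q.2 + 1 : ℕ) = x.2 - q.2 - 1 by push_cast; ring]
    module
  · exact TriSeries.finite₃ a (fun q => ((q.1 - q.2).negOnePow : ℤ)) (x.1 - 1) x.2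

/-- The embedding `ι_{μ,λ} : V_{λ,μ} → V((λ⁻¹))((μ⁻¹))`. -/
noncomputable def iotaMuLambda : VLambdaMu F V →ₗ[F] (ℤ × ℤ → V) :=
  Submodule.liftQ _ (expandMuLambda F V) (expandMuLambda_mulRelation F V)

/-- The embedding `ι_{λ,μ} : V_{λ,μ} → V((μ⁻¹))((λ⁻¹))`. -/
noncomputable def iotaLambdaMu : VLambdaMu F V →ₗ[F] (ℤ × ℤ → V) :=
  Submodule.liftQ _ (expandLambdaMu F V) (expandLambdaMu_mulRelation F V)

/-- The embedding `ι_{λ,λ+μ} : V_{λ,μ} → V(((λ+μ)⁻¹))((λ⁻¹))`. -/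
noncomputable def iotaLambdaNu : VLambdaMu F V →ₗ[F] (ℤ × ℤ → V) :=
  Submodule.liftQ _ (expandLambdaNu F V) (expandLambdaNu_mulRelation F V)

end TwoVariables

/-! ### Algebras of differential functions and non-local Hamiltonian structures -/

/-- The structure of an algebra of differential functions in the variables `u_1, …, u_ℓ` on the
commutative algebra `V`. -/
structure DiffFunAlgebra (F : Type*) [Field F] (ℓ : ℕ) (V : Type*) [CommRing V] [Algebra F V] where
  /-- The derivation `∂`. -/
  D : Derivation F V V
  /-- The variables `u_i`; thus `u_i^{(n)} = ∂^n u_i`. -/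
  u : Fin ℓ → V
  /-- `V` contains the algebra of differential polynomials `F[u_i^{(n)}]`. -/
  algebraicIndependent : AlgebraicIndependent F fun p : Fin ℓ × ℕ => D^[p.2] (u p.1)
  /-- The derivations `∂/∂u_i^{(n)}`. -/
  pd : Fin ℓ → ℕ → Derivation F V V
  pd_u : ∀ i m j n, pd i m (D^[n] (u j)) = if i = j ∧ m = n then 1 else 0
  pd_comm : ∀ i m j n f, pd i m (pd j n f) = pd j n (pd i m f)
  pd_finite : ∀ f, {p : Fin ℓ × ℕ | pd p.1 p.2 f ≠ 0}.Finite
  pd_zero_D : ∀ i f, pd i 0 (D f) - D (pd i 0 f) = 0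
  pd_succ_D : ∀ i n f, pd i (n + 1) (D f) - D (pd i (n + 1) f) = pd i n f

section Hamiltonian

variable {F V : Type*} [Field F] [CommRing V] [Algebra F V] {ℓ : ℕ}

/-- The `λ`-bracket `{f_λ g}_H` on `V` given by the Master Formula
`∑_{i,j,m,n} ∂g/∂u_j^{(n)} (λ+∂)^n H_{ji}(λ+∂) (-λ-∂)^m ∂f/∂u_i^{(m)}`. An element
`∑ c_n λ^n` of `V((λ⁻¹))` is identified with the pseudodifferential operator `∑ c_n ∂^n` with this
symbol; since the symbol of `A ∘ B` is `A(λ+∂) B(λ)`, the Master Formula is a composition. -/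
noncomputable def lambdaBracket (𝒱 : DiffFunAlgebra F ℓ V)
    (H : Matrix (Fin ℓ) (Fin ℓ) (PsiDO 𝒱.D)) (f g : V) : PsiDO 𝒱.D :=
  ∑ i, ∑ j, ∑ᶠ (m : ℕ) (n : ℕ),
    PsiDO.const 𝒱.D (𝒱.pd j n g) * PsiDO.del 𝒱.D ^ n * H j i *
      (-PsiDO.del 𝒱.D) ^ m * PsiDO.const 𝒱.D (𝒱.pd i m f)

/-- The adjoint of a matrix pseudodifferential operator. -/
noncomputable def matrixAdjoint {d : Derivation F V V} (H : Matrix (Fin ℓ) (Fin ℓ) (PsiDO d)) :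
    Matrix (Fin ℓ) (Fin ℓ) (PsiDO d) :=
  fun i j => (H j i).adjoint

/-- The Jacobi identity `{u_i λ {u_j μ u_k}} - {u_j μ {u_i λ u_k}} - {{u_i λ u_j} λ+μ u_k} = 0` for
the `λ`-bracket of `H`. The three terms are series in `V((λ⁻¹))((μ⁻¹))`, `V((μ⁻¹))((λ⁻¹))` and
`V(((λ+μ)⁻¹))((λ⁻¹))` respectively; they have to be expansions of elements of `V_{λ,μ}`, and the
identity is required for these elements of `V_{λ,μ}`. -/
def JacobiIdentity (𝒱 : DiffFunAlgebra F ℓ V) (H : Matrix (Fin ℓ) (Fin ℓ) (PsiDO 𝒱.D))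
    (i j k : Fin ℓ) : Prop :=
  ∃ J₁ J₂ J₃ : VLambdaMu F V,
    (∀ r s : ℤ, iotaMuLambda F V J₁ (r, s) =
      (lambdaBracket 𝒱 H (𝒱.u i) ((lambdaBracket 𝒱 H (𝒱.u j) (𝒱.u k)).coeff s)).coeff r) ∧
    (∀ r s : ℤ, iotaLambdaMu F V J₂ (r, s) =
      (lambdaBracket 𝒱 H (𝒱.u j) ((lambdaBracket 𝒱 H (𝒱.u i) (𝒱.u k)).coeff r)).coeff s) ∧
    (∀ r s : ℤ, iotaLambdaNu F V J₃ (r, s) =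
      (lambdaBracket 𝒱 H ((lambdaBracket 𝒱 H (𝒱.u i) (𝒱.u j)).coeff r) (𝒱.u k)).coeff s) ∧
    J₁ - J₂ - J₃ = 0

variable [IsDomain V]

/-- Non-local Hamiltonian structures on `V`: skewadjoint rational matrix pseudodifferential
operators with coefficients in `V` which satisfy the Jacobi identity on generators. -/
def IsHamiltonian (𝒱 : DiffFunAlgebra F ℓ V) (H : Matrix (Fin ℓ) (Fin ℓ) (rational 𝒱.D)) : Prop :=
  matrixAdjoint (H.map (rational 𝒱.D).val) = -H.map (rational 𝒱.D).val ∧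
    ∀ i j k, JacobiIdentity 𝒱 (H.map (rational 𝒱.D).val) i j k

/-- A compatible family of non-local Hamiltonian structures: every finite linear combination is
again a non-local Hamiltonian structure. -/
def IsCompatibleFamily (𝒱 : DiffFunAlgebra F ℓ V) {ι : Type*}
    (H : ι → Matrix (Fin ℓ) (Fin ℓ) (rational 𝒱.D)) : Prop :=
  (∀ α, IsHamiltonian 𝒱 (H α)) ∧
    ∀ c : ι →₀ F, IsHamiltonian 𝒱 (c.sum fun α x => x • H α)

/-- The sequence `H^{[0]} = K` and `H^{[n]} = (H ∘ K⁻¹)^{n-1} ∘ H` for `n ≥ 1`. -/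
noncomputable def hierarchy {d : Derivation F V V} (H : Matrix (Fin ℓ) (Fin ℓ) (rational d))
    (K : (Matrix (Fin ℓ) (Fin ℓ) (rational d))ˣ) : ℕ → Matrix (Fin ℓ) (Fin ℓ) (rational d)
  | 0 => K
  | n + 1 => (H * (K⁻¹ : (Matrix (Fin ℓ) (Fin ℓ) (rational d))ˣ)) ^ n * H

end Hamiltonian

/-! ### Composition, adjoints and order of pseudodifferential operators -/

namespace PsiDO

section Basic

variable {F V : Type*} [Field F] [CommRing V] [Algebra F V] {d : Derivation F V V}

/-! For an operator A and the evolutionary field X_P with characteristic P, consider the trilinear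
density ∫ R X_P(A) Q modulo total derivatives. If H is skewadjoint, the three terms of its Jacobi
identity are the three cyclic permutations of ∫ R X_{HP}(H) Q, so the identity says that a cyclic
sum vanishes (`jacobiIdentity_iff`). For invertible K with L = K⁻¹, substituting L in all arguments
turns this into closedness of the two-form L: the cyclic sum of ∫ R X_P(L) Q is zero.

By compatibility, K - tH satisfies the Jacobi identity for a formal parameter t. Hence its inverse ∑
t^n ω_n, with ω_n = (LH)^n L, is closed, and so is every ω_n; `cyc_D_form` carries this out on
coefficients of t. Every finite linear combination of the hierarchy is KωK with ω = ∑ c_n ω_n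
(`hierarchy_eq`). Both ω and ωKω = ∑ c_m c_n ω_{m+n} are closed, and together with the Jacobi
identity for K this gives the one for KωK (`jacobi_of_closed`). All linear combinations are thus
treated at once.

The remaining work gives these manipulations a meaning for rational operators, where the terms of
the Jacobi identity lie in different completions. Densities are represented by series in three
variables λ, μ, κ modulo λ+μ+κ+∂, on which permutations and substitutions are transparent.
Integration by parts identifies them with V_{λ,μ}, and since ι_{μ,λ} is injective
(`iotaMuLambda_injective`) a density is determined by its expansion. The variation of an operator
comes from a ring homomorphism into operators over dual numbers; the operators whose variation is
the expansion of a density form an algebra closed under inverses and containing the differential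
operators, hence containing 𝒦(∂) (`rationalFrac_le_admissible`). This forces the work to be done
over 𝒦, and `jacobiIdentity_frac` transfers the Jacobi identity between V and 𝒦. -/

theorem coeff_monomial (n m : ℤ) (a : V) :
    (monomial d n a).coeff m = if m = n then a else 0 := by
  change Pi.single (M := fun _ => V) n a m = _
  rw [Pi.single_apply]

theorem coeff_const (m : ℤ) (a : V) : (const d a).coeff m = if m = 0 then a else 0 :=
  coeff_monomial 0 m a

/-- The coefficient at `∂^n` as an additive map. -/
def coeffHom (d : Derivation F V V) (n : ℤ) : PsiDO d →+ V where
  toFun A := A.coeff n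
  map_zero' := rfl
  map_add' _ _ := rfl

@[simp] theorem coeffHom_apply (n : ℤ) (A : PsiDO d) : coeffHom d n A = A.coeff n := rfl

theorem coeff_sum {ι : Type*} (s : Finset ι) (f : ι → PsiDO d) (n : ℤ) :
    (∑ i ∈ s, f i).coeff n = ∑ i ∈ s, (f i).coeff n :=
  map_sum (coeffHom d n) f s

theorem coeff_finsum {ι : Type*} (f : ι → PsiDO d) (hf : Function.HasFiniteSupport f) (n : ℤ) :
    (∑ᶠ i, f i).coeff n = ∑ᶠ i, (f i).coeff n :=
  map_finsum (coeffHom d n) hf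

/-- The operator `∂^n`, for `n ∈ ℤ`. -/
def delPow (d : Derivation F V V) (n : ℤ) : PsiDO d := monomial d n 1

theorem coeff_delPow (n m : ℤ) : (delPow d n).coeff m = if m = n then 1 else 0 :=
  coeff_monomial n m 1

theorem monomial_add (n : ℤ) (a b : V) : monomial d n (a + b) = monomial d n a + monomial d n b := by
  ext m; simp only [coeff_monomial, coeff_add]; split_ifs <;> simp

theorem monomial_zero (n : ℤ) : monomial d n 0 = 0 := by
  ext m; simp [coeff_monomial]

theorem coeff_monomial_mul (n : ℤ) (a : V) (B : PsiDO d) (k : ℤ) :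
    (monomial d n a * B).coeff k =
      ∑ᶠ j : ℕ, Ring.choose n j • (a * d^[j] (B.coeff (k - n + j))) := by
  rw [coeff_mul]
  have hinj : Function.Injective fun j : ℕ => ((n, j) : ℤ × ℕ) := fun a b h => by simpa using h
  rw [← finsum_mem_univ, ← finsum_mem_inter_support_eq' (s := Set.range fun j : ℕ => ((n, j) : ℤ × ℕ)),
    finsum_mem_range hinj]
  · simp [coeff_monomial]
  · rintro ⟨p, k⟩ hq
    simp only [Set.mem_univ, iff_true, Set.mem_range]
    refine ⟨k, ?_⟩
    by_contra h
    apply hq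
    have : p ≠ n := by rintro rfl; exact h rfl
    simp [coeff_monomial, this]

theorem coeff_mul_delPow (A : PsiDO d) (n k : ℤ) : (A * delPow d n).coeff k = A.coeff (k - n) := by
  rw [coeff_mul, finsum_eq_single _ ((k - n, 0) : ℤ × ℕ)]
  · simp [coeff_delPow]
  · rintro ⟨m, j⟩ h
    rw [coeff_delPow]
    dsimp only
    rcases j with _ | j
    · rw [if_neg, iterate_zero']
      · simp
      · intro h'
        apply h
        rw [Prod.mk.injEq]
        exact ⟨by push_cast at h'; omega, rfl⟩
    · rw [Function.iterate_succ_apply]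
      split_ifs <;> simp

theorem coeff_const_mul (a : V) (B : PsiDO d) (k : ℤ) :
    (const d a * B).coeff k = a * B.coeff k := by
  rw [const, coeff_monomial_mul, finsum_eq_single _ 0]
  · simp
  · intro j hj
    rw [Ring.choose_zero_pos ℤ (Nat.pos_of_ne_zero hj), zero_smul]

theorem const_mul_eq_smul (a : V) (B : PsiDO d) : const d a * B = a • B := by
  ext k; rw [coeff_const_mul, coeff_smul, smul_eq_mul]

theorem coeff_del_mul (B : PsiDO d) (k : ℤ) :
    (del d * B).coeff k = B.coeff (k - 1) + d (B.coeff k) := by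
  rw [del, coeff_monomial_mul, finsum_eq_sum_of_support_subset (s := Finset.range 2)]
  · simp [Finset.sum_range_succ]
  · intro j hj
    simp only [Finset.coe_range, Set.mem_Iio]
    by_contra h
    apply hj
    have : Ring.choose (1 : ℤ) j = 0 := by
      have := Ring.choose_natCast (R := ℤ) 1 j
      rw [Nat.cast_one] at this
      rw [this, Nat.choose_eq_zero_of_lt (by omega), Nat.cast_zero]
    simp only [this, zero_smul]

theorem coeff_monomial_mul_const (n : ℤ) (a b : V) (k : ℤ) :
    (monomial d n a * const d b).coeff k =
      if k ≤ n then Ring.choose n (n - k).toNat • (a * d^[(n - k).toNat] b) else 0 := by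
  rw [coeff_monomial_mul]
  split_ifs with h
  · rw [finsum_eq_single _ (n - k).toNat]
    · rw [coeff_const, if_pos (by omega)]
    · intro j hj
      rw [coeff_const, if_neg (by omega), iterate_zero', mul_zero, smul_zero]
  · refine finsum_eq_zero_of_forall_eq_zero fun j => ?_
    rw [coeff_const, if_neg (by omega), iterate_zero', mul_zero, smul_zero]

theorem const_add (a b : V) : const d (a + b) = const d a + const d b := monomial_add 0 a b

theorem const_zero : const d 0 = 0 := monomial_zero 0

theorem const_one : const d 1 = 1 := rfl

theorem const_mul_const (a b : V) : const d a * const d b = const d (a * b) := by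
  ext k; rw [coeff_const_mul, coeff_const, coeff_const, mul_ite, mul_zero]

theorem del_mul_const (a : V) : del d * const d a = const d a * del d + const d (d a) := by
  ext k
  rw [coeff_del_mul, coeff_add, coeff_const_mul, del, coeff_monomial, coeff_const, coeff_const,
    coeff_const]
  split_ifs <;> first | omega | simp

theorem delPow_zero : delPow d 0 = 1 := rfl

theorem delPow_one : delPow d 1 = del d := rfl

theorem delPow_mul_delPow (m n : ℤ) : delPow d m * delPow d n = delPow d (m + n) := by
  ext k
  rw [coeff_mul_delPow, coeff_delPow, coeff_delPow]
  simp only [sub_eq_iff_eq_add]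

theorem const_mul_delPow (n : ℤ) (a : V) : const d a * delPow d n = monomial d n a := by
  ext k
  rw [coeff_const_mul, coeff_delPow, coeff_monomial, mul_ite, mul_one, mul_zero]

theorem del_pow (n : ℕ) : del d ^ n = delPow d n := by
  induction n with
  | zero => rw [pow_zero, Nat.cast_zero, delPow_zero]
  | succ n ih => rw [pow_succ, ih, ← delPow_one, delPow_mul_delPow, Nat.cast_succ]

theorem smul_mul (a : V) (A B : PsiDO d) : a • A * B = a • (A * B) := by
  rw [← const_mul_eq_smul, ← const_mul_eq_smul, mul_assoc]

/-- `A` has order at most `N`. -/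
def OrdLE (A : PsiDO d) (N : ℤ) : Prop := ∀ n, N < n → A.coeff n = 0

theorem exists_ordLE (A : PsiDO d) : ∃ N, A.OrdLE N := A.bdd

theorem OrdLE.mul {A B : PsiDO d} {M N : ℤ} (hA : A.OrdLE M) (hB : B.OrdLE N) :
    (A * B).OrdLE (M + N) := fun k hk => finsum_eq_zero_of_forall_eq_zero fun q => by
  by_contra hq
  have := mul_support _ _ M N k hA hB q hq
  omega

theorem ordLE_monomial (n : ℤ) (a : V) : (monomial d n a).OrdLE n := fun m hm => by
  rw [coeff_monomial, if_neg hm.ne']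

/-- An additive map which kills all operators of sufficiently low order and all monomials
vanishes. -/
theorem hom_eq_zero {G : Type*} [AddCommGroup G] (f : PsiDO d →+ G) (N : ℤ)
    (h : ∀ A : PsiDO d, A.OrdLE N → f A = 0) (hm : ∀ n a, f (monomial d n a) = 0) : f = 0 := by
  ext A
  obtain ⟨M, hM⟩ := A.exists_ordLE
  -- Only finitely many orders lie above the cutoff N, so A is a finite sum of monomials plus an
  -- operator that f kills.
  have key : A - ∑ n ∈ Finset.Ioc N M, monomial d n (A.coeff n) ∈ {B : PsiDO d | B.OrdLE N} := by
    intro n hn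
    simp only [coeff_sub, coeff_sum, coeff_monomial, Finset.sum_ite_eq, Finset.mem_Ioc]
    split_ifs with h'
    · exact sub_self _
    · rw [hM n (by omega), sub_zero]
  have := h _ key
  rw [map_sub, map_sum, Finset.sum_eq_zero fun n _ => hm n _, sub_zero] at this
  simpa using this

/-! ### The formal adjoint as an involutive anti-automorphism. -/

theorem adjoint_support (A : PsiDO d) (k : ℤ) : Function.HasFiniteSupport fun j : ℕ =>
    (((k + j).negOnePow : ℤ) * Ring.choose (k + j) j) • d^[j] (A.coeff (k + j)) := by
  obtain ⟨N, hN⟩ := A.bdd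
  refine (Set.finite_Iic (N - k).toNat).subset fun j hj => ?_
  by_contra h
  simp only [Set.mem_Iic, not_le] at h
  exact hj (by simp only [hN (k + j) (by omega), iterate_zero', smul_zero])

/-- The formal adjoint as an additive map. -/
noncomputable def adjointHom (d : Derivation F V V) : PsiDO d →+ PsiDO d :=
  AddMonoidHom.mk' adjoint fun A B => by
    ext k
    rw [coeff_add]
    unfold adjoint
    dsimp only
    rw [← finsum_add_distrib (adjoint_support A k) (adjoint_support B k)]
    exact finsum_congr fun j => by rw [coeff_add, iterate_map_add, smul_add]

@[simp] theorem adjointHom_apply (A : PsiDO d) : adjointHom d A = A.adjoint := rfl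

theorem coeff_adjoint (A : PsiDO d) (k : ℤ) : A.adjoint.coeff k = ∑ᶠ j : ℕ,
    (((k + j).negOnePow : ℤ) * Ring.choose (k + j) j) • d^[j] (A.coeff (k + j)) := rfl

theorem adjoint_add (A B : PsiDO d) : (A + B).adjoint = A.adjoint + B.adjoint :=
  map_add (adjointHom d) A B

theorem adjoint_zero : (0 : PsiDO d).adjoint = 0 := map_zero (adjointHom d)

theorem adjoint_zsmul (n : ℤ) (A : PsiDO d) : (n • A).adjoint = n • A.adjoint :=
  map_zsmul (adjointHom d) n A

theorem adjoint_sum {ι : Type*} (s : Finset ι) (f : ι → PsiDO d) :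
    (∑ i ∈ s, f i).adjoint = ∑ i ∈ s, (f i).adjoint := map_sum (adjointHom d) f s

theorem adjoint_smul (c : F) (A : PsiDO d) : (c • A).adjoint = c • A.adjoint := by
  ext k
  rw [coeff_adjoint, coeff_smul, coeff_adjoint, smul_finsum]
  exact finsum_congr fun j => by rw [coeff_smul, iterate_smul, smul_comm]

theorem OrdLE.adjoint {A : PsiDO d} {N : ℤ} (hA : A.OrdLE N) : A.adjoint.OrdLE N := fun k hk =>
  finsum_eq_zero_of_forall_eq_zero fun j => by
    rw [hA _ (by omega), iterate_zero', smul_zero]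

theorem adjoint_monomial (n : ℤ) (a : V) :
    (monomial d n a).adjoint = (n.negOnePow : ℤ) • (delPow d n * const d a) := by
  ext k
  rw [coeff_smul, delPow, coeff_monomial_mul_const, coeff_adjoint]
  split_ifs with h
  · rw [finsum_eq_single _ (n - k).toNat]
    · rw [coeff_monomial, if_pos (by omega), one_mul, mul_smul, show k + ((n - k).toNat : ℤ) = n by omega]
    · intro j hj
      rw [coeff_monomial, if_neg (by omega), iterate_zero', smul_zero]
  · rw [smul_zero]
    refine finsum_eq_zero_of_forall_eq_zero fun j => ?_
    rw [coeff_monomial, if_neg (by omega), iterate_zero', smul_zero]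

theorem adjoint_delPow (n : ℤ) : (delPow d n).adjoint = (n.negOnePow : ℤ) • delPow d n := by
  rw [delPow, adjoint_monomial, const_one, mul_one, delPow]

theorem adjoint_const (a : V) : (const d a).adjoint = const d a := by
  rw [const, adjoint_monomial]
  simp [delPow_zero, const]

/-- The coefficient at ∂^k of either side is additive in B and does not see orders below k, so
`hom_eq_zero` reduces the identity to monomials. The identities for adjoints below follow the same
pattern. -/
theorem adjoint_const_mul (a : V) (B : PsiDO d) : (const d a * B).adjoint = B.adjoint * const d a := by
  ext k
  let f : PsiDO d →+ V := (coeffHom d k).comp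
    ((adjointHom d).comp (AddMonoidHom.mulLeft (const d a)) -
      (AddMonoidHom.mulRight (const d a)).comp (adjointHom d))
  have hf : f = 0 := by
    refine hom_eq_zero f (k - 1) (fun A hA => ?_) fun n b => ?_
    · have h1 := ((ordLE_monomial (d := d) 0 a).mul hA).adjoint k (by omega)
      have h2 := (hA.adjoint.mul (ordLE_monomial (d := d) 0 a)) k (by omega)
      simp only [f, AddMonoidHom.comp_apply, AddMonoidHom.sub_apply, AddMonoidHom.coe_mulLeft,
        AddMonoidHom.coe_mulRight, adjointHom_apply, coeffHom_apply, coeff_sub, const, h1, h2,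
        sub_zero]
    · simp only [f, AddMonoidHom.comp_apply, AddMonoidHom.sub_apply, AddMonoidHom.coe_mulLeft,
        AddMonoidHom.coe_mulRight, adjointHom_apply, coeffHom_apply]
      rw [← const_mul_delPow, ← mul_assoc, const_mul_const, const_mul_delPow, const_mul_delPow,
        adjoint_monomial, adjoint_monomial, smul_mul_assoc, mul_assoc, const_mul_const, mul_comm b,
        sub_self, coeff_zero]
  have := DFunLike.congr_fun hf B
  simpa [f, sub_eq_zero] using this

theorem negOnePow_succ_smul {G : Type*} [AddCommGroup G] (n : ℤ) (x : G) :
    ((n + 1).negOnePow : ℤ) • x = -((n.negOnePow : ℤ) • x) := by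
  rw [Int.negOnePow_succ, Units.val_neg, neg_smul]

theorem negOnePow_add_smul {G : Type*} [AddCommGroup G] (m n : ℤ) (x : G) :
    ((m + n).negOnePow : ℤ) • x = (m.negOnePow : ℤ) • (n.negOnePow : ℤ) • x := by
  rw [Int.negOnePow_add, Units.val_mul, mul_smul]

theorem negOnePow_smul_self {G : Type*} [AddCommGroup G] (n : ℤ) (x : G) :
    (n.negOnePow : ℤ) • (n.negOnePow : ℤ) • x = x := by
  rw [← negOnePow_add_smul, Int.negOnePow_even _ ⟨n, rfl⟩]
  simp

theorem adjoint_del_mul (B : PsiDO d) : (del d * B).adjoint = -(B.adjoint * del d) := by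
  ext k
  let f : PsiDO d →+ V := (coeffHom d k).comp
    ((adjointHom d).comp (AddMonoidHom.mulLeft (del d)) +
      (AddMonoidHom.mulRight (del d)).comp (adjointHom d))
  have hf : f = 0 := by
    -- The cutoff is one lower than for a multiplication operator because ∂ raises the order by one.
    refine hom_eq_zero f (k - 2) (fun A hA => ?_) fun n b => ?_
    · have h1 := ((ordLE_monomial (d := d) 1 1).mul hA).adjoint k (by omega)
      have h2 := (hA.adjoint.mul (ordLE_monomial (d := d) 1 1)) k (by omega)
      simp only [f, AddMonoidHom.comp_apply, AddMonoidHom.add_apply, AddMonoidHom.coe_mulLeft,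
        AddMonoidHom.coe_mulRight, adjointHom_apply, coeffHom_apply, coeff_add, del, h1, h2,
        add_zero]
    · simp only [f, AddMonoidHom.comp_apply, AddMonoidHom.add_apply, AddMonoidHom.coe_mulLeft,
        AddMonoidHom.coe_mulRight, adjointHom_apply, coeffHom_apply]
      rw [adjoint_monomial, ← const_mul_delPow, ← mul_assoc, del_mul_const, add_mul, mul_assoc,
        ← delPow_one, delPow_mul_delPow, add_comm 1 n, const_mul_delPow, const_mul_delPow,
        adjoint_add, adjoint_monomial, adjoint_monomial, negOnePow_succ_smul, smul_mul_assoc,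
        ← delPow_mul_delPow, mul_assoc (delPow d n), mul_assoc (delPow d n), delPow_one,
        del_mul_const, mul_add, smul_add]
      rw [show ∀ x y : PsiDO d, -(x + y) + y + x = 0 from fun x y => by abel]
      rfl
  have := DFunLike.congr_fun hf B
  simpa [f, add_eq_zero_iff_eq_neg] using this

/-- Induction on n in both directions from the case of ∂; the case of ∂⁻¹ follows by applying that
case to ∂⁻¹ ∘ B and cancelling. -/
theorem adjoint_delPow_mul (n : ℤ) (B : PsiDO d) :
    (delPow d n * B).adjoint = B.adjoint * (delPow d n).adjoint := by
  have h1 : ∀ B : PsiDO d, (delPow d (-1) * B).adjoint = -(B.adjoint * delPow d (-1)) := by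
    intro B
    have := adjoint_del_mul (delPow d (-1) * B)
    rw [← delPow_one, ← mul_assoc, delPow_mul_delPow, show (1 : ℤ) + -1 = 0 by ring, delPow_zero,
      one_mul] at this
    rw [this, neg_mul, neg_neg, mul_assoc, delPow_mul_delPow, show (1 : ℤ) + -1 = 0 by ring,
      delPow_zero, mul_one]
  induction n generalizing B with
  | zero => rw [adjoint_delPow]; simp [delPow_zero]
  | succ n ih =>
    rw [← delPow_mul_delPow, mul_assoc, ih, ih, delPow_one, adjoint_del_mul,
      show (del d).adjoint = -del d by rw [← delPow_one, adjoint_delPow]; simp]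
    simp only [neg_mul, mul_assoc]
    rw [mul_neg]
  | pred n ih =>
    rw [show -(n : ℤ) - 1 = -n + -1 by ring, ← delPow_mul_delPow, mul_assoc, ih, ih, h1,
      show (delPow d (-1)).adjoint = -delPow d (-1) by rw [adjoint_delPow]; simp]
    simp only [neg_mul, mul_assoc]
    rw [mul_neg]

/-- A monomial a∂^n is the product of a multiplication operator and a power of ∂, for which the rule
is known. A general A is reached by truncation, with a cutoff lowered by the order of B. -/
theorem adjoint_mul (A B : PsiDO d) : (A * B).adjoint = B.adjoint * A.adjoint := by
  ext k
  obtain ⟨N, hN⟩ := B.exists_ordLE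
  let f : PsiDO d →+ V := (coeffHom d k).comp
    ((adjointHom d).comp (AddMonoidHom.mulRight B) -
      (AddMonoidHom.mulLeft B.adjoint).comp (adjointHom d))
  have hf : f = 0 := by
    refine hom_eq_zero f (k - 1 - N) (fun A hA => ?_) fun n b => ?_
    · have h1 := (hA.mul hN).adjoint k (by omega)
      have h2 := (hN.adjoint.mul hA.adjoint) k (by omega)
      simp only [f, AddMonoidHom.comp_apply, AddMonoidHom.sub_apply, AddMonoidHom.coe_mulLeft,
        AddMonoidHom.coe_mulRight, adjointHom_apply, coeffHom_apply, coeff_sub, h1, h2,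
        sub_zero]
    · simp only [f, AddMonoidHom.comp_apply, AddMonoidHom.sub_apply, AddMonoidHom.coe_mulLeft,
        AddMonoidHom.coe_mulRight, adjointHom_apply, coeffHom_apply]
      rw [← const_mul_delPow, mul_assoc, adjoint_const_mul, adjoint_delPow_mul, adjoint_const_mul,
        mul_assoc, sub_self, coeff_zero]
  have := DFunLike.congr_fun hf A
  simpa [f, sub_eq_zero] using this

theorem adjoint_adjoint (A : PsiDO d) : A.adjoint.adjoint = A := by
  ext k
  let f : PsiDO d →+ V := (coeffHom d k).comp
    ((adjointHom d).comp (adjointHom d) - AddMonoidHom.id _)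
  have hf : f = 0 := by
    refine hom_eq_zero f (k - 1) (fun A hA => ?_) fun n b => ?_
    · have h1 := hA.adjoint.adjoint k (by omega)
      have h2 := hA k (by omega)
      simp [f, h1, h2]
    · simp only [f, AddMonoidHom.comp_apply, AddMonoidHom.sub_apply, adjointHom_apply,
        coeffHom_apply, AddMonoidHom.id_apply]
      rw [adjoint_monomial, adjoint_zsmul, adjoint_mul, adjoint_const, adjoint_delPow, mul_smul_comm,
        negOnePow_smul_self, const_mul_delPow, sub_self, coeff_zero]
  have := DFunLike.congr_fun hf A
  simpa [f, sub_eq_zero] using this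

theorem adjoint_injective : Function.Injective (adjoint : PsiDO d → PsiDO d) :=
  Function.LeftInverse.injective adjoint_adjoint

end Basic

/-! ### Functoriality in the differential algebra. -/

section Map

variable {F V W : Type*} [Field F] [CommRing V] [Algebra F V] [CommRing W] [Algebra F W]
  {d : Derivation F V V} {d' : Derivation F W W}

theorem map_monomial (φ : V →ₐ[F] W) (h : ∀ a, φ (d a) = d' (φ a)) (n : ℤ) (a : V) :
    map φ h (monomial d n a) = monomial d' n (φ a) := by
  ext m
  rw [coeff_map, coeff_monomial, coeff_monomial, apply_ite φ, map_zero]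

theorem map_const (φ : V →ₐ[F] W) (h : ∀ a, φ (d a) = d' (φ a)) (a : V) :
    map φ h (const d a) = const d' (φ a) := map_monomial φ h 0 a

theorem map_delPow (φ : V →ₐ[F] W) (h : ∀ a, φ (d a) = d' (φ a)) (n : ℤ) :
    map φ h (delPow d n) = delPow d' n := by
  rw [delPow, map_monomial, map_one, delPow]

theorem map_adjoint (φ : V →ₐ[F] W) (h : ∀ a, φ (d a) = d' (φ a)) (A : PsiDO d) :
    map φ h A.adjoint = (map φ h A).adjoint := by
  ext k
  rw [coeff_map, coeff_adjoint, coeff_adjoint, map_finsum φ (adjoint_support A k)]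
  refine finsum_congr fun j => ?_
  rw [map_zsmul, Function.Semiconj.iterate_right (f := φ) (ga := d) (gb := d') h, coeff_map]

theorem map_injective (φ : V →ₐ[F] W) (h : ∀ a, φ (d a) = d' (φ a)) (hφ : Function.Injective φ) :
    Function.Injective (map φ h) := fun A B hAB => by
  ext n
  exact hφ (by rw [← coeff_map φ h, hAB, coeff_map])

end Map

end PsiDO

/-! ### Trilinear densities

A series `∑ a_{m,n,p} λ^m μ^n κ^p` is regarded as the symbol of the trilinear density
`∑ a_{m,n,p} ∂^m(P) ∂^n(Q) ∂^p(R)`. Densities are considered modulo total derivatives, i.e. modulo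
the image of `λ + μ + κ + ∂`. -/

namespace TriSeries

section Permutations

variable {F V : Type*} [Field F] [AddCommGroup V] [Module F V]

/-- Cyclic permutation of the variables. -/
def rot : TriSeries F V →ₗ[F] TriSeries F V where
  toFun x := ⟨fun m n p => x.1 n p m, by
    obtain ⟨N, hN⟩ := x.2
    exact ⟨N, fun m n p h => by have := hN _ _ _ h; tauto⟩⟩
  map_add' _ _ := rfl
  map_smul' _ _ := rfl

/-- Exchange of the last two variables. -/
def swap23 : TriSeries F V →ₗ[F] TriSeries F V where
  toFun x := ⟨fun m n p => x.1 m p n, by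
    obtain ⟨N, hN⟩ := x.2
    exact ⟨N, fun m n p h => by have := hN _ _ _ h; tauto⟩⟩
  map_add' _ _ := rfl
  map_smul' _ _ := rfl

theorem rot_apply (x : TriSeries F V) (m n p : ℤ) : (rot x).1 m n p = x.1 n p m := rfl

theorem swap23_apply (x : TriSeries F V) (m n p : ℤ) : (swap23 x).1 m n p = x.1 m p n := rfl

theorem swap23_swap23 (x : TriSeries F V) : swap23 (swap23 x) = x := rfl

end Permutations

variable {F V : Type*} [Field F] [CommRing V] [Algebra F V] (d : Derivation F V V)

/-- The coefficient of `μ^n κ^p`, as a pseudodifferential operator in the first variable. -/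
def slice (x : TriSeries F V) (n p : ℤ) : PsiDO d where
  coeff m := x.1 m n p
  bdd := by
    obtain ⟨N, hN⟩ := x.2
    refine ⟨N, fun m hm => ?_⟩
    by_contra h
    exact absurd (hN _ _ _ h).1 (not_le.mpr hm)

variable {d}

@[simp] theorem coeff_slice (x : TriSeries F V) (m n p : ℤ) :
    (slice d x n p).coeff m = x.1 m n p := rfl

theorem slice_add (x y : TriSeries F V) (n p : ℤ) :
    slice d (x + y) n p = slice d x n p + slice d y n p := rfl

theorem slice_smul (c : F) (x : TriSeries F V) (n p : ℤ) :
    slice d (c • x) n p = c • slice d x n p := rfl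

theorem slice_eq_zero {x : TriSeries F V} {n p : ℤ} (h : ∀ m, x.1 m n p = 0) :
    slice d x n p = 0 := PsiDO.ext (funext h)

/-- Substitution of an operator into the first argument. -/
noncomputable def act1 (A : PsiDO d) : TriSeries F V →ₗ[F] TriSeries F V where
  toFun x := ⟨fun m n p => (slice d x n p * A).coeff m, by
    obtain ⟨N, hN⟩ := x.2
    obtain ⟨a, ha⟩ := A.exists_ordLE
    -- Composition changes the bound on the first exponent by the order a of A, which may be
    -- negative; the other two exponents keep the bound N, hence the maximum.
    refine ⟨max N (N + a), fun m n p h => ?_⟩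
    have h1 : m ≤ N + a := by
      by_contra hm
      refine h (PsiDO.OrdLE.mul (M := N) (fun k hk => ?_) ha m (by omega))
      by_contra h'
      exact absurd (hN _ _ _ h').1 (not_le.mpr hk)
    have h2 : ∃ m', x.1 m' n p ≠ 0 := by
      by_contra! h'
      exact h (by dsimp only; rw [slice_eq_zero h', zero_mul, PsiDO.coeff_zero])
    obtain ⟨m', h2⟩ := h2
    have := hN _ _ _ h2
    omega⟩
  map_add' x y := by
    ext m n p
    simp only [slice_add, add_mul, PsiDO.coeff_add, Submodule.coe_add, Pi.add_apply]
  map_smul' c x := by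
    ext m n p
    simp only [slice_smul, smul_mul_assoc, PsiDO.coeff_smul, Submodule.coe_smul, Pi.smul_apply,
      RingHom.id_apply]

theorem act1_apply (A : PsiDO d) (x : TriSeries F V) (m n p : ℤ) :
    (act1 A x).1 m n p = (slice d x n p * A).coeff m := rfl

theorem slice_act1 (A : PsiDO d) (x : TriSeries F V) (n p : ℤ) :
    slice d (act1 A x) n p = slice d x n p * A := rfl

/-- Substitution of an operator into the second argument. -/
noncomputable def act2 (A : PsiDO d) : TriSeries F V →ₗ[F] TriSeries F V :=
  rot ∘ₗ act1 A ∘ₗ rot ∘ₗ rot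

/-- Substitution of an operator into the third argument. -/
noncomputable def act3 (A : PsiDO d) : TriSeries F V →ₗ[F] TriSeries F V :=
  rot ∘ₗ rot ∘ₗ act1 A ∘ₗ rot

theorem act2_apply (A : PsiDO d) (x : TriSeries F V) (m n p : ℤ) :
    (act2 A x).1 m n p = (slice d (rot (rot x)) p m * A).coeff n := rfl

theorem swap23_act2 (A : PsiDO d) (x : TriSeries F V) :
    swap23 (act2 A x) = act3 A (swap23 x) := rfl

theorem act1_one (x : TriSeries F V) : act1 (1 : PsiDO d) x = x := by
  ext m n p
  rw [act1_apply, mul_one, coeff_slice]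

theorem act1_act1 (A B : PsiDO d) (x : TriSeries F V) : act1 B (act1 A x) = act1 (A * B) x := by
  ext m n p
  rw [act1_apply, act1_apply, slice_act1, mul_assoc]

theorem act1_add (A B : PsiDO d) (x : TriSeries F V) :
    act1 (A + B) x = act1 A x + act1 B x := by
  ext m n p
  simp only [Submodule.coe_add, Pi.add_apply, act1_apply, mul_add, PsiDO.coeff_add]

theorem act1_smul (c : F) (A : PsiDO d) (x : TriSeries F V) :
    act1 (c • A) x = c • act1 A x := by
  ext m n p
  simp only [Submodule.coe_smul, Pi.smul_apply, act1_apply, mul_smul_comm, PsiDO.coeff_smul]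

/-- The series `(∑ A_m λ^m) (∑ c_n μ^n) κ^p`. -/
def pure (A c : PsiDO d) (p : ℤ) : TriSeries F V :=
  ⟨fun m n p' => if p' = p then c.coeff n * A.coeff m else 0, by
    obtain ⟨M, hM⟩ := A.bdd
    obtain ⟨N, hN⟩ := c.bdd
    refine ⟨max (max M N) p, fun m n p' h => ?_⟩
    have h1 : p' = p := by
      by_contra h'
      exact h (if_neg h')
    have h2 : m ≤ M := by
      by_contra h'
      exact h (by dsimp only; rw [hM m (by omega), mul_zero, ite_self])
    have h3 : n ≤ N := by
      by_contra h'
      exact h (by dsimp only; rw [hN n (by omega), zero_mul, ite_self])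
    omega⟩

theorem pure_apply (A c : PsiDO d) (p m n p' : ℤ) :
    (pure A c p).1 m n p' = if p' = p then c.coeff n * A.coeff m else 0 := rfl

theorem slice_pure (A c : PsiDO d) (p n p' : ℤ) :
    slice d (pure A c p) n p' = if p' = p then c.coeff n • A else 0 := by
  ext m
  rw [coeff_slice, pure_apply]
  split_ifs <;> simp

theorem act1_pure (A c B : PsiDO d) (p : ℤ) : act1 B (pure A c p) = pure (A * B) c p := by
  ext m n p'
  rw [act1_apply, slice_pure, pure_apply]
  split_ifs
  · rw [PsiDO.smul_mul, PsiDO.coeff_smul, smul_eq_mul]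
  · rw [zero_mul, PsiDO.coeff_zero]

theorem act2_pure (A c B : PsiDO d) (p : ℤ) : act2 B (pure A c p) = pure A (c * B) p := by
  ext m n p'
  have : slice d (rot (rot (pure A c p))) p' m = if p' = p then A.coeff m • c else 0 := by
    ext n'
    rw [coeff_slice, rot_apply, rot_apply, pure_apply]
    split_ifs <;> simp [mul_comm]
  rw [act2_apply, this, pure_apply]
  split_ifs
  · rw [PsiDO.smul_mul, PsiDO.coeff_smul, smul_eq_mul, mul_comm]
  · rw [zero_mul, PsiDO.coeff_zero]

/-- All terms `λ^m μ^n κ^p` of `x` have `n + p ≤ D`. -/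
def DegLE (x : TriSeries F V) (D : ℤ) : Prop := ∀ m n p, D < n + p → x.1 m n p = 0

theorem DegLE.slice {x : TriSeries F V} {D : ℤ} (hx : DegLE x D) {n p : ℤ} (h : D < n + p) :
    slice d x n p = 0 := slice_eq_zero fun m => hx m n p h

theorem DegLE.act1 {x : TriSeries F V} {D : ℤ} (hx : DegLE x D) (A : PsiDO d) :
    DegLE (act1 A x) D := fun m n p h => by
  rw [act1_apply, hx.slice h, zero_mul, PsiDO.coeff_zero]

theorem DegLE.act2 {x : TriSeries F V} {D a : ℤ} (hx : DegLE x D) {A : PsiDO d}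
    (hA : A.OrdLE a) : DegLE (TriSeries.act2 A x) (D + a) := fun m n p h => by
  rw [act2_apply]
  refine PsiDO.OrdLE.mul (M := D - p) (fun k hk => ?_) hA n (by omega)
  rw [coeff_slice, rot_apply, rot_apply]
  exact hx m k p (by omega)

/-- An additive map which kills all series of sufficiently low degree in `μ, κ` and all series
`A(λ) μ^n κ^p` vanishes. -/
theorem hom_eq_zero {G : Type*} [AddCommGroup G] (d : Derivation F V V) (f : TriSeries F V →+ G)
    (D : ℤ) (h : ∀ x, DegLE x D → f x = 0)
    (hp : ∀ (A : PsiDO d) (n p : ℤ), f (pure A (PsiDO.delPow d n) p) = 0) : f = 0 := by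
  ext x
  obtain ⟨N, hN⟩ := x.2
  -- If n, p ≤ N and n + p > D, then both exponents exceed D - N, so only a finite box of pairs (n,
  -- p) lies above the cutoff.
  have key : DegLE (x - ∑ q ∈ Finset.Icc (D - N) N ×ˢ Finset.Icc (D - N) N,
      pure (slice d x q.1 q.2) (PsiDO.delPow d q.1) q.2) D := by
    intro m n p hnp
    have h1 : ∀ (s : Finset (ℤ × ℤ)) (g : ℤ × ℤ → TriSeries F V),
        (∑ q ∈ s, g q).1 m n p = ∑ q ∈ s, (g q).1 m n p := fun s g => by
      simp only [AddSubmonoidClass.coe_finsetSum, Finset.sum_apply]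
    have h2 : ∀ q : ℤ × ℤ, (pure (slice d x q.1 q.2) (PsiDO.delPow d q.1) q.2).1 m n p =
        if q = (n, p) then x.1 m n p else 0 := fun q => by
      rw [pure_apply, PsiDO.coeff_delPow, coeff_slice]
      obtain ⟨a, b⟩ := q
      simp only [Prod.mk.injEq]
      by_cases h3 : p = b
      · by_cases h4 : n = a
        · subst h3 h4; simp
        · simp [h4, Ne.symm h4]
      · simp [h3, Ne.symm h3]
    change x.1 m n p - (∑ q ∈ Finset.Icc (D - N) N ×ˢ Finset.Icc (D - N) N,
      pure (slice d x q.1 q.2) (PsiDO.delPow d q.1) q.2).1 m n p = 0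
    rw [h1, Finset.sum_congr rfl fun q _ => h2 q, Finset.sum_ite_eq']
    split_ifs with h'
    · exact sub_self _
    · rw [sub_zero]
      by_contra h0
      have := hN _ _ _ h0
      apply h'
      simp only [Finset.mem_product, Finset.mem_Icc]
      omega
  have := h _ key
  rw [map_sub, map_sum, Finset.sum_eq_zero fun q _ => hp _ _ _, sub_zero] at this
  simpa using this

/-- The coefficient of `λ^m μ^n κ^p`. -/
def coeffHom (m n p : ℤ) : TriSeries F V →+ V where
  toFun x := x.1 m n p
  map_zero' := rfl
  map_add' _ _ := rfl

/-- On a series A'(λ) c(μ) κ^p the two substitutions modify different factors and visibly commute.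
The general case follows since a fixed coefficient of either side depends only on the part of x of
large degree in μ, κ. -/
theorem act1_act2 (A B : PsiDO d) (x : TriSeries F V) :
    act1 A (act2 B x) = act2 B (act1 A x) := by
  ext m n p
  obtain ⟨b, hb⟩ := B.exists_ordLE
  let f : TriSeries F V →+ V := (coeffHom (F := F) m n p).comp
    (act1 A ∘ₗ act2 B - act2 B ∘ₗ act1 A : TriSeries F V →ₗ[F] TriSeries F V).toAddMonoidHom
  have hf : f = 0 := by
    refine hom_eq_zero d f (n + p - 1 - b) (fun x hx => ?_) fun A n p => ?_
    · have h1 := ((hx.act2 hb).act1 A) m n p (by omega)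
      have h2 := ((hx.act1 A).act2 hb) m n p (by omega)
      change (act1 A (act2 B x)).1 m n p - (act2 B (act1 A x)).1 m n p = 0
      rw [h1, h2, sub_zero]
    · change (act1 _ (act2 B _)).1 _ _ _ - (act2 B (act1 _ _)).1 _ _ _ = 0
      rw [act2_pure, act1_pure, act1_pure, act2_pure, sub_self]
  have := DFunLike.congr_fun hf x
  exact sub_eq_zero.mp this

variable (d)

/-- Multiplication by `λ + μ + κ + ∂`, i.e. the total derivative of a density. -/
def totalDer : TriSeries F V →ₗ[F] TriSeries F V where
  toFun x := ⟨fun m n p => x.1 (m - 1) n p + x.1 m (n - 1) p + x.1 m n (p - 1) + d (x.1 m n p), by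
    obtain ⟨N, hN⟩ := x.2
    refine ⟨N + 1, fun m n p h => ?_⟩
    by_contra h'
    have h0 : ∀ a b c, ¬ (a ≤ N ∧ b ≤ N ∧ c ≤ N) → x.1 a b c = 0 := fun a b c h1 => by
      by_contra h2
      exact h1 (hN _ _ _ h2)
    apply h
    dsimp only
    rw [h0 _ _ _ (by omega), h0 _ _ _ (by omega), h0 _ _ _ (by omega), h0 _ _ _ (by omega),
      map_zero]
    simp⟩
  map_add' x y := by
    ext m n p
    simp only [Submodule.coe_add, Pi.add_apply, map_add]
    abel
  map_smul' c x := by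
    ext m n p
    simp only [Submodule.coe_smul, Pi.smul_apply, d.map_smul, RingHom.id_apply, smul_add]

theorem totalDer_apply (x : TriSeries F V) (m n p : ℤ) : (totalDer d x).1 m n p =
    x.1 (m - 1) n p + x.1 m (n - 1) p + x.1 m n (p - 1) + d (x.1 m n p) := rfl

theorem slice_totalDer (x : TriSeries F V) (n p : ℤ) : slice d (totalDer d x) n p =
    PsiDO.del d * slice d x n p + slice d x (n - 1) p + slice d x n (p - 1) := by
  ext m
  simp only [coeff_slice, totalDer_apply, PsiDO.coeff_add, PsiDO.coeff_del_mul]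
  abel

theorem totalDer_rot (x : TriSeries F V) : totalDer d (rot x) = rot (totalDer d x) := by
  ext m n p
  simp only [rot_apply, totalDer_apply]
  abel

theorem totalDer_swap23 (x : TriSeries F V) : totalDer d (swap23 x) = swap23 (totalDer d x) := by
  ext m n p
  simp only [swap23_apply, totalDer_apply]
  abel

variable {d}

/-- A substitution multiplies the slices on the right, while the total derivative multiplies them on
the left by ∂ and shifts their indices. -/
theorem totalDer_act1 (A : PsiDO d) (x : TriSeries F V) :
    totalDer d (act1 A x) = act1 A (totalDer d x) := by
  ext m n p
  rw [act1_apply, slice_totalDer, ← coeff_slice (d := d), slice_totalDer]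
  simp only [slice_act1, add_mul, mul_assoc]

end TriSeries

/-! ### Densities modulo total derivatives, with permutations and substitutions. -/

section Density

variable {F V : Type*} [Field F] [CommRing V] [Algebra F V]

/-- Trilinear densities modulo total derivatives. -/
abbrev Density (d : Derivation F V V) : Type _ :=
  TriSeries F V ⧸ LinearMap.range (TriSeries.totalDer d)

namespace Density

variable {d : Derivation F V V}

/-- The density given by a symbol. -/
def mk (x : TriSeries F V) : Density d := Submodule.Quotient.mk x

theorem mk_surjective : Function.Surjective (mk : TriSeries F V → Density d) :=
  Submodule.Quotient.mk_surjective _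

/-- The map of densities induced by a map of symbols which commutes with the total derivative. -/
def lift (f : TriSeries F V →ₗ[F] TriSeries F V)
    (hf : ∀ x, TriSeries.totalDer d (f x) = f (TriSeries.totalDer d x)) :
    Density d →ₗ[F] Density d :=
  Submodule.mapQ _ _ f (by
    rintro _ ⟨x, rfl⟩
    exact ⟨f x, hf x⟩)

variable (d) in
/-- Cyclic permutation of the arguments. -/
def rot : Density d →ₗ[F] Density d := lift TriSeries.rot (TriSeries.totalDer_rot d)

variable (d) in
/-- Exchange of the last two arguments. -/
def swap23 : Density d →ₗ[F] Density d := lift TriSeries.swap23 (TriSeries.totalDer_swap23 d)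

/-- Substitution of an operator into the first argument. -/
noncomputable def act1 (A : PsiDO d) : Density d →ₗ[F] Density d :=
  lift (TriSeries.act1 A) (TriSeries.totalDer_act1 A)

/-- Substitution of an operator into the second argument. -/
noncomputable def act2 (A : PsiDO d) : Density d →ₗ[F] Density d := rot d ∘ₗ act1 A ∘ₗ rot d ∘ₗ rot d

/-- Substitution of an operator into the third argument. -/
noncomputable def act3 (A : PsiDO d) : Density d →ₗ[F] Density d := rot d ∘ₗ rot d ∘ₗ act1 A ∘ₗ rot d

theorem act1_mk (A : PsiDO d) (x : TriSeries F V) : act1 A (mk x) = mk (TriSeries.act1 A x) := rfl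
theorem act2_mk (A : PsiDO d) (x : TriSeries F V) : act2 A (mk x) = mk (TriSeries.act2 A x) := rfl
theorem rot_rot_rot (x : Density d) : rot d (rot d (rot d x)) = x := by
  obtain ⟨x, rfl⟩ := mk_surjective x; rfl

theorem rot_act1 (A : PsiDO d) (x : Density d) : rot d (act1 A x) = act2 A (rot d x) := by
  obtain ⟨x, rfl⟩ := mk_surjective x; rfl

theorem rot_act2 (A : PsiDO d) (x : Density d) : rot d (act2 A x) = act3 A (rot d x) := by
  obtain ⟨x, rfl⟩ := mk_surjective x; rfl

theorem rot_act3 (A : PsiDO d) (x : Density d) : rot d (act3 A x) = act1 A (rot d x) := by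
  obtain ⟨x, rfl⟩ := mk_surjective x; rfl

theorem swap23_act1 (A : PsiDO d) (x : Density d) : swap23 d (act1 A x) = act1 A (swap23 d x) := by
  obtain ⟨x, rfl⟩ := mk_surjective x; rfl

theorem act1_one (x : Density d) : act1 (1 : PsiDO d) x = x := by
  obtain ⟨x, rfl⟩ := mk_surjective x
  rw [act1_mk, TriSeries.act1_one]

theorem act1_act1 (A B : PsiDO d) (x : Density d) : act1 B (act1 A x) = act1 (A * B) x := by
  obtain ⟨x, rfl⟩ := mk_surjective x
  rw [act1_mk, act1_mk, act1_mk, TriSeries.act1_act1]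

theorem act1_add (A B : PsiDO d) (x : Density d) : act1 (A + B) x = act1 A x + act1 B x := by
  obtain ⟨x, rfl⟩ := mk_surjective x
  rw [act1_mk, act1_mk, act1_mk, TriSeries.act1_add]; rfl

theorem act1_smul (c : F) (A : PsiDO d) (x : Density d) : act1 (c • A) x = c • act1 A x := by
  obtain ⟨x, rfl⟩ := mk_surjective x
  rw [act1_mk, act1_mk, TriSeries.act1_smul]; rfl

theorem act1_act2 (A B : PsiDO d) (x : Density d) : act1 A (act2 B x) = act2 B (act1 A x) := by
  obtain ⟨x, rfl⟩ := mk_surjective x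
  rw [act1_mk, act2_mk, act2_mk, act1_mk, TriSeries.act1_act2]

end Density

end Density

/-! ### First-order deformations of pseudodifferential operators -/

theorem finsum_eq_of_fst_eq {ι κ M : Type*} [AddCommMonoid M] (f : ι × κ → M) (i : ι)
    (h : ∀ q, q.1 ≠ i → f q = 0) : ∑ᶠ q, f q = ∑ᶠ j, f (i, j) := by
  have hinj : Function.Injective fun j : κ => (i, j) := fun a b h => by simpa using h
  rw [← finsum_mem_univ, ← finsum_mem_inter_support_eq' (s := Set.range fun j : κ => (i, j)),
    finsum_mem_range hinj]
  rintro ⟨a, b⟩ hq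
  simp only [Set.mem_univ, iff_true, Set.mem_range]
  have : a = i := by
    by_contra h'
    exact hq (h _ h')
  exact ⟨b, by rw [this]⟩

namespace PsiDO

section DualNumbers

variable {F V : Type*} [Field F] [CommRing V] [Algebra F V] {d : Derivation F V V}

noncomputable instance : Module V (PsiDO d) :=
  coeff_injective.module V ⟨⟨coeff, rfl⟩, fun _ _ => rfl⟩ fun _ _ => rfl

noncomputable instance : Module Vᵐᵒᵖ (PsiDO d) :=
  coeff_injective.module Vᵐᵒᵖ ⟨⟨coeff, rfl⟩, fun _ _ => rfl⟩ fun _ _ => rfl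

instance : IsCentralScalar V (PsiDO d) := ⟨fun a A => by
  ext n; simp only [coeff_smul, op_smul_eq_smul]⟩

instance : IsScalarTower F V (PsiDO d) := ⟨fun a b A => by
  ext n; simp only [coeff_smul, smul_assoc]⟩

instance : IsScalarTower F Vᵐᵒᵖ (PsiDO d) := ⟨fun a b A => by
  ext n
  induction b using MulOpposite.rec'
  simp only [coeff_smul, ← MulOpposite.op_smul, op_smul_eq_smul, smul_assoc]⟩

variable (d)

/-- The dual numbers `V ⊕ ε V((λ⁻¹))`. The series in `λ` are written as pseudodifferential
operators. -/
abbrev Dual : Type _ := TrivSqZeroExt V (PsiDO d)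

open TrivSqZeroExt in
/-- The derivation of the dual numbers which extends `∂` and acts by `∂ + λ` on `V((λ⁻¹))`. -/
noncomputable def dualDer : Derivation F (Dual d) (Dual d) :=
  Derivation.mk'
    { toFun := fun w => inl (d w.fst) + inr (del d * w.snd)
      map_add' := fun v w => by
        ext
        · simp
        · simp [mul_add]
      map_smul' := fun c w => by
        ext
        · simp
        · simp }
    (fun v w => by
      ext
      · simp
      · simp only [LinearMap.coe_mk, AddHom.coe_mk, snd_add, snd_inl, snd_inr, fst_mul, snd_mul,
          zero_add, smul_eq_mul, fst_inl, fst_inr, op_smul_eq_smul,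
          ← const_mul_eq_smul, mul_add, ← mul_assoc, del_mul_const]
        simp only [add_mul, mul_assoc, const_zero, mul_zero, zero_mul, add_zero]
        abel_nf)

variable {d}

theorem dualDer_inl (a : V) :
    dualDer d (TrivSqZeroExt.inl a) = TrivSqZeroExt.inl (d a) := by
  change (TrivSqZeroExt.inl (d _) + TrivSqZeroExt.inr _ : Dual d) = _
  simp

theorem dualDer_inr (A : PsiDO d) :
    dualDer d (TrivSqZeroExt.inr A) = TrivSqZeroExt.inr (del d * A) := by
  change (TrivSqZeroExt.inl (d _) + TrivSqZeroExt.inr _ : Dual d) = _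
  simp

theorem dualDer_iterate_inr (A : PsiDO d) (j : ℕ) :
    (dualDer d)^[j] (TrivSqZeroExt.inr A) = TrivSqZeroExt.inr (delPow d j * A) := by
  induction j with
  | zero => rw [Nat.cast_zero, delPow_zero, one_mul]; rfl
  | succ j ih =>
    rw [Function.iterate_succ_apply', ih, dualDer_inr, ← mul_assoc, ← delPow_one,
      delPow_mul_delPow, add_comm, Nat.cast_succ]

variable (d)

/-- The inclusion of the pseudodifferential operators over `V` into those over the dual numbers. -/
noncomputable def dualIncl : PsiDO d →ₐ[F] PsiDO (dualDer d) :=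
  PsiDO.map (TrivSqZeroExt.inlAlgHom F V (PsiDO d)) fun a => (dualDer_inl a).symm

variable {d}

theorem coeff_dualIncl (A : PsiDO d) (n : ℤ) :
    (dualIncl d A).coeff n = TrivSqZeroExt.inl (A.coeff n) := rfl

theorem dualIncl_delPow (n : ℤ) : dualIncl d (delPow d n) = delPow (dualDer d) n :=
  map_delPow _ _ n

theorem dualIncl_adjoint (A : PsiDO d) : dualIncl d A.adjoint = (dualIncl d A).adjoint :=
  map_adjoint _ _ A

theorem OrdLE.dualIncl {A : PsiDO d} {N : ℤ} (hA : A.OrdLE N) :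
    (PsiDO.dualIncl d A).OrdLE N := fun n hn => by
  rw [coeff_dualIncl, hA n hn, TrivSqZeroExt.inl_zero]

end DualNumbers

end PsiDO

/-! ### Expansion of trilinear densities as operators over the dual numbers. -/

namespace TriSeries

variable {F V : Type*} [Field F] [CommRing V] [Algebra F V] {d : Derivation F V V}

open PsiDO

theorem expand_support (x : TriSeries F V) (s : ℤ) : Function.HasFiniteSupport fun q : ℤ × ℕ =>
    ((q.1.negOnePow : ℤ) * Ring.choose q.1 q.2) •
      (delPow d q.2 * slice d x (s - q.1 + q.2) q.1) := by
  obtain ⟨N, hN⟩ := x.2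
  refine (Set.finite_Icc ((s - N, 0) : ℤ × ℕ) (N, (2 * N - s).toNat)).subset fun q hq => ?_
  have : ∃ m, x.1 m (s - q.1 + q.2) q.1 ≠ 0 := by
    by_contra! h
    exact hq (by simp only [slice_eq_zero h, mul_zero, smul_zero])
  obtain ⟨m, hm⟩ := this
  have := hN _ _ _ hm
  simp only [Set.mem_Icc, Prod.le_def]
  omega

variable (d)

/-- The expansion of a density `∫ a ∂^m(P) ∂^n(Q) ∂^p(R)`, as an operator in `Q` with coefficients
in the operators in `P`: the coefficient of `μ^s` in `∑ (-λ-μ-∂)^p a_{m,n,p} λ^m μ^n`. -/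
noncomputable def expand (x : TriSeries F V) (s : ℤ) : PsiDO d :=
  ∑ᶠ q : ℤ × ℕ, ((q.1.negOnePow : ℤ) * Ring.choose q.1 q.2) •
    (delPow d q.2 * slice d x (s - q.1 + q.2) q.1)

variable {d}

theorem expand_eq_zero {x : TriSeries F V} {D : ℤ} (hx : DegLE x D) {s : ℤ} (hs : D < s) :
    expand d x s = 0 :=
  finsum_eq_zero_of_forall_eq_zero fun q => by
    rw [hx.slice (by omega), mul_zero, smul_zero]

theorem exists_degLE (x : TriSeries F V) : ∃ D, DegLE x D := by
  obtain ⟨N, hN⟩ := x.2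
  refine ⟨2 * N, fun m n p h => ?_⟩
  by_contra h'
  have := hN _ _ _ h'
  omega

theorem expand_add (x y : TriSeries F V) (s : ℤ) :
    expand d (x + y) s = expand d x s + expand d y s := by
  unfold expand
  rw [← finsum_add_distrib (expand_support x s) (expand_support y s)]
  exact finsum_congr fun q => by rw [slice_add, mul_add, smul_add]

theorem expand_smul (c : F) (x : TriSeries F V) (s : ℤ) :
    expand d (c • x) s = c • expand d x s := by
  unfold expand
  rw [smul_finsum]
  exact finsum_congr fun q => by rw [slice_smul, mul_smul_comm, smul_comm]

variable (d)

/-- The expansion of a density as a pseudodifferential operator over the dual numbers. -/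
noncomputable def eps : TriSeries F V →ₗ[F] PsiDO (dualDer d) where
  toFun x := ⟨fun s => TrivSqZeroExt.inr (expand d x s), by
    obtain ⟨D, hD⟩ := exists_degLE x
    exact ⟨D, fun s hs => by rw [expand_eq_zero hD hs, TrivSqZeroExt.inr_zero]⟩⟩
  map_add' x y := by
    ext s : 2
    rw [coeff_add]
    dsimp only
    rw [expand_add, TrivSqZeroExt.inr_add]
  map_smul' c x := by
    ext s : 2
    rw [RingHom.id_apply, coeff_smul]
    dsimp only
    rw [expand_smul, TrivSqZeroExt.inr_smul]

variable {d}

theorem coeff_eps (x : TriSeries F V) (s : ℤ) :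
    (eps d x).coeff s = TrivSqZeroExt.inr (expand d x s) := rfl

theorem DegLE.eps {x : TriSeries F V} {D : ℤ} (hx : DegLE x D) : (eps d x).OrdLE D := fun s hs => by
  rw [coeff_eps, expand_eq_zero hx hs, TrivSqZeroExt.inr_zero]

theorem eps_mul_eps (x y : TriSeries F V) : eps d x * eps d y = 0 := by
  ext k : 2
  rw [coeff_mul]
  refine finsum_eq_zero_of_forall_eq_zero fun q => ?_
  rw [coeff_eps, coeff_eps, dualDer_iterate_inr, TrivSqZeroExt.inr_mul_inr, smul_zero]

/-- Moving ∂^p off R in ∫ (A P)(c Q) ∂^p R leaves the operator (-∂)^p ∘ (A P) ∘ c applied to Q, and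
the factor A P is stored in the ε-part. -/
theorem eps_pure (A c : PsiDO d) (p : ℤ) : eps d (pure A c p) =
    (p.negOnePow : ℤ) • (delPow (dualDer d) p *
      (const (dualDer d) (TrivSqZeroExt.inr A) * dualIncl d c)) := by
  ext s : 2
  rw [coeff_eps, coeff_smul, delPow, coeff_monomial_mul, expand, finsum_eq_of_fst_eq _ p]
  · let φ : PsiDO d →+ Dual d := TrivSqZeroExt.inrHom V (PsiDO d)
    change φ _ = _
    rw [map_finsum φ, smul_finsum' _ ?_]
    · refine finsum_congr fun j => ?_
      rw [map_zsmul, slice_pure, if_pos rfl, one_mul, coeff_const_mul, coeff_dualIncl,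
        TrivSqZeroExt.inr_mul_inl, op_smul_eq_smul, dualDer_iterate_inr, mul_smul]
      rfl
    · obtain ⟨N, hN⟩ := c.bdd
      refine (Set.finite_Iic (N - s + p).toNat).subset fun j hj => ?_
      by_contra h
      simp only [Set.mem_Iic, not_le] at h
      refine hj ?_
      simp only [coeff_const_mul, coeff_dualIncl, hN (s - p + j) (by omega)]
      rw [TrivSqZeroExt.inl_zero, mul_zero, iterate_zero', mul_zero, smul_zero]
    · have h := (expand_support (d := d) (pure A c p) s).comp_of_injective
        (g := fun j : ℕ => ((p, j) : ℤ × ℕ)) (fun a b h => by simpa using h)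
      exact h
  · intro q hq
    rw [slice_pure, if_neg hq, mul_zero, smul_zero]

/-- The expansion is an operator acting on Q, so replacing Q by BQ composes with B on the right; by
`eps_pure` this is plain associativity on the generators. -/
theorem eps_act2 (B : PsiDO d) (x : TriSeries F V) :
    eps d (act2 B x) = eps d x * dualIncl d B := by
  ext s : 2
  obtain ⟨b, hb⟩ := B.exists_ordLE
  let f : TriSeries F V →+ Dual d := (PsiDO.coeffHom (dualDer d) s).comp
    (((eps d).toAddMonoidHom.comp (act2 B).toAddMonoidHom) -
      (AddMonoidHom.mulRight (dualIncl d B)).comp (eps d).toAddMonoidHom)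
  have hf0 : ∀ x, f x = (eps d (act2 B x)).coeff s - (eps d x * dualIncl d B).coeff s :=
    fun x => rfl
  have hf : f = 0 := by
    refine hom_eq_zero d f (s - 1 - b) (fun x hx => ?_) fun A n p => ?_
    · rw [hf0, (hx.act2 hb).eps s (by omega), (hx.eps.mul hb.dualIncl) s (by omega), sub_zero]
    · rw [hf0, act2_pure, eps_pure, eps_pure, map_mul, smul_mul_assoc]
      simp only [mul_assoc, sub_self]
  exact sub_eq_zero.mp ((hf0 x).symm.trans (DFunLike.congr_fun hf x))

theorem swap23_pure (A : PsiDO d) (n p : ℤ) :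
    swap23 (pure A (delPow d n) p) = pure A (delPow d p) n := by
  ext a b c
  rw [swap23_apply, pure_apply, pure_apply, coeff_delPow, coeff_delPow]
  split_ifs <;> simp

theorem DegLE.swap23 {x : TriSeries F V} {D : ℤ} (hx : DegLE x D) : DegLE (swap23 x) D :=
  fun m n p h => hx m p n (by omega)

/-- Pairing the operator applied to Q with R and integrating by parts exchanges the roles of Q and
R. On generators, the adjoint of (-∂)^p ∘ εA ∘ ∂^n is (-∂)^n ∘ εA ∘ ∂^p. -/
theorem adjoint_eps (x : TriSeries F V) : (eps d x).adjoint = eps d (swap23 x) := by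
  ext s : 2
  let f : TriSeries F V →+ Dual d := (PsiDO.coeffHom (dualDer d) s).comp
    (((adjointHom _).comp (eps d).toAddMonoidHom) -
      ((eps d).toAddMonoidHom.comp swap23.toAddMonoidHom))
  have hf0 : ∀ x, f x = (eps d x).adjoint.coeff s - (eps d (swap23 x)).coeff s :=
    fun x => rfl
  have hf : f = 0 := by
    refine hom_eq_zero d f (s - 1) (fun x hx => ?_) fun A n p => ?_
    · rw [hf0, hx.eps.adjoint s (by omega), hx.swap23.eps s (by omega), sub_zero]
    · rw [hf0, swap23_pure, eps_pure, eps_pure, adjoint_zsmul, adjoint_mul, adjoint_mul,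
        dualIncl_delPow, dualIncl_delPow, adjoint_delPow, adjoint_delPow, adjoint_const,
        mul_smul_comm, negOnePow_smul_self, smul_mul_assoc, smul_mul_assoc, mul_assoc, sub_self]
  exact sub_eq_zero.mp ((hf0 x).symm.trans (DFunLike.congr_fun hf x))

/-- Conjugation of the rule for the second argument by the adjoint; this is why C enters through its
adjoint, on the left. -/
theorem eps_act3 (C : PsiDO d) (x : TriSeries F V) :
    eps d (act3 C x) = dualIncl d C.adjoint * eps d x := by
  rw [← swap23_swap23 x, ← swap23_act2, ← adjoint_eps, eps_act2, adjoint_mul, adjoint_eps,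
    dualIncl_adjoint]

theorem totalDer_pure (A : PsiDO d) (n p : ℤ) : totalDer d (pure A (delPow d n) p) =
    pure (del d * A) (delPow d n) p + pure A (delPow d (n + 1)) p +
      pure A (delPow d n) (p + 1) := by
  ext a b c
  simp only [totalDer_apply, Submodule.coe_add, Pi.add_apply, pure_apply, coeff_delPow,
    coeff_del_mul, sub_eq_iff_eq_add, apply_ite d, map_zero, ite_mul, one_mul, zero_mul]
  split_ifs <;> first | omega | simp

/-- On generators this is the commutation rule ∂ ∘ εA = εA ∘ ∂ + ε(∂ ∘ A): the first product comes
from the term κ with a minus sign, the other two from the terms μ and λ + ∂. -/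
theorem eps_totalDer (x : TriSeries F V) : eps d (totalDer d x) = 0 := by
  ext s : 2
  let f : TriSeries F V →+ Dual d := (PsiDO.coeffHom (dualDer d) s).comp
    ((eps d).toAddMonoidHom.comp (totalDer d).toAddMonoidHom)
  have hf0 : ∀ x, f x = (eps d (totalDer d x)).coeff s := fun x => rfl
  have hf : f = 0 := by
    refine hom_eq_zero d f (s - 2) (fun x hx => ?_) fun A n p => ?_
    · rw [hf0]
      refine DegLE.eps (D := s - 1) (fun m n p h => ?_) s (by omega)
      rw [totalDer_apply, hx _ _ _ (by omega), hx _ _ _ (by omega), hx _ _ _ (by omega),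
        hx _ _ _ (by omega)]
      simp
    · have e : delPow (dualDer d) (n + 1) = del (dualDer d) * delPow (dualDer d) n := by
        rw [← delPow_one, delPow_mul_delPow, add_comm]
      rw [hf0, totalDer_pure, map_add, map_add, eps_pure, eps_pure, eps_pure, negOnePow_succ_smul,
        dualIncl_delPow, dualIncl_delPow, e, ← delPow_mul_delPow, delPow_one,
        mul_assoc (delPow _ p), ← mul_assoc (del _), del_mul_const, dualDer_inr, add_mul, mul_add,
        smul_add, mul_assoc]
      rw [show ∀ x y : PsiDO (dualDer d), x + y + -(y + x) = 0 from fun x y => by abel]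
      rfl
  exact (hf0 x).symm.trans (DFunLike.congr_fun hf x)

end TriSeries

/-! ### The expansion on densities modulo total derivatives. -/

namespace Density

variable {F V : Type*} [Field F] [CommRing V] [Algebra F V] {d : Derivation F V V}

open PsiDO

variable (d) in
/-- The expansion of a density as a pseudodifferential operator over the dual numbers. -/
noncomputable def eps : Density d →ₗ[F] PsiDO (dualDer d) :=
  Submodule.liftQ _ (TriSeries.eps d) (by
    rintro _ ⟨x, rfl⟩
    exact TriSeries.eps_totalDer x)

theorem eps_mk (x : TriSeries F V) : eps d (mk x) = TriSeries.eps d x := rfl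

theorem eps_act2 (B : PsiDO d) (x : Density d) : eps d (act2 B x) = eps d x * dualIncl d B := by
  obtain ⟨x, rfl⟩ := mk_surjective x
  exact TriSeries.eps_act2 B x

theorem eps_act3 (C : PsiDO d) (x : Density d) :
    eps d (act3 C x) = dualIncl d C.adjoint * eps d x := by
  obtain ⟨x, rfl⟩ := mk_surjective x
  exact TriSeries.eps_act3 C x

theorem adjoint_eps (x : Density d) : (eps d x).adjoint = eps d (swap23 d x) := by
  obtain ⟨x, rfl⟩ := mk_surjective x
  exact TriSeries.adjoint_eps x

theorem eps_mul_eps (x y : Density d) : eps d x * eps d y = 0 := by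
  obtain ⟨x, rfl⟩ := mk_surjective x
  obtain ⟨y, rfl⟩ := mk_surjective y
  exact TriSeries.eps_mul_eps x y

end Density

/-! ### Injectivity of the expansions of `V_{λ,μ}` -/

section Injectivity

variable {F V : Type*} [Field F] [AddCommGroup V] [Module F V]

/-- The coefficients of the quotient of a series by `ν - λ - μ`, computed in the region where the
exponents of `λ` and `μ` are smaller than `N`. -/
def TriSeries.quotCoeff (a : ℤ → ℤ → ℤ → V) (N : ℤ) : ℕ → ℤ → ℤ → V
  | 0, _, _ => 0
  | k + 1, m, n => if m < N ∧ n < N then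
      a m n (N - k) + quotCoeff a N k (m - 1) n + quotCoeff a N k m (n - 1) else 0

theorem TriSeries.quotCoeff_ne_zero {a : ℤ → ℤ → ℤ → V} {N : ℤ} {k : ℕ} {m n : ℤ}
    (h : quotCoeff a N k m n ≠ 0) : 0 < k ∧ m < N ∧ n < N := by
  rcases k with _ | k
  · exact absurd rfl h
  · refine ⟨Nat.succ_pos k, ?_⟩
    by_contra h'
    exact h (if_neg h')

/-- Division by ν - λ - μ, starting from the highest power of ν, removes all terms with both
exponents of λ and μ below N. The quotient is kept zero outside this region so that all exponents
stay bounded, and what remains sits on the faces m = N and n = N. -/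
theorem TriSeries.exists_normalForm (a : TriSeries F V) : ∃ (b : TriSeries F V) (N : ℤ),
    (∀ m n p, (a - mulRelation F V b).1 m n p ≠ 0 → m ≤ N ∧ n ≤ N ∧ p ≤ N) ∧
    ∀ m n p, (a - mulRelation F V b).1 m n p ≠ 0 → m = N ∨ n = N := by
  obtain ⟨N, hN⟩ := a.2
  -- The recursion index is the distance N - p of the ν-exponent from the top; at p ≥ N it is 0 and
  -- the quotient vanishes.
  let b : TriSeries F V := ⟨fun m n p => quotCoeff a.1 N (N - p).toNat m n, N, fun m n p h => by
    have := quotCoeff_ne_zero h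
    omega⟩
  have hb : ∀ m n p, b.1 m n p ≠ 0 → m < N ∧ n < N ∧ p < N := fun m n p h => by
    have := quotCoeff_ne_zero h
    omega
  have hbv : ∀ m n p, b.1 m n p = quotCoeff a.1 N (N - p).toNat m n := fun m n p => rfl
  have hv : ∀ m n p, (a - mulRelation F V b).1 m n p =
      a.1 m n p - (b.1 m n (p - 1) - b.1 (m - 1) n p - b.1 m (n - 1) p) := fun m n p => rfl
  have hbd : ∀ m n p, (a - mulRelation F V b).1 m n p ≠ 0 → m ≤ N ∧ n ≤ N ∧ p ≤ N := by
    intro m n p h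
    by_contra h'
    have h1 : a.1 m n p = 0 := by
      by_contra h0; exact h' (hN _ _ _ h0)
    have h2 : b.1 m n (p - 1) = 0 := by
      by_contra h0; have := hb _ _ _ h0; omega
    have h3 : b.1 (m - 1) n p = 0 := by
      by_contra h0; have := hb _ _ _ h0; omega
    have h4 : b.1 m (n - 1) p = 0 := by
      by_contra h0; have := hb _ _ _ h0; omega
    exact h (by rw [hv, h1, h2, h3, h4]; simp)
  refine ⟨b, N, hbd, fun m n p h => ?_⟩
  by_contra! h'
  have h1 := hbd _ _ _ h
  apply h
  -- The recursive clause for the quotient at ν^{p-1} is exactly the vanishing of the remainder at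
  -- ν^p.
  have h2 : (N - (p - 1)).toNat = (N - p).toNat + 1 := by omega
  rw [hv, hbv m n (p - 1), h2, quotCoeff, if_pos (by omega), ← hbv, ← hbv,
    show N - ((N - p).toNat : ℤ) = p by omega]
  abel

/-- Shifting the upper index to p - P makes the matrix of binomials unitriangular over ℤ, so the
system is solved from p = N downwards without any division. The shift is needed because P may be
negative. -/
theorem sum_choose_smul_eq_zero (g : ℤ → V) (P N : ℤ)
    (h : ∀ j : ℕ, ∑ p ∈ Finset.Icc P N, Ring.choose p j • g p = 0) :
    ∀ p ∈ Finset.Icc P N, g p = 0 := by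
  -- By Vandermonde, the shifted sums are integer combinations of the given ones.
  have h1 : ∀ j : ℕ, ∑ p ∈ Finset.Icc P N, Ring.choose (p - P) j • g p = 0 := fun j => by
    have h2 : ∀ p ∈ Finset.Icc P N, Ring.choose (p - P) j • g p =
        ∑ q ∈ Finset.HasAntidiagonal.antidiagonal j, Ring.choose (-P) q.2 • Ring.choose p q.1 • g p := fun p _ => by
      rw [sub_eq_add_neg, Ring.add_choose_eq _ (Commute.all _ _), Finset.sum_smul]
      exact Finset.sum_congr rfl fun q _ => by rw [smul_smul, mul_comm]
    rw [Finset.sum_congr rfl h2, Finset.sum_comm]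
    refine Finset.sum_eq_zero fun q _ => ?_
    rw [← Finset.smul_sum, h, smul_zero]
  have key : ∀ k : ℕ, ∀ p ∈ Finset.Icc P N, (N - p).toNat = k → g p = 0 := by
    intro k
    induction k using Nat.strong_induction_on with
    | _ k ih =>
      intro p hp hk
      have := h1 (p - P).toNat
      rw [Finset.mem_Icc] at hp
      rw [Finset.sum_eq_single p] at this
      · rwa [show Ring.choose (p - P) (p - P).toNat = 1 by
          obtain ⟨l, hl⟩ : ∃ l : ℕ, p - P = l := ⟨(p - P).toNat, by omega⟩
          rw [hl, Int.toNat_natCast, Ring.choose_natCast, Nat.choose_self, Nat.cast_one],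
          one_smul] at this
      · intro p' hp' hne
        rw [Finset.mem_Icc] at hp'
        rcases lt_or_gt_of_ne hne with hlt | hgt
        · rw [show p' - P = (((p' - P).toNat : ℕ) : ℤ) by omega, Ring.choose_natCast,
            Nat.choose_eq_zero_of_lt (by omega), Nat.cast_zero, zero_smul]
        · rw [ih (N - p').toNat (by omega) p' (Finset.mem_Icc.mpr hp') rfl, smul_zero]
      · intro h'
        exact absurd (Finset.mem_Icc.mpr hp) h'
  exact fun p hp => key _ p hp rfl

theorem expandMuLambda_apply (a : TriSeries F V) (r s : ℤ) : expandMuLambda F V a (r, s) =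
    ∑ᶠ q : ℤ × ℕ, Ring.choose q.1 q.2 • a.1 (r - q.2) (s - q.1 + q.2) q.1 := rfl

/-- The expansion only moves exponents from ν to λ and μ. The face n = N is read off first, away
from the edge m = N, using coefficients of λ^m with m < N; then only m = N is left, where each power
of λ above N isolates a binomial moment of the coefficients. -/
theorem expandMuLambda_normalForm (a : TriSeries F V) (N : ℤ)
    (h1 : ∀ m n p, a.1 m n p ≠ 0 → m ≤ N ∧ n ≤ N ∧ p ≤ N)
    (h2 : ∀ m n p, a.1 m n p ≠ 0 → m = N ∨ n = N) (h : expandMuLambda F V a = 0) : a = 0 := by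
  have e : ∀ r s : ℤ, ∑ᶠ q : ℤ × ℕ, Ring.choose q.1 q.2 • a.1 (r - q.2) (s - q.1 + q.2) q.1 = 0 :=
    fun r s => by rw [← expandMuLambda_apply, h]; rfl
  have z1 : ∀ m n p, ¬ (m ≤ N ∧ n ≤ N ∧ p ≤ N) → a.1 m n p = 0 := fun m n p h' => by
    by_contra h0; exact h' (h1 _ _ _ h0)
  have z2 : ∀ m n p, ¬ (m = N ∨ n = N) → a.1 m n p = 0 := fun m n p h' => by
    by_contra h0; exact h' (h2 _ _ _ h0)
  -- In the coefficient of λ^m μ^{N+p}, a term using j factors λ from the power of ν has λ-exponent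
  -- m - j < N. It therefore needs μ-exponent N, hence ν-exponent p + j; for j > 0 it was already
  -- shown to vanish.
  have step1 : ∀ k : ℕ, ∀ p, (N - p).toNat = k → ∀ m, m < N → a.1 m N p = 0 := by
    intro k
    induction k using Nat.strong_induction_on with
    | _ k ih =>
      intro p hp m hm
      by_cases hpN : p ≤ N
      · have := e m (N + p)
        rw [finsum_eq_single _ ((p, 0) : ℤ × ℕ)] at this
        · simpa using this
        · rintro ⟨q, j⟩ hq
          dsimp only
          by_cases hqj : q = p + j
          · have hj : 0 < j := by
              rcases Nat.eq_zero_or_pos j with h0 | h0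
              · subst h0; exact absurd (by simpa using hqj) (fun h' => hq (by rw [h']))
              · exact h0
            rw [show N + p - q + j = N by omega]
            by_cases hqN : q ≤ N
            · rw [ih (N - q).toNat (by omega) q rfl _ (by omega), smul_zero]
            · rw [z1 _ _ _ (by omega), smul_zero]
          · rw [z2 _ _ _ (by omega), smul_zero]
      · exact z1 _ _ _ (by omega)
  have z3 : ∀ m n p, m ≠ N → a.1 m n p = 0 := fun m n p hm => by
    by_contra h0
    rcases h2 _ _ _ h0 with h' | h'
    · exact hm h'
    · subst h'
      have := h1 _ _ _ h0
      exact h0 (step1 _ p rfl m (by omega))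
  ext m n p
  change a.1 m n p = 0
  by_cases hm : m = N
  · subst hm
    by_contra h0
    have hb := h1 _ _ _ h0
    refine h0 ?_
    -- With first exponent at the bound, fixing the total n + p leaves finitely many ν-exponents p':
    -- from n + p - p' ≤ m and p' ≤ m, where m is now the bound. The moments are the coefficients of
    -- λ^{m+j} μ^{n+p-j}.
    have := sum_choose_smul_eq_zero (fun p' => a.1 m (n + p - p') p') (n + p - m) m (fun j => ?_) p
      (Finset.mem_Icc.mpr (by omega))
    · simpa using this
    · have h3 := e (m + j) (n + p - j)
      let g : ℤ → ℤ × ℕ := fun p' => (p', j)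
      have hg : Function.Injective g := fun x y hxy => by simpa [g] using hxy
      rw [finsum_eq_sum_of_support_subset (s := (Finset.Icc (n + p - m) m).image g),
        Finset.sum_image (fun x _ y _ hxy => hg hxy)] at h3
      · rw [← h3]
        refine Finset.sum_congr rfl fun p' _ => ?_
        dsimp only [g]
        rw [show m + (j : ℤ) - j = m by ring, show n + p - j - p' + j = n + p - p' by ring]
      · rintro ⟨q, l⟩ hq
        have h4 : a.1 (m + j - l) (n + p - j - q + l) q ≠ 0 := fun h' => hq (by
          dsimp only; rw [h', smul_zero])
        have h5 : m + (j : ℤ) - l = m := by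
          by_contra h'
          exact h4 (z3 _ _ _ h')
        have h6 := h1 _ _ _ h4
        have : l = j := by omega
        subst this
        simp only [Finset.coe_image, Set.mem_image, Finset.coe_Icc, Set.mem_Icc, g]
        exact ⟨q, by omega, rfl⟩
  · exact z3 _ _ _ hm

theorem iotaMuLambda_injective : Function.Injective (iotaMuLambda F V) := by
  rw [injective_iff_map_eq_zero]
  intro J hJ
  obtain ⟨a, rfl⟩ := Submodule.Quotient.mk_surjective _ J
  obtain ⟨b, N, h1, h2⟩ := TriSeries.exists_normalForm a
  have h3 : expandMuLambda F V a = 0 := hJ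
  have h4 := expandMuLambda_normalForm _ N h1 h2 (by
    rw [map_sub, h3, zero_sub, neg_eq_zero]
    exact expandMuLambda_mulRelation F V ⟨b, rfl⟩)
  rw [Submodule.Quotient.mk_eq_zero]
  exact ⟨b, (sub_eq_zero.mp h4).symm⟩

end Injectivity

/-! ### Densities as elements of `V_{λ,μ}` -/

namespace TriSeries

variable {F V : Type*} [Field F] [CommRing V] [Algebra F V] (d : Derivation F V V)

open PsiDO

/-- Integration by parts in the last argument: the map `∑ a_{m,n,p} λ^m μ^n κ^p ↦
∑ (-λ-μ-∂)^p a_{m,n,p} λ^m μ^n`, with `ν = λ + μ`. -/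
noncomputable def byParts : TriSeries F V →ₗ[F] TriSeries F V where
  toFun x := ⟨fun m n p => (slice d (rot x) m n).adjoint.coeff p, by
    obtain ⟨N, hN⟩ := x.2
    refine ⟨N, fun m n p h => ?_⟩
    have h1 : p ≤ N := by
      by_contra hp
      refine h (OrdLE.adjoint (N := N) (fun k hk => ?_) p (by omega))
      by_contra h'
      exact absurd (hN _ _ _ h').2.2 (not_le.mpr hk)
    have h2 : ∃ k, x.1 m n k ≠ 0 := by
      by_contra! h'
      exact h (by dsimp only; rw [slice_eq_zero (x := rot x) h', adjoint_zero, coeff_zero])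
    obtain ⟨k, h2⟩ := h2
    have := hN _ _ _ h2
    omega⟩
  map_add' x y := by
    ext m n p
    simp only [map_add, slice_add, adjoint_add, coeff_add, Submodule.coe_add, Pi.add_apply]
  map_smul' c x := by
    ext m n p
    simp only [map_smul, slice_smul, adjoint_smul, coeff_smul, Submodule.coe_smul, Pi.smul_apply,
      RingHom.id_apply]

variable {d}

theorem byParts_apply (x : TriSeries F V) (m n p : ℤ) :
    (byParts d x).1 m n p = (slice d (rot x) m n).adjoint.coeff p := rfl

theorem slice_rot_byParts (x : TriSeries F V) (m n : ℤ) :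
    slice d (rot (byParts d x)) m n = (slice d (rot x) m n).adjoint := rfl

theorem byParts_byParts (x : TriSeries F V) : byParts d (byParts d x) = x := by
  ext m n p
  rw [byParts_apply, slice_rot_byParts, adjoint_adjoint, coeff_slice, rot_apply]

/-- The adjoint in the last variable replaces κ + ∂ by -ν, so λ + μ + κ + ∂ becomes λ + μ - ν. Thus
total derivatives correspond to the relation defining V_{λ,μ}. -/
theorem byParts_totalDer (x : TriSeries F V) :
    byParts d (totalDer d x) = -mulRelation F V (byParts d x) := by
  ext m n p
  rw [byParts_apply, ← totalDer_rot, slice_totalDer, adjoint_add, adjoint_add, adjoint_del_mul,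
    ← delPow_one, coeff_add, coeff_add, coeff_neg, coeff_mul_delPow]
  simp only [← byParts_apply]
  change _ = -((byParts d x).1 m n (p - 1) - (byParts d x).1 (m - 1) n p -
    (byParts d x).1 m (n - 1) p)
  abel

/-- Both sides expand (-λ-μ-∂)^p applied to the coefficients: one separates ∂ from λ + μ first, the
other separates μ from λ + ∂ first. They agree by the factorization of trinomial coefficients. -/
theorem expandMuLambda_byParts (x : TriSeries F V) (r s : ℤ) :
    expandMuLambda F V (byParts d x) (r, s) = (expand d x s).coeff r := by
  let f : TriSeries F V →+ V :=
    AddMonoidHom.mk' (fun x => expandMuLambda F V (byParts d x) (r, s) - (expand d x s).coeff r)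
      (fun x y => by
        rw [map_add, map_add, expand_add, coeff_add, Pi.add_apply]
        abel)
  have hf0 : ∀ x, f x = expandMuLambda F V (byParts d x) (r, s) - (expand d x s).coeff r :=
    fun x => rfl
  have hf : f = 0 := by
    refine hom_eq_zero d f (s - 1) (fun x hx => ?_) fun A n p => ?_
    · rw [hf0, expand_eq_zero hx (by omega), coeff_zero, sub_zero, expandMuLambda_apply]
      refine finsum_eq_zero_of_forall_eq_zero fun q => ?_
      rw [byParts_apply, OrdLE.adjoint (N := s - 1 - (s - q.1 + q.2)) _ _ (by omega), smul_zero]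
      intro k hk
      rw [coeff_slice, rot_apply]
      exact hx _ _ _ (by omega)
    · have hs : ∀ m n', slice d (rot (pure A (delPow d n) p)) m n' =
          if n' = n then monomial d p (A.coeff m) else 0 := fun m n' => by
        ext k
        rw [coeff_slice, rot_apply, pure_apply, coeff_delPow]
        split_ifs <;> simp_all [coeff_monomial]
      have hb : ∀ m n' k, (byParts d (pure A (delPow d n) p)).1 m n' k = if n' = n ∧ k ≤ p then
          (p.negOnePow : ℤ) • Ring.choose p (p - k).toNat • d^[(p - k).toNat] (A.coeff m) else 0 := by
        intro m n' k
        rw [byParts_apply, hs]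
        by_cases h1 : n' = n
        · rw [if_pos h1, adjoint_monomial, coeff_smul, delPow, coeff_monomial_mul_const]
          by_cases h2 : k ≤ p
          · rw [if_pos h2, if_pos ⟨h1, h2⟩, one_mul]
          · rw [if_neg h2, if_neg fun h' => h2 h'.2, smul_zero]
        · rw [if_neg h1, if_neg fun h' => h1 h'.1, adjoint_zero, coeff_zero]
      have he : (expand d (pure A (delPow d n) p) s).coeff r = if s ≤ n + p then
          ((p.negOnePow : ℤ) * Ring.choose p (n + p - s).toNat) •
            (delPow d (n + p - s).toNat * A).coeff r else 0 := by
        rw [expand, finsum_eq_of_fst_eq _ p (fun q hq => by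
          rw [slice_pure, if_neg hq, mul_zero, smul_zero])]
        split_ifs with h
        · rw [finsum_eq_single _ (n + p - s).toNat]
          · rw [slice_pure, if_pos rfl, coeff_delPow, if_pos (by omega), one_smul, coeff_smul]
          · intro j hj
            rw [slice_pure, if_pos rfl, coeff_delPow, if_neg (by omega), zero_smul, mul_zero,
              smul_zero]
        · rw [finsum_eq_zero_of_forall_eq_zero, coeff_zero]
          intro j
          rw [slice_pure, if_pos rfl, coeff_delPow, if_neg (by omega), zero_smul, mul_zero,
              smul_zero]
      rw [hf0, sub_eq_zero, he, expandMuLambda_apply]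
      simp only [hb]
      split_ifs with h
      · obtain ⟨L, hL⟩ : ∃ L : ℕ, n + p - s = L := ⟨(n + p - s).toNat, by omega⟩
        have hL' : (n + p - s).toNat = L := by omega
        -- Of the L factors other than μ, j are derivatives; this leaves ν^{p-j}, from which L - j
        -- powers of λ are taken.
        let g : ℕ → ℤ × ℕ := fun j => (p - j, L - j)
        have hg : Function.Injective g := fun x y hxy => by simpa [g] using (Prod.mk.inj hxy).1
        rw [finsum_eq_sum_of_support_subset (s := (Finset.range (L + 1)).image g),
          Finset.sum_image (fun x _ y _ hxy => hg hxy), hL', delPow, coeff_monomial_mul,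
          finsum_eq_sum_of_support_subset (s := Finset.range (L + 1)), Finset.smul_sum]
        · refine Finset.sum_congr rfl fun j hj => ?_
          rw [Finset.mem_range] at hj
          dsimp only [g]
          rw [if_pos (by omega), show (p - (p - (j : ℤ))).toNat = j by omega, one_mul,
            show r - ((L - j : ℕ) : ℤ) = r - L + j by omega, smul_smul, smul_smul, smul_smul]
          congr 1
          -- Choosing L factors and then j among them equals choosing the j first, also for negative
          -- p.
          have := Ring.choose_smul_choose p (show j ≤ L by omega)
          rw [nsmul_eq_mul] at this
          rw [Ring.choose_natCast]
          linear_combination (-(p.negOnePow : ℤ)) * this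
        · intro j hj
          simp only [Finset.coe_range, Set.mem_Iio]
          by_contra h'
          refine hj ?_
          dsimp only
          rw [Ring.choose_natCast, Nat.choose_eq_zero_of_lt (by omega), Nat.cast_zero, zero_smul]
        · rintro ⟨q, l⟩ hq
          simp only [Finset.coe_image, Set.mem_image, Finset.coe_range, Set.mem_Iio, g]
          have h1 : s - q + l = n ∧ q ≤ p := by
            by_contra h'
            refine hq ?_
            dsimp only
            rw [if_neg h', smul_zero]
          exact ⟨(p - q).toNat, by omega, by rw [Prod.mk.injEq]; omega⟩
      · refine finsum_eq_zero_of_forall_eq_zero fun q => ?_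
        rw [if_neg (by omega), smul_zero]
  exact sub_eq_zero.mp ((hf0 x).symm.trans (DFunLike.congr_fun hf x))

/-- `rot` after `swap23` exchanges the first two variables, which turns one expansion into the
other. -/
theorem expandLambdaMu_byParts (x : TriSeries F V) (r s : ℤ) :
    expandLambdaMu F V (byParts d (rot (swap23 x))) (r, s) = (expand d x r).coeff s := by
  rw [← expandMuLambda_byParts]
  rfl

/-- After two rotations the argument P of x occupies the last place, so integration by parts takes
the adjoint in P; the old Q carries λ and the old R carries μ = ν - λ. -/
theorem expandLambdaNu_byParts (x : TriSeries F V) (r s : ℤ) :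
    expandLambdaNu F V (byParts d (rot (rot x))) (r, s) = (expand d x r).adjoint.coeff s := by
  let φ : PsiDO d →+ V := (PsiDO.coeffHom d s).comp (adjointHom d)
  change _ = φ (expand d x r)
  rw [expand, map_finsum φ (expand_support x r)]
  refine finsum_congr fun q => ?_
  dsimp only
  rw [byParts_apply, map_zsmul]
  change _ = _ • (PsiDO.adjoint _).coeff s
  rw [adjoint_mul, adjoint_delPow, mul_smul_comm, coeff_smul, coeff_mul_delPow, smul_smul,
    Int.negOnePow_sub, Units.val_mul, mul_right_comm]
  rfl

end TriSeries

/-! ### The isomorphism of densities with V_{λ,μ}. -/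

namespace Density

variable {F V : Type*} [Field F] [CommRing V] [Algebra F V] {d : Derivation F V V}

open PsiDO

variable (d) in
/-- The element of `V_{λ,μ}` which represents a density. -/
noncomputable def toVLambdaMu : Density d →ₗ[F] VLambdaMu F V :=
  Submodule.mapQ _ _ (TriSeries.byParts d) (by
    rintro _ ⟨x, rfl⟩
    rw [Submodule.mem_comap, TriSeries.byParts_totalDer]
    exact neg_mem ⟨_, rfl⟩)

theorem toVLambdaMu_mk (x : TriSeries F V) :
    toVLambdaMu d (mk x) = Submodule.Quotient.mk (TriSeries.byParts d x) := rfl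

/-- Integration by parts is an involution on symbols which exchanges, up to sign, the two operators
whose images are divided out. -/
theorem toVLambdaMu_injective : Function.Injective (toVLambdaMu d) := by
  rw [injective_iff_map_eq_zero]
  intro x hx
  obtain ⟨x, rfl⟩ := mk_surjective x
  rw [toVLambdaMu_mk, Submodule.Quotient.mk_eq_zero] at hx
  obtain ⟨y, hy⟩ := hx
  refine (Submodule.Quotient.mk_eq_zero _).mpr ⟨-TriSeries.byParts d y, ?_⟩
  rw [← TriSeries.byParts_byParts (d := d) (TriSeries.totalDer d _), map_neg, map_neg,
    TriSeries.byParts_totalDer, TriSeries.byParts_byParts, neg_neg, hy, TriSeries.byParts_byParts]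

theorem toVLambdaMu_surjective : Function.Surjective (toVLambdaMu d) := fun J => by
  obtain ⟨a, rfl⟩ := Submodule.Quotient.mk_surjective _ J
  exact ⟨mk (TriSeries.byParts d a), by rw [toVLambdaMu_mk, TriSeries.byParts_byParts]⟩

theorem iotaMuLambda_toVLambdaMu (x : Density d) (r s : ℤ) :
    iotaMuLambda F V (toVLambdaMu d x) (r, s) = ((eps d x).coeff s).snd.coeff r := by
  obtain ⟨x, rfl⟩ := mk_surjective x
  exact TriSeries.expandMuLambda_byParts x r s

theorem iotaLambdaMu_toVLambdaMu (x : Density d) (r s : ℤ) :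
    iotaLambdaMu F V (toVLambdaMu d (rot d (swap23 d x))) (r, s) =
      ((eps d x).coeff r).snd.coeff s := by
  obtain ⟨x, rfl⟩ := mk_surjective x
  exact TriSeries.expandLambdaMu_byParts x r s

theorem iotaLambdaNu_toVLambdaMu (x : Density d) (r s : ℤ) :
    iotaLambdaNu F V (toVLambdaMu d (rot d (rot d x))) (r, s) =
      ((eps d x).coeff r).snd.adjoint.coeff s := by
  obtain ⟨x, rfl⟩ := mk_surjective x
  exact TriSeries.expandLambdaNu_byParts x r s

theorem coeff_eps_eq (x : Density d) (s : ℤ) :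
    (eps d x).coeff s = TrivSqZeroExt.inr ((eps d x).coeff s).snd := by
  obtain ⟨x, rfl⟩ := mk_surjective x
  rfl

/-- The coefficients of the expansion are those of ι_{μ,λ} on the corresponding element of V_{λ,μ}.
This allows identities between densities to be verified on operators. -/
theorem eps_injective : Function.Injective (eps d) := by
  rw [injective_iff_map_eq_zero]
  intro x hx
  apply toVLambdaMu_injective
  apply iotaMuLambda_injective
  rw [map_zero, map_zero]
  funext ⟨r, s⟩
  rw [iotaMuLambda_toVLambdaMu, hx]
  rfl

/-- Two densities agree if their expansions do. -/
theorem ext_snd {x y : Density d}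
    (h : ∀ s, ((eps d x).coeff s).snd = ((eps d y).coeff s).snd) : x = y :=
  eps_injective (PsiDO.ext (funext fun s => by rw [coeff_eps_eq, h, ← coeff_eps_eq]))

end Density

/-! ### The hierarchy in terms of closed two-forms -/

/-- The formal rules for trilinear densities and for the variation `D(A)(P, Q, R) = ∫ R X_P(A) Q`
of operators `A`: substitution of operators into the arguments, cyclic permutation of the arguments,
and the Leibniz rule for left factors which are skewadjoint. -/
structure VariationCalculus (R M : Type*) [Ring R] [AddCommGroup M] where
  /-- `ev A B C x` is the density `x(A P, B Q, C R)`. -/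
  ev : R → R → R → M →+ M
  /-- Cyclic permutation of the arguments. -/
  rot : M →+ M
  /-- The variation of an operator. -/
  D : R →+ M
  /-- Skewadjoint operators. -/
  IsSkew : R → Prop
  ev_one : ∀ x, ev 1 1 1 x = x
  ev_ev : ∀ A B C A' B' C' x, ev A' B' C' (ev A B C x) = ev (A * A') (B * B') (C * C') x
  rot_rot_rot : ∀ x, rot (rot (rot x)) = x
  rot_ev : ∀ A B C x, rot (ev A B C x) = ev C A B (rot x)
  D_one : D 1 = 0
  D_mul : ∀ A B, IsSkew A → D (A * B) = ev 1 B 1 (D A) - ev 1 1 A (D B)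

namespace VariationCalculus

variable {R M : Type*} [Ring R] [AddCommGroup M] (𝒞 : VariationCalculus R M)

/-- The sum over the cyclic permutations of the arguments. -/
def cyc : M →+ M := AddMonoidHom.id M + 𝒞.rot + 𝒞.rot.comp 𝒞.rot

theorem cyc_apply (x : M) : 𝒞.cyc x = x + 𝒞.rot x + 𝒞.rot (𝒞.rot x) := rfl

theorem cyc_rot (x : M) : 𝒞.cyc (𝒞.rot x) = 𝒞.cyc x := by
  rw [cyc_apply, cyc_apply, rot_rot_rot]
  abel

theorem ev_cyc (A B C : R) (x : M) : 𝒞.ev A B C (𝒞.cyc x) =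
    𝒞.ev A B C x + 𝒞.rot (𝒞.ev B C A x) + 𝒞.rot (𝒞.rot (𝒞.ev C A B x)) := by
  rw [cyc_apply, map_add, map_add, rot_ev, rot_ev, rot_ev]

/-- Substituting three different operators in a vanishing cyclic sum permutes them among the
summands; a further cyclic sum removes the rotations. -/
theorem cyc_ev_of_cyc_eq_zero {x : M} (hx : 𝒞.cyc x = 0) (A B C : R) :
    𝒞.cyc (𝒞.ev A B C x) + 𝒞.cyc (𝒞.ev B C A x) + 𝒞.cyc (𝒞.ev C A B x) = 0 := by
  have := congrArg 𝒞.cyc (𝒞.ev_cyc A B C x)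
  rw [hx, map_zero, map_zero, map_add, map_add, cyc_rot, cyc_rot, cyc_rot] at this
  exact this.symm

theorem cyc_ev_diag {x : M} (hx : 𝒞.cyc x = 0) (A : R) : 𝒞.cyc (𝒞.ev A A A x) = 0 := by
  rw [cyc_apply, ← ev_cyc, hx, map_zero]

/-- If `K` satisfies the Jacobi identity and the two-forms `ω` and `ω K ω` are closed, then
`K ω K` satisfies the Jacobi identity. -/
theorem jacobi_of_closed {K ω : R} (hK : 𝒞.IsSkew K) (hω : 𝒞.IsSkew ω)
    (hKK : 𝒞.cyc (𝒞.ev K 1 1 (𝒞.D K)) = 0) (h1 : 𝒞.cyc (𝒞.D ω) = 0)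
    (h2 : 𝒞.cyc (𝒞.D (ω * (K * ω))) = 0) :
    𝒞.cyc (𝒞.ev (K * (ω * K)) 1 1 (𝒞.D (K * (ω * K)))) = 0 := by
  -- The Leibniz rule twice; each skewadjoint left factor that passes to the third argument
  -- contributes a sign.
  have e1 : 𝒞.D (K * (ω * K)) = 𝒞.ev 1 (ω * K) 1 (𝒞.D K) - 𝒞.ev 1 K K (𝒞.D ω) +
      𝒞.ev 1 1 (ω * K) (𝒞.D K) := by
    rw [𝒞.D_mul _ _ hK, 𝒞.D_mul _ _ hω, map_sub, ev_ev, ev_ev]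
    simp only [one_mul, mul_one]
    abel
  have e2 : 𝒞.D (ω * (K * ω)) = 𝒞.ev 1 (K * ω) 1 (𝒞.D ω) - 𝒞.ev 1 ω ω (𝒞.D K) +
      𝒞.ev 1 1 (K * ω) (𝒞.D ω) := by
    rw [𝒞.D_mul _ _ hω, 𝒞.D_mul _ _ hK, map_sub, ev_ev, ev_ev]
    simp only [one_mul, mul_one]
    abel
  -- The arguments are chosen so that the two terms of the goal with the variation of K appear in
  -- `f1`, together with a term (K, ωK, ωK) which cancels against `f3`. The terms with the variation
  -- of ω left over in `f3` are traded for the one in the goal by `f2`.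
  have f1 := 𝒞.cyc_ev_of_cyc_eq_zero hKK (ω * K) (ω * K) 1
  have f2 := 𝒞.cyc_ev_of_cyc_eq_zero h1 (K * (ω * K)) K K
  have f3 := 𝒞.cyc_ev_diag h2 K
  rw [e1]
  rw [e2] at f3
  simp only [map_add, map_sub, ev_ev, one_mul, mul_one, mul_assoc] at f1 f2 f3 ⊢
  rw [add_assoc, add_eq_zero_iff_eq_neg] at f2
  have f4 := congrArg₂ (· + ·) f1 f3
  simp only [add_zero] at f4
  rw [f2, ← f4]
  abel

/-- The sum of `f a b c` over all `a + b + c = n`. -/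
def tripleSum (f : ℕ → ℕ → ℕ → M) (n : ℕ) : M :=
  ∑ q ∈ Finset.HasAntidiagonal.antidiagonal n,
    ∑ r ∈ Finset.HasAntidiagonal.antidiagonal q.2, f q.1 r.1 r.2

theorem tripleSum_rot (f : ℕ → ℕ → ℕ → M) (n : ℕ) :
    tripleSum (fun a b c => f b c a) n = tripleSum f n := by
  unfold tripleSum
  rw [Finset.sum_sigma', Finset.sum_sigma']
  refine Finset.sum_nbij' (fun s => ⟨(s.2.1, s.2.2 + s.1.1), (s.2.2, s.1.1)⟩)
    (fun s => ⟨(s.2.2, s.1.1 + s.2.1), (s.1.1, s.2.1)⟩) ?_ ?_ ?_ ?_ ?_ <;>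
    simp +contextual [Finset.mem_sigma] <;> omega

theorem tripleSum_succ (f : ℕ → ℕ → ℕ → M) (n : ℕ) : tripleSum f (n + 1) =
    ∑ r ∈ Finset.HasAntidiagonal.antidiagonal (n + 1), f 0 r.1 r.2 +
      tripleSum (fun a b c => f (a + 1) b c) n := by
  unfold tripleSum
  rw [Finset.Nat.sum_antidiagonal_succ]

theorem tripleSum_add (f g : ℕ → ℕ → ℕ → M) (n : ℕ) :
    tripleSum (fun a b c => f a b c + g a b c) n = tripleSum f n + tripleSum g n := by
  simp only [tripleSum, Finset.sum_add_distrib]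

theorem map_tripleSum (φ : M →+ M) (f : ℕ → ℕ → ℕ → M) (n : ℕ) :
    φ (tripleSum f n) = tripleSum (fun a b c => φ (f a b c)) n := by
  simp only [tripleSum, map_sum]

/-- Summing over a + b + c = n makes the sum invariant under relabelling the indices, so the three
pointwise terms add up to the cyclic sum of a single `tripleSum`. -/
theorem cyc_tripleSum (f : ℕ → ℕ → ℕ → M)
    (hf : ∀ a b c, f a b c + 𝒞.rot (f b c a) + 𝒞.rot (𝒞.rot (f c a b)) = 0) (n : ℕ) :
    𝒞.cyc (tripleSum f n) = 0 := by
  have h1 := tripleSum_rot f n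
  have h2 := tripleSum_rot (fun a b c => f b c a) n
  have h3 : tripleSum (fun a b c => f a b c + (𝒞.rot (f b c a) + 𝒞.rot (𝒞.rot (f c a b)))) n = 0 := by
    simp only [← add_assoc, hf, tripleSum, Finset.sum_const_zero]
  rw [tripleSum_add, tripleSum_add, ← map_tripleSum 𝒞.rot (fun a b c => f b c a),
    ← map_tripleSum 𝒞.rot (fun a b c => 𝒞.rot (f c a b)),
    ← map_tripleSum 𝒞.rot (fun a b c => f c a b), h1, h2, h1, ← add_assoc] at h3
  exact h3

/-- The two-forms `ω_n = (K⁻¹ H)^n K⁻¹`. -/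
def form (H L : R) (n : ℕ) : R := (L * H) ^ n * L

variable {H K L : R}

theorem form_zero : form H L 0 = L := by rw [form, pow_zero, one_mul]

theorem form_succ (n : ℕ) : form H L (n + 1) = L * (H * form H L n) := by
  rw [form, pow_succ', form]
  simp only [mul_assoc]

theorem form_mul (n : ℕ) : form H L n * (H * L) = form H L (n + 1) := by
  rw [form, form, pow_succ]
  simp only [mul_assoc]

/-- The Lenard recursion, which turns a factor H in the first argument into K with the index raised
by one. -/
theorem mul_form_succ (hKL : K * L = 1) (n : ℕ) : K * form H L (n + 1) = H * form H L n := by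
  rw [form_succ, ← mul_assoc, hKL, one_mul]

theorem form_mul_form (hLK : L * K = 1) (m n : ℕ) :
    form H L m * (K * form H L n) = form H L (m + n) := by
  rw [form, form, form, pow_add]
  simp only [mul_assoc]
  rw [← mul_assoc L K, hLK, one_mul]

variable {𝒞}

/-- Differentiate LK = 1. The usual minus sign of the derivative of an inverse is absorbed by L* =
-L in the third argument. -/
theorem D_inv (hL : 𝒞.IsSkew L) (hKL : K * L = 1) (hLK : L * K = 1) :
    𝒞.D L = 𝒞.ev 1 L L (𝒞.D K) := by
  have h := 𝒞.D_mul L K hL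
  rw [hLK, 𝒞.D_one] at h
  have h' := congrArg (𝒞.ev 1 L 1) (sub_eq_zero.mp h.symm)
  rw [ev_ev, ev_ev, hKL] at h'
  simpa only [one_mul, mul_one, ev_one] using h'

/-- The coefficient of t^{n+1} in the rule for the derivative of an inverse, applied to ω(t) = (K -
tH)⁻¹ = ∑ t^n ω_n: the variation of ω(t) is that of K - tH with ω(t) in the last two arguments. -/
theorem D_form_succ (hH : 𝒞.IsSkew H) (hL : 𝒞.IsSkew L) (hKL : K * L = 1) (hLK : L * K = 1)
    (n : ℕ) : 𝒞.D (form H L (n + 1)) =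
      ∑ p ∈ Finset.HasAntidiagonal.antidiagonal (n + 1),
        𝒞.ev 1 (form H L p.1) (form H L p.2) (𝒞.D K) -
      ∑ p ∈ Finset.HasAntidiagonal.antidiagonal n,
        𝒞.ev 1 (form H L p.1) (form H L p.2) (𝒞.D H) := by
  have key : ∀ n, 𝒞.D (form H L (n + 1)) = 𝒞.ev 1 (form H L (n + 1)) L (𝒞.D K) -
      𝒞.ev 1 (form H L n) L (𝒞.D H) + 𝒞.ev 1 1 (H * L) (𝒞.D (form H L n)) := fun n => by
    rw [form_succ, 𝒞.D_mul _ _ hL, 𝒞.D_mul _ _ hH, D_inv hL hKL hLK, map_sub, ev_ev, ev_ev, ev_ev]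
    simp only [one_mul, mul_one]
    abel
  induction n with
  | zero =>
    rw [key, form_zero, D_inv hL hKL hLK, ev_ev, ← mul_assoc]
    simp [Finset.Nat.antidiagonal_succ, form_zero, form_succ, mul_assoc]
    abel
  | succ n ih =>
    rw [key, ih, map_sub, map_sum, map_sum]
    rw [Finset.Nat.sum_antidiagonal_succ' (n := n + 1)
        (f := fun p => 𝒞.ev 1 (form H L p.1) (form H L p.2) (𝒞.D K)),
      Finset.Nat.sum_antidiagonal_succ' (n := n)
        (f := fun p => 𝒞.ev 1 (form H L p.1) (form H L p.2) (𝒞.D H))]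
    simp only [ev_ev, mul_one, form_mul, form_zero]
    abel

/-- If `K` is invertible and `H`, `K` satisfy the Jacobi identity and are compatible, then the
two-forms `(K⁻¹ H)^n K⁻¹` are closed. -/
theorem cyc_D_form (hH : 𝒞.IsSkew H) (hL : 𝒞.IsSkew L) (hKL : K * L = 1) (hLK : L * K = 1)
    (hKK : 𝒞.cyc (𝒞.ev K 1 1 (𝒞.D K)) = 0) (hHH : 𝒞.cyc (𝒞.ev H 1 1 (𝒞.D H)) = 0)
    (hHK : 𝒞.cyc (𝒞.ev H 1 1 (𝒞.D K) + 𝒞.ev K 1 1 (𝒞.D H)) = 0) (n : ℕ) :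
    𝒞.cyc (𝒞.D (form H L n)) = 0 := by
  let u : ℕ → ℕ → ℕ → M := fun a b c =>
    𝒞.ev (K * form H L a) (form H L b) (form H L c) (𝒞.D K)
  let v : ℕ → ℕ → ℕ → M := fun a b c =>
    𝒞.ev (K * form H L a) (form H L b) (form H L c) (𝒞.D H)
  -- Substitution of ω(t) in all three arguments, coefficientwise in t. Applied to the Jacobi
  -- identities of K and H and to their mixed term it gives `r1`, `r3` and `r2`.
  have rel : ∀ x, 𝒞.cyc x = 0 → ∀ n,
      𝒞.cyc (tripleSum (fun a b c => 𝒞.ev (form H L a) (form H L b) (form H L c) x) n) = 0 :=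
    fun x hx n => 𝒞.cyc_tripleSum _ (fun a b c => by rw [← ev_cyc, hx, map_zero]) n
  have r1 : ∀ n, 𝒞.cyc (tripleSum u n) = 0 := fun n => by
    simpa only [ev_ev, one_mul] using rel _ hKK n
  have r2 : ∀ n, 𝒞.cyc (tripleSum (fun a b c => u (a + 1) b c) n) + 𝒞.cyc (tripleSum v n) = 0 :=
    fun n => by
    have := rel _ hHK n
    simp only [map_add, ev_ev, one_mul, tripleSum_add] at this
    simpa only [u, mul_form_succ hKL] using this
  have r3 : ∀ n, 𝒞.cyc (tripleSum (fun a b c => v (a + 1) b c) n) = 0 := fun n => by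
    have := rel _ hHH n
    simp only [ev_ev, one_mul] at this
    simpa only [v, mul_form_succ hKL] using this
  have hu : ∀ p : ℕ × ℕ, 𝒞.ev 1 (form H L p.1) (form H L p.2) (𝒞.D K) = u 0 p.1 p.2 := fun p => by
    simp only [u, form_zero, hKL]
  have hv : ∀ p : ℕ × ℕ, 𝒞.ev 1 (form H L p.1) (form H L p.2) (𝒞.D H) = v 0 p.1 p.2 := fun p => by
    simp only [v, form_zero, hKL]
  rcases n with _ | n
  · rw [form_zero, D_inv hL hKL hLK]
    simpa [tripleSum, u, form_zero, hKL] using r1 0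
  · rw [D_form_succ hH hL hKL hLK, Finset.sum_congr rfl fun p _ => hu p,
      Finset.sum_congr rfl fun p _ => hv p, map_sub]
    -- Telescoping in the index a: up to cyclic sums, the part of u with a = 0 is minus the part
    -- with a > 0, which is the full sum of v by `r2`, and this equals its part with a = 0 by `r3`.
    have e1 := r1 (n + 1)
    rw [tripleSum_succ, map_add] at e1
    have e2 := r2 n
    have e3 : 𝒞.cyc (tripleSum v n) =
        𝒞.cyc (∑ p ∈ Finset.HasAntidiagonal.antidiagonal n, v 0 p.1 p.2) := by
      rcases n with _ | n
      · simp [tripleSum]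
      · rw [tripleSum_succ, map_add, r3, add_zero]
    rw [e3] at e2
    rw [eq_neg_of_add_eq_zero_left e1, eq_neg_of_add_eq_zero_left e2]
    abel

end VariationCalculus

/-! ### The variation of rational operators -/

theorem PsiDO.adjoint_del_pow {F V : Type*} [Field F] [CommRing V] [Algebra F V]
    {d : Derivation F V V} (n : ℕ) : (PsiDO.del d ^ n).adjoint = (-PsiDO.del d) ^ n := by
  induction n with
  | zero => exact PsiDO.adjoint_const 1
  | succ n ih =>
    rw [pow_succ, PsiDO.adjoint_mul, ih, pow_succ' (-PsiDO.del d)]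
    congr 1
    rw [← PsiDO.delPow_one, PsiDO.adjoint_delPow]
    simp

namespace DiffFunAlgebra

variable {F V : Type*} [Field F] [CommRing V] [Algebra F V] {ℓ : ℕ} (𝒱 : DiffFunAlgebra F ℓ V)

open PsiDO

/-- The Fréchet derivative `∑_n ∂f/∂u_h^{(n)} ∂^n`. -/
def frechetDer (h : Fin ℓ) (f : V) : PsiDO 𝒱.D where
  coeff m := if 0 ≤ m then 𝒱.pd h m.toNat f else 0
  bdd := by
    have hfin : {n : ℕ | 𝒱.pd h n f ≠ 0}.Finite :=
      (𝒱.pd_finite f).preimage (f := fun n => (h, n)) (fun a _ b _ hab => by simpa using hab)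
    obtain ⟨N, hN⟩ := hfin.bddAbove
    refine ⟨N, fun n hn => ?_⟩
    rw [if_pos (by omega)]
    by_contra h0
    have := hN h0
    omega

theorem coeff_frechetDer (h : Fin ℓ) (f : V) (m : ℤ) :
    (𝒱.frechetDer h f).coeff m = if 0 ≤ m then 𝒱.pd h m.toNat f else 0 := rfl

theorem frechetDer_add (h : Fin ℓ) (f g : V) :
    𝒱.frechetDer h (f + g) = 𝒱.frechetDer h f + 𝒱.frechetDer h g := by
  ext m
  simp only [coeff_add, coeff_frechetDer, map_add]
  split_ifs <;> simp

theorem frechetDer_smul (h : Fin ℓ) (c : F) (f : V) :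
    𝒱.frechetDer h (c • f) = c • 𝒱.frechetDer h f := by
  ext m
  simp only [coeff_smul, coeff_frechetDer, Derivation.map_smul, smul_ite, smul_zero]

theorem frechetDer_mul (h : Fin ℓ) (f g : V) :
    𝒱.frechetDer h (f * g) = f • 𝒱.frechetDer h g + g • 𝒱.frechetDer h f := by
  ext m
  simp only [coeff_add, coeff_smul, coeff_frechetDer, Derivation.leibniz, smul_ite, smul_zero]
  split_ifs <;> simp

theorem frechetDer_one (h : Fin ℓ) : 𝒱.frechetDer h 1 = 0 := by
  ext m; simp [coeff_frechetDer]

/-- The commutation relations of ∂ with all the partial derivatives, collected in one operator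
identity. -/
theorem frechetDer_D (h : Fin ℓ) (f : V) :
    𝒱.frechetDer h (𝒱.D f) = del 𝒱.D * 𝒱.frechetDer h f := by
  ext m
  simp only [coeff_del_mul, coeff_frechetDer]
  rcases lt_trichotomy m 0 with hm | rfl | hm
  · rw [if_neg (by omega), if_neg (by omega), if_neg (by omega), map_zero, add_zero]
  · rw [if_pos le_rfl, if_neg (by omega), if_pos le_rfl, zero_add]
    exact sub_eq_zero.mp (𝒱.pd_zero_D h f)
  · obtain ⟨n, rfl⟩ : ∃ n : ℕ, m = n + 1 := ⟨(m - 1).toNat, by omega⟩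
    rw [if_pos (by omega), if_pos (by omega), if_pos (by omega), add_sub_cancel_right,
      show ((n : ℤ) + 1).toNat = n + 1 by omega, Int.toNat_natCast]
    exact sub_eq_iff_eq_add.mp (𝒱.pd_succ_D h n f)

theorem frechetDer_support (h : Fin ℓ) (f : V) :
    Function.HasFiniteSupport fun n : ℕ => const 𝒱.D (𝒱.pd h n f) * del 𝒱.D ^ n := by
  refine ((𝒱.pd_finite f).preimage (f := fun n => (h, n))
    (fun a _ b _ hab => by simpa using hab)).subset fun n hn h0 => hn ?_
  dsimp only at h0 ⊢
  rw [h0, const_zero, zero_mul]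

theorem frechetDer_eq_finsum (h : Fin ℓ) (f : V) :
    𝒱.frechetDer h f = ∑ᶠ n : ℕ, const 𝒱.D (𝒱.pd h n f) * del 𝒱.D ^ n := by
  ext m
  rw [coeff_finsum _ (𝒱.frechetDer_support h f), coeff_frechetDer]
  simp only [del_pow, const_mul_delPow, coeff_monomial]
  split_ifs with hm
  · rw [finsum_eq_single _ m.toNat, if_pos (by omega)]
    intro n hn
    rw [if_neg (by omega)]
  · exact (finsum_eq_zero_of_forall_eq_zero fun n => if_neg (by omega)).symm

/-- The sum over n in the Master Formula assembles the Fréchet derivative of g, the sum over m the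
adjoint of that of f. -/
theorem lambdaBracket_eq (H : Matrix (Fin ℓ) (Fin ℓ) (PsiDO 𝒱.D)) (f g : V) :
    lambdaBracket 𝒱 H f g =
      ∑ i, ∑ j, 𝒱.frechetDer j g * H j i * (𝒱.frechetDer i f).adjoint := by
  unfold lambdaBracket
  refine Finset.sum_congr rfl fun i _ => Finset.sum_congr rfl fun j _ => ?_
  have h1 : ∀ m : ℕ, (∑ᶠ n : ℕ, const 𝒱.D (𝒱.pd j n g) * del 𝒱.D ^ n * H j i *
      (-del 𝒱.D) ^ m * const 𝒱.D (𝒱.pd i m f)) =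
      𝒱.frechetDer j g * H j i * (const 𝒱.D (𝒱.pd i m f) * del 𝒱.D ^ m).adjoint := fun m => by
    rw [adjoint_mul, adjoint_const, adjoint_del_pow, frechetDer_eq_finsum, mul_assoc,
      finsum_mul' _ _ (𝒱.frechetDer_support j g)]
    exact finsum_congr fun n => by simp only [mul_assoc]
  rw [finsum_congr h1, frechetDer_eq_finsum 𝒱 i, ← adjointHom_apply,
    map_finsum _ (𝒱.frechetDer_support i f), mul_finsum']
  · rfl
  · refine (𝒱.frechetDer_support i f).subset fun n hn h0 => hn ?_
    dsimp only at h0 ⊢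
    rw [h0, map_zero]

theorem frechetDer_u (h k : Fin ℓ) : 𝒱.frechetDer h (𝒱.u k) = if h = k then 1 else 0 := by
  ext m
  have := fun n => 𝒱.pd_u h n k 0
  simp only [Function.iterate_zero, id_eq] at this
  rw [coeff_frechetDer, this]
  by_cases hk : h = k
  · simp only [hk, true_and, if_true, coeff_one]
    split_ifs <;> first | omega | rfl
  · simp [hk]

theorem lambdaBracket_u_left (H : Matrix (Fin ℓ) (Fin ℓ) (PsiDO 𝒱.D)) (i : Fin ℓ) (g : V) :
    lambdaBracket 𝒱 H (𝒱.u i) g = ∑ h, 𝒱.frechetDer h g * H h i := by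
  rw [lambdaBracket_eq, Finset.sum_eq_single i]
  · simp only [frechetDer_u, if_true]
    refine Finset.sum_congr rfl fun j _ => ?_
    rw [← const_one, adjoint_const, const_one, mul_one]
  · intro i' _ hi
    refine Finset.sum_eq_zero fun j _ => ?_
    rw [frechetDer_u, if_neg hi, adjoint_zero, mul_zero]
  · simp

theorem lambdaBracket_u_right (H : Matrix (Fin ℓ) (Fin ℓ) (PsiDO 𝒱.D)) (f : V) (k : Fin ℓ) :
    lambdaBracket 𝒱 H f (𝒱.u k) = ∑ h, H k h * (𝒱.frechetDer h f).adjoint := by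
  rw [lambdaBracket_eq]
  refine Finset.sum_congr rfl fun i _ => ?_
  rw [Finset.sum_eq_single k]
  · rw [frechetDer_u, if_pos rfl, one_mul]
  · intro j _ hj
    rw [frechetDer_u, if_neg hj, zero_mul, zero_mul]
  · simp

theorem lambdaBracket_u_u (H : Matrix (Fin ℓ) (Fin ℓ) (PsiDO 𝒱.D)) (j k : Fin ℓ) :
    lambdaBracket 𝒱 H (𝒱.u j) (𝒱.u k) = H k j := by
  rw [lambdaBracket_u_left, Finset.sum_eq_single k]
  · rw [frechetDer_u, if_pos rfl, one_mul]
  · intro h _ hh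
    rw [frechetDer_u, if_neg hh, zero_mul]
  · simp

open TrivSqZeroExt in
/-- The first-order deformation `f ↦ f + ε ∑_n ∂f/∂u_h^{(n)} λ^n`. -/
noncomputable def deform (h : Fin ℓ) : V →ₐ[F] Dual 𝒱.D :=
  AlgHom.ofLinearMap
    { toFun := fun f => inl f + inr (𝒱.frechetDer h f)
      map_add' := fun f g => by
        rw [frechetDer_add, inl_add, inr_add]
        abel
      map_smul' := fun c f => by
        rw [frechetDer_smul, RingHom.id_apply, smul_add, inl_smul, inr_smul] }
    (by
      change (inl (1 : V) + inr (𝒱.frechetDer h 1) : Dual 𝒱.D) = 1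
      rw [frechetDer_one, inr_zero, add_zero, inl_one])
    (fun f g => by
      change (inl (f * g) + inr (𝒱.frechetDer h (f * g)) : Dual 𝒱.D) =
        (inl f + inr (𝒱.frechetDer h f)) * (inl g + inr (𝒱.frechetDer h g))
      rw [frechetDer_mul, mul_add, add_mul, add_mul, inr_mul_inr, inl_mul_inl, inl_mul_inr,
        inr_mul_inl, op_smul_eq_smul, inr_add]
      abel)

theorem deform_apply (h : Fin ℓ) (f : V) : 𝒱.deform h f =
    TrivSqZeroExt.inl f + TrivSqZeroExt.inr (𝒱.frechetDer h f) := rfl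

/-- By `frechetDer_D`, ∂ acts on the Fréchet symbol as ∂ + λ, which is how `dualDer` acts on the
ε-part. Hence the deformation extends to a ring homomorphism on operators. -/
theorem deform_D (h : Fin ℓ) (f : V) : 𝒱.deform h (𝒱.D f) = dualDer 𝒱.D (𝒱.deform h f) := by
  rw [deform_apply, deform_apply, map_add, dualDer_inl, dualDer_inr, frechetDer_D]

/-- The first-order deformation of pseudodifferential operators. -/
noncomputable def vary (h : Fin ℓ) : PsiDO 𝒱.D →ₐ[F] PsiDO (dualDer 𝒱.D) :=
  PsiDO.map (𝒱.deform h) (𝒱.deform_D h)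

/-- The algebra of operators whose variation is a density. -/
noncomputable def admissible (h : Fin ℓ) : Subalgebra F (PsiDO 𝒱.D) where
  carrier := {A | ∃ x : Density 𝒱.D, 𝒱.vary h A = dualIncl 𝒱.D A + Density.eps 𝒱.D x}
  mul_mem' := by
    rintro A B ⟨x, hx⟩ ⟨y, hy⟩
    refine ⟨Density.act2 B x + Density.act3 A.adjoint y, ?_⟩
    rw [map_mul, map_mul, hx, hy, map_add, Density.eps_act2, Density.eps_act3, adjoint_adjoint,
      mul_add, add_mul, add_mul, Density.eps_mul_eps]
    abel
  add_mem' := by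
    rintro A B ⟨x, hx⟩ ⟨y, hy⟩
    refine ⟨x + y, ?_⟩
    rw [map_add, map_add, map_add, hx, hy]
    abel
  algebraMap_mem' c := ⟨0, by
    rw [AlgHom.commutes, AlgHom.commutes, map_zero, add_zero]⟩

/-- The variation of A⁻¹ is -A⁻¹ (δA) A⁻¹, which is again a density with operators substituted in
its last two arguments; it is exact at first order because products of two ε-parts vanish. -/
theorem inv_mem_admissible {h : Fin ℓ} {A B : PsiDO 𝒱.D} (hA : A ∈ 𝒱.admissible h)
    (hAB : A * B = 1) (hBA : B * A = 1) : B ∈ 𝒱.admissible h := by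
  obtain ⟨x, hx⟩ := hA
  refine ⟨-Density.act3 B.adjoint (Density.act2 B x), ?_⟩
  have h1 : 𝒱.vary h B * 𝒱.vary h A = 1 := by rw [← map_mul, hBA, map_one]
  refine left_inv_eq_right_inv h1 ?_
  have h2 : dualIncl 𝒱.D A * dualIncl 𝒱.D B = 1 := by rw [← map_mul, hAB, map_one]
  have h3 : Density.eps 𝒱.D x * (dualIncl 𝒱.D B * (Density.eps 𝒱.D x * dualIncl 𝒱.D B)) = 0 := by
    rw [← mul_assoc, ← mul_assoc, ← Density.eps_act2, Density.eps_mul_eps, zero_mul]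
  rw [hx, map_neg, Density.eps_act3, Density.eps_act2, adjoint_adjoint, mul_add, add_mul, add_mul,
    h2, mul_neg, mul_neg, h3, ← mul_assoc (dualIncl _ A), h2, one_mul]
  abel

theorem const_mem_admissible (h : Fin ℓ) (f : V) : const 𝒱.D f ∈ 𝒱.admissible h := by
  refine ⟨Density.mk (TriSeries.pure (𝒱.frechetDer h f) 1 0), ?_⟩
  rw [Density.eps_mk, TriSeries.eps_pure, map_one, mul_one, delPow_zero, one_mul, vary, PsiDO.map_const,
    deform_apply, const_add, show dualIncl 𝒱.D (const 𝒱.D f) = const _ (TrivSqZeroExt.inl f) from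
      PsiDO.map_const _ _ f]
  simp

theorem del_mem_admissible (h : Fin ℓ) : del 𝒱.D ∈ 𝒱.admissible h := by
  refine ⟨0, ?_⟩
  rw [map_zero, add_zero, ← delPow_one, vary, map_delPow, dualIncl_delPow]

theorem isDifferential_mem_admissible {h : Fin ℓ} {A : PsiDO 𝒱.D} (hA : A.IsDifferential) :
    A ∈ 𝒱.admissible h := by
  obtain ⟨N, hN⟩ := A.exists_ordLE
  have : A = ∑ n ∈ Finset.range (N.toNat + 1), const 𝒱.D (A.coeff n) * del 𝒱.D ^ n := by
    ext m
    simp only [coeff_sum, del_pow, const_mul_delPow, coeff_monomial]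
    by_cases hm : 0 ≤ m ∧ m ≤ N
    · rw [Finset.sum_eq_single m.toNat]
      · rw [if_pos (by omega), show (m.toNat : ℤ) = m by omega]
      · intro n _ hn
        rw [if_neg (by omega)]
      · intro h'
        exact absurd (Finset.mem_range.mpr (by omega)) h'
    · rw [Finset.sum_eq_zero fun n hn => ?_]
      · by_cases h0 : 0 ≤ m
        · exact hN m (by omega)
        · exact hA m (by omega)
      · rw [Finset.mem_range] at hn
        split_ifs with h'
        · subst h'
          exact hN _ (by omega)
        · rfl
  rw [this]
  exact sum_mem fun n _ => mul_mem (𝒱.const_mem_admissible h _)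
    (pow_mem (𝒱.del_mem_admissible h) n)

open Classical in
/-- The variation of an admissible operator with respect to `u_h`. -/
noncomputable def variation (h : Fin ℓ) (A : PsiDO 𝒱.D) : Density 𝒱.D :=
  if hA : A ∈ 𝒱.admissible h then hA.choose else 0

variable {𝒱}

theorem eps_variation {h : Fin ℓ} {A : PsiDO 𝒱.D} (hA : A ∈ 𝒱.admissible h) :
    𝒱.vary h A = dualIncl 𝒱.D A + Density.eps 𝒱.D (𝒱.variation h A) := by
  rw [variation, dif_pos hA]
  exact hA.choose_spec

/-- Injectivity of the expansion makes the chosen density unique, so the algebraic rules for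
variations can be read off from the homomorphism `vary`. -/
theorem variation_eq {h : Fin ℓ} {A : PsiDO 𝒱.D} {x : Density 𝒱.D}
    (hx : 𝒱.vary h A = dualIncl 𝒱.D A + Density.eps 𝒱.D x) : 𝒱.variation h A = x := by
  apply Density.eps_injective
  have := eps_variation (𝒱 := 𝒱) ⟨x, hx⟩
  rw [hx] at this
  exact (add_left_cancel this).symm

theorem snd_coeff_eps_variation {h : Fin ℓ} {A : PsiDO 𝒱.D} (hA : A ∈ 𝒱.admissible h) (s : ℤ) :
    ((Density.eps 𝒱.D (𝒱.variation h A)).coeff s).snd = 𝒱.frechetDer h (A.coeff s) := by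
  have h1 := congrArg (fun B => (PsiDO.coeff B s).snd) (eps_variation hA)
  simp only [coeff_add, TrivSqZeroExt.snd_add, coeff_dualIncl, TrivSqZeroExt.snd_inl, zero_add,
    vary, coeff_map, deform_apply, TrivSqZeroExt.snd_inr] at h1
  exact h1.symm

theorem variation_mul {h : Fin ℓ} {A B : PsiDO 𝒱.D} (hA : A ∈ 𝒱.admissible h)
    (hB : B ∈ 𝒱.admissible h) : 𝒱.variation h (A * B) =
      Density.act2 B (𝒱.variation h A) + Density.act3 A.adjoint (𝒱.variation h B) := by
  apply variation_eq
  rw [map_mul, map_mul, eps_variation hA, eps_variation hB, map_add, Density.eps_act2,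
    Density.eps_act3, adjoint_adjoint, mul_add, add_mul, add_mul, Density.eps_mul_eps]
  abel

theorem variation_add {h : Fin ℓ} {A B : PsiDO 𝒱.D} (hA : A ∈ 𝒱.admissible h)
    (hB : B ∈ 𝒱.admissible h) :
    𝒱.variation h (A + B) = 𝒱.variation h A + 𝒱.variation h B := by
  apply variation_eq
  rw [map_add, map_add, map_add, eps_variation hA, eps_variation hB]
  abel

theorem variation_smul {h : Fin ℓ} {A : PsiDO 𝒱.D} (hA : A ∈ 𝒱.admissible h) (c : F) :
    𝒱.variation h (c • A) = c • 𝒱.variation h A := by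
  apply variation_eq
  rw [map_smul, map_smul, map_smul, eps_variation hA, smul_add]

theorem variation_zero (h : Fin ℓ) : 𝒱.variation h 0 = 0 := by
  apply variation_eq
  simp

theorem variation_one (h : Fin ℓ) : 𝒱.variation h 1 = 0 := by
  apply variation_eq
  simp

theorem variation_adjoint {h : Fin ℓ} {A : PsiDO 𝒱.D} (hA : A ∈ 𝒱.admissible h) :
    𝒱.variation h A.adjoint = Density.swap23 𝒱.D (𝒱.variation h A) := by
  apply variation_eq
  rw [vary, map_adjoint, ← vary, eps_variation hA, adjoint_add, dualIncl_adjoint,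
    Density.adjoint_eps]

theorem variation_neg {h : Fin ℓ} {A : PsiDO 𝒱.D} (hA : A ∈ 𝒱.admissible h) :
    𝒱.variation h (-A) = -𝒱.variation h A := by
  have := variation_smul hA (-1)
  simpa using this

theorem variation_sum {h : Fin ℓ} {ι : Type*} (s : Finset ι) (f : ι → PsiDO 𝒱.D)
    (hf : ∀ i ∈ s, f i ∈ 𝒱.admissible h) :
    𝒱.variation h (∑ i ∈ s, f i) = ∑ i ∈ s, 𝒱.variation h (f i) := by
  classical
  induction s using Finset.induction_on with
  | empty => exact variation_zero h
  | insert a s ha ih =>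
    rw [Finset.sum_insert ha, Finset.sum_insert ha, variation_add (hf _ (Finset.mem_insert_self _ _))
      (sum_mem fun i hi => hf i (Finset.mem_insert_of_mem hi)),
      ih fun i hi => hf i (Finset.mem_insert_of_mem hi)]

end DiffFunAlgebra

/-! ### Matrices of densities and the Jacobi identity -/

namespace Density

variable {F V : Type*} [Field F] [CommRing V] [Algebra F V] {d : Derivation F V V}

theorem swap23_swap23 (x : Density d) : swap23 d (swap23 d x) = x := by
  obtain ⟨x, rfl⟩ := mk_surjective x; rfl

theorem act3_eq (A : PsiDO d) (x : Density d) :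
    act3 A x = rot d (rot d (act1 A (rot d x))) := rfl

theorem act1_neg (A : PsiDO d) (x : Density d) : act1 (-A) x = -act1 A x := by
  have := act1_smul (-1 : F) A x
  simpa using this

theorem act3_neg (A : PsiDO d) (x : Density d) : act3 (-A) x = -act3 A x := by
  rw [act3_eq, act1_neg, map_neg, map_neg, ← act3_eq]

theorem act1_sum {ι : Type*} (s : Finset ι) (A : ι → PsiDO d) (x : Density d) :
    act1 (∑ i ∈ s, A i) x = ∑ i ∈ s, act1 (A i) x := by
  let φ : PsiDO d →+ Density d := AddMonoidHom.mk' (fun A => act1 A x) fun A B => act1_add A B x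
  exact map_sum φ A s

theorem expand_act1 (B : PsiDO d) (x : TriSeries F V) (s : ℤ) :
    TriSeries.expand d (TriSeries.act1 B x) s = TriSeries.expand d x s * B := by
  unfold TriSeries.expand
  rw [finsum_mul' _ _ (TriSeries.expand_support x s)]
  exact finsum_congr fun q => by rw [TriSeries.slice_act1, smul_mul_assoc, mul_assoc]

theorem snd_coeff_eps_act1 (B : PsiDO d) (x : Density d) (s : ℤ) :
    ((eps d (act1 B x)).coeff s).snd = ((eps d x).coeff s).snd * B := by
  obtain ⟨x, rfl⟩ := mk_surjective x
  exact expand_act1 B x s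

theorem snd_coeff_eps_sum {ι : Type*} (t : Finset ι) (x : ι → Density d) (s : ℤ) :
    ((eps d (∑ i ∈ t, x i)).coeff s).snd = ∑ i ∈ t, ((eps d (x i)).coeff s).snd := by
  rw [map_sum, PsiDO.coeff_sum, TrivSqZeroExt.snd_sum]

end Density

section Tensor

variable {F V : Type*} [Field F] [CommRing V] [Algebra F V] {ℓ : ℕ}

/-- Trilinear densities with three vector arguments. -/
abbrev DensityTensor (ℓ : ℕ) (d : Derivation F V V) : Type _ :=
  Fin ℓ → Fin ℓ → Fin ℓ → Density d

namespace DensityTensor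

variable {d : Derivation F V V}

variable (d) in
/-- Cyclic permutation of the arguments. -/
def rot : DensityTensor ℓ d →+ DensityTensor ℓ d :=
  AddMonoidHom.mk' (fun x i j k => Density.rot d (x j k i)) fun x y => by
    funext i j k
    exact map_add (Density.rot d) _ _

theorem rot_apply (x : DensityTensor ℓ d) (i j k : Fin ℓ) :
    rot d x i j k = Density.rot d (x j k i) := rfl

theorem rot_rot_rot (x : DensityTensor ℓ d) : rot d (rot d (rot d x)) = x := by
  funext i j k
  exact Density.rot_rot_rot _

/-- Substitution of a matrix operator into the first argument. -/
noncomputable def act1 (A : Matrix (Fin ℓ) (Fin ℓ) (PsiDO d)) :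
    DensityTensor ℓ d →+ DensityTensor ℓ d :=
  AddMonoidHom.mk' (fun x i j k => ∑ l, Density.act1 (A l i) (x l j k)) fun x y => by
    funext i j k
    simp only [Pi.add_apply, map_add, Finset.sum_add_distrib]

/-- Substitution of a matrix operator into the second argument. -/
noncomputable def act2 (A : Matrix (Fin ℓ) (Fin ℓ) (PsiDO d)) :
    DensityTensor ℓ d →+ DensityTensor ℓ d :=
  AddMonoidHom.mk' (fun x i j k => ∑ l, Density.act2 (A l j) (x i l k)) fun x y => by
    funext i j k
    simp only [Pi.add_apply, map_add, Finset.sum_add_distrib]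

/-- Substitution of a matrix operator into the third argument. -/
noncomputable def act3 (A : Matrix (Fin ℓ) (Fin ℓ) (PsiDO d)) :
    DensityTensor ℓ d →+ DensityTensor ℓ d :=
  AddMonoidHom.mk' (fun x i j k => ∑ l, Density.act3 (A l k) (x i j l)) fun x y => by
    funext i j k
    simp only [Pi.add_apply, map_add, Finset.sum_add_distrib]

variable (A B : Matrix (Fin ℓ) (Fin ℓ) (PsiDO d)) (x : DensityTensor ℓ d) (i j k : Fin ℓ)

theorem act1_apply : act1 A x i j k = ∑ l, Density.act1 (A l i) (x l j k) := rfl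
theorem act2_apply : act2 A x i j k = ∑ l, Density.act2 (A l j) (x i l k) := rfl
theorem act3_apply : act3 A x i j k = ∑ l, Density.act3 (A l k) (x i j l) := rfl

theorem rot_act1 : rot d (act1 A x) = act2 A (rot d x) := by
  funext i j k
  simp only [rot_apply, act1_apply, act2_apply, map_sum, Density.rot_act1]

theorem rot_act2 : rot d (act2 A x) = act3 A (rot d x) := by
  funext i j k
  simp only [rot_apply, act2_apply, act3_apply, map_sum, Density.rot_act2]

theorem rot_act3 : rot d (act3 A x) = act1 A (rot d x) := by
  funext i j k
  simp only [rot_apply, act3_apply, act1_apply, map_sum, Density.rot_act3]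

theorem act1_one : act1 1 x = x := by
  funext i j k
  rw [act1_apply, Finset.sum_eq_single i]
  · rw [Matrix.one_apply_eq, Density.act1_one]
  · intro l _ hl
    rw [Matrix.one_apply_ne hl]
    have := Density.act1_smul (0 : F) (0 : PsiDO d) (x l j k)
    simpa using this
  · simp

theorem act1_act1 : act1 B (act1 A x) = act1 (A * B) x := by
  funext i j k
  simp only [act1_apply, map_sum, Density.act1_act1, Matrix.mul_apply, Density.act1_sum]
  exact Finset.sum_comm

theorem act1_act2 : act1 A (act2 B x) = act2 B (act1 A x) := by
  funext i j k
  simp only [act1_apply, act2_apply, map_sum, Density.act1_act2]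
  exact Finset.sum_comm

theorem act2_eq : act2 A x = rot d (act1 A (rot d (rot d x))) := by
  rw [rot_act1, rot_rot_rot]

theorem act3_eq : act3 A x = rot d (rot d (act1 A (rot d x))) := by
  rw [rot_act1, rot_act2, rot_rot_rot]

theorem act2_act3 : act2 A (act3 B x) = act3 B (act2 A x) := by
  have := congrArg (rot d) (act1_act2 A B (rot d (rot d x)))
  rwa [rot_act1, rot_act2, rot_act2, rot_act1, rot_rot_rot] at this

theorem act1_act3 : act1 A (act3 B x) = act3 B (act1 A x) := by
  have := congrArg (rot d) (act2_act3 B A (rot d (rot d x)))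
  rw [rot_act2, rot_act3, rot_act3, rot_act2, rot_rot_rot] at this
  exact this.symm

theorem act2_one : act2 1 x = x := by rw [act2_eq, act1_one, rot_rot_rot]

theorem act3_one : act3 1 x = x := by rw [act3_eq, act1_one, rot_rot_rot]

theorem act2_act2 : act2 B (act2 A x) = act2 (A * B) x := by
  rw [act2_eq, act2_eq, act2_eq, rot_rot_rot, act1_act1]

theorem act3_act3 : act3 B (act3 A x) = act3 (A * B) x := by
  rw [act3_eq, act3_eq, act3_eq, rot_rot_rot, act1_act1]

end DensityTensor

end Tensor

/-! ### Adjoints of matrix operators. -/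

section Adjoint

variable {F V : Type*} [Field F] [CommRing V] [Algebra F V] {ℓ : ℕ} {d : Derivation F V V}
  (A B : Matrix (Fin ℓ) (Fin ℓ) (PsiDO d))

theorem matrixAdjoint_apply (i j : Fin ℓ) : matrixAdjoint A i j = (A j i).adjoint := rfl

theorem matrixAdjoint_mul : matrixAdjoint (A * B) = matrixAdjoint B * matrixAdjoint A := by
  ext1 i j
  simp only [matrixAdjoint_apply, Matrix.mul_apply, PsiDO.adjoint_sum, PsiDO.adjoint_mul]

theorem matrixAdjoint_one : matrixAdjoint (1 : Matrix (Fin ℓ) (Fin ℓ) (PsiDO d)) = 1 := by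
  ext1 i j
  rw [matrixAdjoint_apply, Matrix.one_apply, Matrix.one_apply]
  simp only [eq_comm (a := j)]
  split_ifs
  · exact PsiDO.adjoint_const 1
  · exact PsiDO.adjoint_zero

theorem matrixAdjoint_add : matrixAdjoint (A + B) = matrixAdjoint A + matrixAdjoint B := by
  ext1 i j
  exact PsiDO.adjoint_add _ _

theorem matrixAdjoint_zero : matrixAdjoint (0 : Matrix (Fin ℓ) (Fin ℓ) (PsiDO d)) = 0 := by
  ext1 i j
  exact PsiDO.adjoint_zero

theorem matrixAdjoint_smul (c : F) : matrixAdjoint (c • A) = c • matrixAdjoint A := by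
  ext1 i j
  exact PsiDO.adjoint_smul _ _

end Adjoint

namespace DiffFunAlgebra

variable {F V : Type*} [Field F] [CommRing V] [Algebra F V] {ℓ : ℕ} {𝒱 : DiffFunAlgebra F ℓ V}
  {𝒜 : Subalgebra F (PsiDO 𝒱.D)}

/-- The matrix of pseudodifferential operators underlying a matrix over a subalgebra. -/
noncomputable def toMatrix (𝒜 : Subalgebra F (PsiDO 𝒱.D)) :
    Matrix (Fin ℓ) (Fin ℓ) 𝒜 →ₐ[F] Matrix (Fin ℓ) (Fin ℓ) (PsiDO 𝒱.D) :=
  𝒜.val.mapMatrix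

/-- The variation `∫ R X_P(A) Q` of a matrix operator. -/
noncomputable def matrixVariation (h𝒜 : ∀ h, 𝒜 ≤ 𝒱.admissible h) :
    Matrix (Fin ℓ) (Fin ℓ) 𝒜 →ₗ[F] DensityTensor ℓ 𝒱.D where
  toFun A h j k := 𝒱.variation h (A k j : PsiDO 𝒱.D)
  map_add' A B := by
    funext h j k
    exact variation_add (h𝒜 h (A k j).2) (h𝒜 h (B k j).2)
  map_smul' c A := by
    funext h j k
    exact variation_smul (h𝒜 h (A k j).2) c

variable (h𝒜 : ∀ h, 𝒜 ≤ 𝒱.admissible h)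

open DensityTensor

/-- The calculus of variations of admissible matrix operators. -/
noncomputable def calculus :
    VariationCalculus (Matrix (Fin ℓ) (Fin ℓ) 𝒜) (DensityTensor ℓ 𝒱.D) where
  ev A B C := (act1 (toMatrix 𝒜 A)).comp ((act2 (toMatrix 𝒜 B)).comp (act3 (toMatrix 𝒜 C)))
  rot := rot 𝒱.D
  D := (matrixVariation h𝒜).toAddMonoidHom
  IsSkew A := matrixAdjoint (toMatrix 𝒜 A) = -toMatrix 𝒜 A
  ev_one x := by
    simp only [AddMonoidHom.comp_apply, map_one, act1_one, act2_one, act3_one]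
  ev_ev A B C A' B' C' x := by
    simp only [AddMonoidHom.comp_apply, map_mul, ← act1_act1, ← act2_act2, ← act3_act3]
    rw [← act1_act3, ← act2_act3, ← act1_act2]
  rot_rot_rot := rot_rot_rot
  rot_ev A B C x := by
    simp only [AddMonoidHom.comp_apply, rot_act1, rot_act2, rot_act3]
    rw [act1_act2, act1_act3]
  D_one := by
    funext h j k
    change 𝒱.variation h ((1 : Matrix (Fin ℓ) (Fin ℓ) 𝒜) k j : PsiDO 𝒱.D) = 0
    rw [Matrix.one_apply]
    split_ifs
    · exact variation_one h
    · exact variation_zero h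
  D_mul A B hA := by
    funext h j k
    -- Skewadjointness replaces the adjoint entry in the third argument by -A l k, whose indices are
    -- in the order used by matrix substitution.
    have e : ∀ l, ((A k l : PsiDO 𝒱.D)).adjoint = -(A l k : PsiDO 𝒱.D) := fun l =>
      congrFun (congrFun hA l) k
    simp only [AddMonoidHom.comp_apply, map_one, act1_one, act2_one, act3_one]
    change 𝒱.variation h ((A * B) k j : PsiDO 𝒱.D) = act2 (toMatrix 𝒜 B) (matrixVariation h𝒜 A) h j k -
      act3 (toMatrix 𝒜 A) (matrixVariation h𝒜 B) h j k
    rw [act2_apply, act3_apply, Matrix.mul_apply, AddSubmonoidClass.coe_finsetSum, variation_sum _ _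
      fun l _ => h𝒜 h (A k l * B l j).2, ← Finset.sum_sub_distrib]
    refine Finset.sum_congr rfl fun l _ => ?_
    rw [MulMemClass.coe_mul, variation_mul (h𝒜 h (A k l).2) (h𝒜 h (B l j).2), e, Density.act3_neg,
      ← sub_eq_add_neg]
    rfl

end DiffFunAlgebra

/-! ### The Jacobi identity as the vanishing of a cyclic sum. -/

namespace DiffFunAlgebra

variable {F V : Type*} [Field F] [CommRing V] [Algebra F V] {ℓ : ℕ} {𝒱 : DiffFunAlgebra F ℓ V}
  {𝒜 : Subalgebra F (PsiDO 𝒱.D)} (h𝒜 : ∀ h, 𝒜 ≤ 𝒱.admissible h)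

/-- The density `∫ R X_{HP}(H) Q`. -/
noncomputable def jacobiDensity (H : Matrix (Fin ℓ) (Fin ℓ) 𝒜) : DensityTensor ℓ 𝒱.D :=
  (calculus h𝒜).ev H 1 1 ((calculus h𝒜).D H)

theorem jacobiDensity_apply (H : Matrix (Fin ℓ) (Fin ℓ) 𝒜) (i j k : Fin ℓ) :
    jacobiDensity h𝒜 H i j k =
      ∑ h, Density.act1 (H h i : PsiDO 𝒱.D) (𝒱.variation h (H k j : PsiDO 𝒱.D)) := by
  change DensityTensor.act1 (toMatrix 𝒜 H) (DensityTensor.act2 (toMatrix 𝒜 1)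
    (DensityTensor.act3 (toMatrix 𝒜 1) (matrixVariation h𝒜 H))) i j k = _
  rw [map_one, DensityTensor.act3_one, DensityTensor.act2_one]
  rfl

theorem snd_coeff_eps_jacobiDensity (H : Matrix (Fin ℓ) (Fin ℓ) 𝒜) (i j k : Fin ℓ) (s : ℤ) :
    ((Density.eps 𝒱.D (jacobiDensity h𝒜 H i j k)).coeff s).snd =
      ∑ h, 𝒱.frechetDer h ((H k j : PsiDO 𝒱.D).coeff s) * (H h i : PsiDO 𝒱.D) := by
  rw [jacobiDensity_apply, Density.snd_coeff_eps_sum]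
  refine Finset.sum_congr rfl fun h _ => ?_
  rw [Density.snd_coeff_eps_act1, snd_coeff_eps_variation (h𝒜 h (H k j).2)]

theorem snd_coeff_eps_eq_lambdaBracket (H : Matrix (Fin ℓ) (Fin ℓ) 𝒜) (i j k : Fin ℓ) (s : ℤ) :
    ((Density.eps 𝒱.D (jacobiDensity h𝒜 H i j k)).coeff s).snd =
      lambdaBracket 𝒱 (toMatrix 𝒜 H) (𝒱.u i)
        ((lambdaBracket 𝒱 (toMatrix 𝒜 H) (𝒱.u j) (𝒱.u k)).coeff s) := by
  rw [snd_coeff_eps_jacobiDensity, lambdaBracket_u_u, lambdaBracket_u_left]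
  rfl

/-- The third term of the Jacobi identity has H on the left of an adjoint Fréchet derivative.
Skewadjointness makes it the adjoint of a product of the shape occurring in the first term, at the
price of a sign. -/
theorem lambdaBracket_lambdaBracket_eq {H : Matrix (Fin ℓ) (Fin ℓ) 𝒜}
    (hH : (calculus h𝒜).IsSkew H) (i j k : Fin ℓ) (r : ℤ) :
    lambdaBracket 𝒱 (toMatrix 𝒜 H)
        ((lambdaBracket 𝒱 (toMatrix 𝒜 H) (𝒱.u i) (𝒱.u j)).coeff r) (𝒱.u k) =
      -((Density.eps 𝒱.D (jacobiDensity h𝒜 H k i j)).coeff r).snd.adjoint := by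
  rw [snd_coeff_eps_jacobiDensity, lambdaBracket_u_u, lambdaBracket_u_right, PsiDO.adjoint_sum,
    ← Finset.sum_neg_distrib]
  refine Finset.sum_congr rfl fun h _ => ?_
  have e : ((H h k : PsiDO 𝒱.D)).adjoint = -(H k h : PsiDO 𝒱.D) :=
    congrFun (congrFun hH k) h
  rw [PsiDO.adjoint_mul, e, neg_mul, neg_neg]
  rfl

/-- The density is skew in Q and R because H is: exchanging these arguments amounts to taking
adjoints of the entries being varied. This turns the second term of the Jacobi identity into a
rotation. -/
theorem swap23_jacobiDensity {H : Matrix (Fin ℓ) (Fin ℓ) 𝒜} (hH : (calculus h𝒜).IsSkew H)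
    (i j k : Fin ℓ) : Density.swap23 𝒱.D (jacobiDensity h𝒜 H i j k) =
      -jacobiDensity h𝒜 H i k j := by
  rw [jacobiDensity_apply, jacobiDensity_apply, map_sum, ← Finset.sum_neg_distrib]
  refine Finset.sum_congr rfl fun h _ => ?_
  have e : ((H k j : PsiDO 𝒱.D)).adjoint = -(H j k : PsiDO 𝒱.D) :=
    congrFun (congrFun hH j) k
  rw [Density.swap23_act1, ← variation_adjoint (h𝒜 h (H k j).2), e,
    variation_neg (h𝒜 h (H j k).2), map_neg]

/-- The three terms are the three expansions of rotations of one density. Surjectivity of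
`toVLambdaMu` and injectivity of the expansion show that the elements of V_{λ,μ} in the Jacobi
identity can only be the images of these rotations. -/
theorem jacobiIdentity_iff {H : Matrix (Fin ℓ) (Fin ℓ) 𝒜} (hH : (calculus h𝒜).IsSkew H) :
    (∀ i j k, JacobiIdentity 𝒱 (toMatrix 𝒜 H) i j k) ↔
      (calculus h𝒜).cyc (jacobiDensity h𝒜 H) = 0 := by
  have hc : ∀ i j k, (calculus h𝒜).cyc (jacobiDensity h𝒜 H) i j k =
      jacobiDensity h𝒜 H i j k -
        Density.rot 𝒱.D (Density.swap23 𝒱.D (jacobiDensity h𝒜 H j i k)) +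
        Density.rot 𝒱.D (Density.rot 𝒱.D (jacobiDensity h𝒜 H k i j)) := fun i j k => by
    rw [swap23_jacobiDensity h𝒜 hH, map_neg, sub_neg_eq_add]
    rfl
  have hJ : ∀ i j k, Density.toVLambdaMu 𝒱.D ((calculus h𝒜).cyc (jacobiDensity h𝒜 H) i j k) =
      Density.toVLambdaMu 𝒱.D (jacobiDensity h𝒜 H i j k) -
        Density.toVLambdaMu 𝒱.D (Density.rot 𝒱.D
          (Density.swap23 𝒱.D (jacobiDensity h𝒜 H j i k))) -
        Density.toVLambdaMu 𝒱.D (-Density.rot 𝒱.D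
          (Density.rot 𝒱.D (jacobiDensity h𝒜 H k i j))) := fun i j k => by
    rw [hc, map_add, map_sub, map_neg, sub_neg_eq_add]
  constructor
  · intro h
    funext i j k
    obtain ⟨J₁, J₂, J₃, h1, h2, h3, h4⟩ := h i j k
    apply Density.toVLambdaMu_injective
    rw [hJ, Pi.zero_apply, Pi.zero_apply, Pi.zero_apply, map_zero, ← h4]
    congr 1
    · congr 1
      · obtain ⟨y, rfl⟩ := Density.toVLambdaMu_surjective (d := 𝒱.D) J₁
        congr 1
        refine Density.ext_snd fun s => PsiDO.ext (funext fun r => ?_)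
        rw [snd_coeff_eps_eq_lambdaBracket, ← h1, Density.iotaMuLambda_toVLambdaMu]
      · obtain ⟨z, rfl⟩ := Density.toVLambdaMu_surjective (d := 𝒱.D) J₂
        -- The permutation is undone so that the second expansion takes the form of the operator
        -- expansion of y.
        obtain ⟨y, rfl⟩ : ∃ y, z = Density.rot 𝒱.D (Density.swap23 𝒱.D y) :=
          ⟨Density.swap23 𝒱.D (Density.rot 𝒱.D (Density.rot 𝒱.D z)), by
            rw [Density.swap23_swap23, Density.rot_rot_rot]⟩
        congr 3
        refine Density.ext_snd fun r => PsiDO.ext (funext fun s => ?_)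
        rw [snd_coeff_eps_eq_lambdaBracket, ← h2, Density.iotaLambdaMu_toVLambdaMu]
    · obtain ⟨z, rfl⟩ := Density.toVLambdaMu_surjective (d := 𝒱.D) J₃
      obtain ⟨y, rfl⟩ : ∃ y, z = -Density.rot 𝒱.D (Density.rot 𝒱.D y) :=
        ⟨-Density.rot 𝒱.D z, by rw [map_neg, map_neg, Density.rot_rot_rot, neg_neg]⟩
      congr 4
      refine Density.ext_snd fun r => PsiDO.adjoint_injective (PsiDO.ext (funext fun s => ?_))
      have := h3 r s
      rw [lambdaBracket_lambdaBracket_eq h𝒜 hH, map_neg, map_neg, Pi.neg_apply,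
        Density.iotaLambdaNu_toVLambdaMu, PsiDO.coeff_neg, neg_inj] at this
      exact this.symm
  · intro h i j k
    refine ⟨_, _, _, fun r s => ?_, fun r s => ?_, fun r s => ?_, (hJ i j k).symm.trans ?_⟩
    · rw [Density.iotaMuLambda_toVLambdaMu, snd_coeff_eps_eq_lambdaBracket]
    · rw [Density.iotaLambdaMu_toVLambdaMu, snd_coeff_eps_eq_lambdaBracket]
    · rw [map_neg, map_neg, Pi.neg_apply, Density.iotaLambdaNu_toVLambdaMu,
        lambdaBracket_lambdaBracket_eq h𝒜 hH, PsiDO.coeff_neg]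
    · rw [h]
      exact map_zero _

/-! ### Skewadjointness of inverses, of the forms ω_n and of KωK. -/

section Skew

variable {h𝒜}

theorem isSkew_iff {A : Matrix (Fin ℓ) (Fin ℓ) 𝒜} : (calculus h𝒜).IsSkew A ↔
    matrixAdjoint (toMatrix 𝒜 A) = -toMatrix 𝒜 A := Iff.rfl

theorem isSkew_inv {K L : Matrix (Fin ℓ) (Fin ℓ) 𝒜} (hK : (calculus h𝒜).IsSkew K)
    (hKL : K * L = 1) : (calculus h𝒜).IsSkew L := by
  rw [isSkew_iff] at hK ⊢
  have h1 : toMatrix 𝒜 K * toMatrix 𝒜 L = 1 := by rw [← map_mul, hKL, map_one]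
  have h2 := congrArg matrixAdjoint h1
  rw [matrixAdjoint_mul, matrixAdjoint_one, hK, mul_neg, ← neg_mul] at h2
  rw [← neg_eq_iff_eq_neg]
  exact left_inv_eq_right_inv h2 h1

theorem isSkew_sum {ι : Type*} {s : Finset ι} {f : ι → Matrix (Fin ℓ) (Fin ℓ) 𝒜} {c : ι → F}
    (hf : ∀ i ∈ s, (calculus h𝒜).IsSkew (f i)) : (calculus h𝒜).IsSkew (∑ i ∈ s, c i • f i) := by
  classical
  induction s using Finset.induction_on with
  | empty =>
    rw [isSkew_iff, Finset.sum_empty, map_zero, matrixAdjoint_zero, neg_zero]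
  | insert a s ha ih =>
    have h1 := hf _ (Finset.mem_insert_self a s)
    have h2 := ih fun i hi => hf i (Finset.mem_insert_of_mem hi)
    rw [isSkew_iff] at h1 h2 ⊢
    rw [Finset.sum_insert ha, map_add, map_smul, matrixAdjoint_add, matrixAdjoint_smul, h1, h2,
      neg_add, smul_neg]

theorem isSkew_form {H L : Matrix (Fin ℓ) (Fin ℓ) 𝒜} (hH : (calculus h𝒜).IsSkew H)
    (hL : (calculus h𝒜).IsSkew L) (n : ℕ) :
    (calculus h𝒜).IsSkew (VariationCalculus.form H L n) := by
  induction n with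
  | zero => rwa [VariationCalculus.form_zero]
  | succ n ih =>
    rw [isSkew_iff] at hH hL ih ⊢
    conv_lhs => rw [VariationCalculus.form_succ, map_mul, map_mul, matrixAdjoint_mul,
      matrixAdjoint_mul, hH, hL, ih]
    rw [← VariationCalculus.form_mul, map_mul, map_mul]
    simp only [neg_mul, mul_neg, neg_neg, mul_assoc]

theorem isSkew_conj {K ω : Matrix (Fin ℓ) (Fin ℓ) 𝒜} (hK : (calculus h𝒜).IsSkew K)
    (hω : (calculus h𝒜).IsSkew ω) : (calculus h𝒜).IsSkew (K * (ω * K)) := by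
  rw [isSkew_iff] at hK hω ⊢
  rw [map_mul, map_mul, matrixAdjoint_mul, matrixAdjoint_mul, hK, hω]
  simp only [neg_mul, mul_neg, neg_neg, mul_assoc]

end Skew

theorem cyc_smul (c : F) (x : DensityTensor ℓ 𝒱.D) :
    (calculus h𝒜).cyc (c • x) = c • (calculus h𝒜).cyc x := by
  have hr : ∀ x, (calculus h𝒜).rot (c • x) = c • (calculus h𝒜).rot x := fun x => by
    funext i j k
    exact map_smul (Density.rot 𝒱.D) c _
  rw [VariationCalculus.cyc_apply, VariationCalculus.cyc_apply, hr, hr, smul_add, smul_add]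

/-- If `H` and `K` are compatible structures and `K` is invertible, with inverse `L`, then
`K ω K` is a structure for all linear combinations `ω` of the operators `(L H)^n L`. -/
theorem jacobi_combination {H K L : Matrix (Fin ℓ) (Fin ℓ) 𝒜}
    (hKL : K * L = 1) (hLK : L * K = 1)
    (hH : (calculus h𝒜).IsSkew H) (hK : (calculus h𝒜).IsSkew K)
    (jH : ∀ i j k, JacobiIdentity 𝒱 (toMatrix 𝒜 H) i j k)
    (jK : ∀ i j k, JacobiIdentity 𝒱 (toMatrix 𝒜 K) i j k)
    (hHK : (calculus h𝒜).IsSkew (H + K))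
    (jHK : ∀ i j k, JacobiIdentity 𝒱 (toMatrix 𝒜 (H + K)) i j k)
    (s : Finset ℕ) (c : ℕ → F) :
    (calculus h𝒜).IsSkew (K * ((∑ n ∈ s, c n • VariationCalculus.form H L n) * K)) ∧
    ∀ i j k, JacobiIdentity 𝒱
      (toMatrix 𝒜 (K * ((∑ n ∈ s, c n • VariationCalculus.form H L n) * K))) i j k := by
  have hL := isSkew_inv hK hKL
  have hω := isSkew_sum (s := s) (c := c) fun n _ => isSkew_form hH hL n
  have hA := isSkew_conj hK hω
  refine ⟨hA, ?_⟩
  rw [jacobiIdentity_iff h𝒜 hH, jacobiDensity] at jH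
  rw [jacobiIdentity_iff h𝒜 hK, jacobiDensity] at jK
  rw [jacobiIdentity_iff h𝒜 hHK, jacobiDensity] at jHK
  -- Polarization: the Jacobi expression is quadratic, and those of H and K are removed from that of
  -- H + K.
  have jmix : (calculus h𝒜).cyc ((calculus h𝒜).ev H 1 1 ((calculus h𝒜).D K) +
      (calculus h𝒜).ev K 1 1 ((calculus h𝒜).D H)) = 0 := by
    have hadd : ∀ x, (calculus h𝒜).ev (H + K) 1 1 x =
        (calculus h𝒜).ev H 1 1 x + (calculus h𝒜).ev K 1 1 x := fun x => by
      funext i j k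
      change DensityTensor.act1 (toMatrix 𝒜 (H + K)) _ i j k =
        DensityTensor.act1 (toMatrix 𝒜 H) _ i j k + DensityTensor.act1 (toMatrix 𝒜 K) _ i j k
      rw [DensityTensor.act1_apply, DensityTensor.act1_apply, DensityTensor.act1_apply,
        ← Finset.sum_add_distrib]
      exact Finset.sum_congr rfl fun l _ => Density.act1_add _ _ _
    rw [hadd, map_add, map_add, map_add, map_add, map_add, map_add, jH, jK, zero_add, add_zero] at jHK
    rw [map_add]
    exact jHK
  have closed := VariationCalculus.cyc_D_form hH hL hKL hLK jK jH jmix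
  have D_smul : ∀ (a : F) A, (calculus h𝒜).D (a • A) = a • (calculus h𝒜).D A := fun a A =>
    map_smul (matrixVariation h𝒜) a A
  rw [jacobiIdentity_iff h𝒜 hA]
  refine VariationCalculus.jacobi_of_closed _ hK hω jK ?_ ?_
  · rw [map_sum, map_sum]
    exact Finset.sum_eq_zero fun n _ => by rw [D_smul, cyc_smul, closed, smul_zero]
  -- Here ωKω = ∑ c_m c_n ω_{m+n} is again a combination of closed forms.
  · rw [Finset.mul_sum, Finset.sum_mul_sum]
    simp only [map_sum, mul_smul_comm, smul_mul_assoc, D_smul, cyc_smul,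
      VariationCalculus.form_mul_form hLK, closed, smul_zero, Finset.sum_const_zero]

end DiffFunAlgebra

/-! ### Extension of coefficients to the field of fractions -/

section MapCoefficients

variable {F V W : Type*} [Field F] [AddCommGroup V] [Module F V] [AddCommGroup W] [Module F W]

/-- Application of a linear map to the coefficients of a series. -/
def TriSeries.mapCoeff (g : V →ₗ[F] W) : TriSeries F V →ₗ[F] TriSeries F W where
  toFun a := ⟨fun m n p => g (a.1 m n p), by
    obtain ⟨N, hN⟩ := a.2
    exact ⟨N, fun m n p h => hN m n p fun h0 => h (by dsimp only; rw [h0, map_zero])⟩⟩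
  map_add' a b := by ext m n p; exact map_add g _ _
  map_smul' c a := by ext m n p; exact map_smul g _ _

/-- Application of a linear map to the coefficients of an element of `V_{λ,μ}`. -/
def VLambdaMu.mapCoeff (g : V →ₗ[F] W) : VLambdaMu F V →ₗ[F] VLambdaMu F W :=
  Submodule.mapQ _ _ (TriSeries.mapCoeff g) (by
    rintro _ ⟨a, rfl⟩
    refine ⟨TriSeries.mapCoeff g a, ?_⟩
    ext m n p
    change g _ - g _ - g _ = g (_ - _ - _)
    rw [map_sub, map_sub])

theorem iotaMuLambda_mapCoeff (g : V →ₗ[F] W) (J : VLambdaMu F V) (x : ℤ × ℤ) :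
    iotaMuLambda F W (VLambdaMu.mapCoeff g J) x = g (iotaMuLambda F V J x) := by
  obtain ⟨a, rfl⟩ := Submodule.Quotient.mk_surjective _ J
  change ∑ᶠ q : ℤ × ℕ, _ = g (∑ᶠ q : ℤ × ℕ, _)
  rw [map_finsum g (TriSeries.finite₁ a _ _ _)]
  exact finsum_congr fun q => (map_zsmul g _ _).symm

theorem iotaLambdaMu_mapCoeff (g : V →ₗ[F] W) (J : VLambdaMu F V) (x : ℤ × ℤ) :
    iotaLambdaMu F W (VLambdaMu.mapCoeff g J) x = g (iotaLambdaMu F V J x) := by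
  obtain ⟨a, rfl⟩ := Submodule.Quotient.mk_surjective _ J
  change ∑ᶠ q : ℤ × ℕ, _ = g (∑ᶠ q : ℤ × ℕ, _)
  rw [map_finsum g (TriSeries.finite₂ a _ _ _)]
  exact finsum_congr fun q => (map_zsmul g _ _).symm

theorem iotaLambdaNu_mapCoeff (g : V →ₗ[F] W) (J : VLambdaMu F V) (x : ℤ × ℤ) :
    iotaLambdaNu F W (VLambdaMu.mapCoeff g J) x = g (iotaLambdaNu F V J x) := by
  obtain ⟨a, rfl⟩ := Submodule.Quotient.mk_surjective _ J
  change ∑ᶠ q : ℤ × ℕ, _ = g (∑ᶠ q : ℤ × ℕ, _)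
  rw [map_finsum g (TriSeries.finite₃ a _ _ _)]
  exact finsum_congr fun q => (map_zsmul g _ _).symm

end MapCoefficients

section FractionField

variable {F V : Type*} [Field F] [CommRing V] [Algebra F V] [IsDomain V]

/-- The Leibniz rule for a = (a/b) b determines the value at a/b from those at a and b. -/
theorem Derivation.fractionRing_ext {D₁ D₂ : Derivation F (FractionRing V) (FractionRing V)}
    (h : ∀ a : V, D₁ (algebraMap V (FractionRing V) a) = D₂ (algebraMap V (FractionRing V) a)) :
    D₁ = D₂ := by
  ext x
  obtain ⟨a, b, hb, rfl⟩ := IsFractionRing.div_surjective (A := V) x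
  have hb' : algebraMap V (FractionRing V) b ≠ 0 := by
    simpa using nonZeroDivisors.ne_zero hb
  have h1 := h a
  rw [← div_mul_cancel₀ (algebraMap V (FractionRing V) a) hb', Derivation.leibniz,
    Derivation.leibniz, h b] at h1
  exact smul_right_injective _ hb' (add_left_cancel h1)

variable {ℓ : ℕ}

/-- The structure of an algebra of differential functions on the field of fractions. -/
noncomputable abbrev DiffFunAlgebra.frac (𝒱 : DiffFunAlgebra F ℓ V) :
    DiffFunAlgebra F ℓ (FractionRing V) where
  D := fracDerivation 𝒱.D
  u i := algebraMap V (FractionRing V) (𝒱.u i)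
  algebraicIndependent := by
    have h := 𝒱.algebraicIndependent.map' (f := IsScalarTower.toAlgHom F V (FractionRing V))
      (IsFractionRing.injective V (FractionRing V))
    convert h using 1
    funext p
    exact (Function.Semiconj.iterate_right (f := algebraMap V (FractionRing V)) (ga := 𝒱.D)
      (gb := fracDerivation 𝒱.D) (fun a => (fracDerivation_algebraMap 𝒱.D a).symm) p.2 _).symm
  pd i n := fracDerivation (𝒱.pd i n)
  pd_u i m j n := by
    rw [← (Function.Semiconj.iterate_right (f := algebraMap V (FractionRing V)) (ga := 𝒱.D)
      (gb := fracDerivation 𝒱.D) (fun a => (fracDerivation_algebraMap 𝒱.D a).symm) n _),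
      fracDerivation_algebraMap, 𝒱.pd_u]
    split_ifs <;> simp
  pd_comm i m j n f := by
    have : ⁅fracDerivation (𝒱.pd i m), fracDerivation (𝒱.pd j n)⁆ = 0 :=
      Derivation.fractionRing_ext fun a => by
        simp only [Derivation.commutator_apply, fracDerivation_algebraMap, 𝒱.pd_comm i m, sub_self,
          Derivation.zero_apply]
    have h := DFunLike.congr_fun this f
    rw [Derivation.commutator_apply] at h
    exact sub_eq_zero.mp h
  pd_finite f := by
    obtain ⟨a, b, hb, rfl⟩ := IsFractionRing.div_surjective (A := V) f
    have hb' : algebraMap V (FractionRing V) b ≠ 0 := by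
      simpa using nonZeroDivisors.ne_zero hb
    refine ((𝒱.pd_finite a).union (𝒱.pd_finite b)).subset fun p hp => ?_
    by_contra h
    simp only [Set.mem_union, Set.mem_ofPred_eq, not_or, not_not] at h
    have h1 := fracDerivation_algebraMap (𝒱.pd p.1 p.2) a
    rw [← div_mul_cancel₀ (algebraMap V (FractionRing V) a) hb', Derivation.leibniz,
      fracDerivation_algebraMap, h.1, h.2, map_zero, smul_zero, zero_add, smul_eq_mul] at h1
    exact hp ((mul_eq_zero.mp h1).resolve_left hb')
  pd_zero_D i f := by
    have : ⁅fracDerivation (𝒱.pd i 0), fracDerivation 𝒱.D⁆ = 0 :=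
      Derivation.fractionRing_ext fun a => by
        simp only [Derivation.commutator_apply, fracDerivation_algebraMap, ← map_sub, 𝒱.pd_zero_D,
          map_zero, Derivation.zero_apply]
    have h := DFunLike.congr_fun this f
    rwa [Derivation.commutator_apply] at h
  pd_succ_D i n f := by
    have : ⁅fracDerivation (𝒱.pd i (n + 1)), fracDerivation 𝒱.D⁆ = fracDerivation (𝒱.pd i n) :=
      Derivation.fractionRing_ext fun a => by
        simp only [Derivation.commutator_apply, fracDerivation_algebraMap, ← map_sub, 𝒱.pd_succ_D]
    have h := DFunLike.congr_fun this f
    rwa [Derivation.commutator_apply] at h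

namespace DiffFunAlgebra

variable (𝒱 : DiffFunAlgebra F ℓ V)

open PsiDO

theorem toFrac_injective : Function.Injective (toFrac 𝒱.D) :=
  PsiDO.map_injective _ _ (IsFractionRing.injective V (FractionRing V))

theorem coeff_toFrac (A : PsiDO 𝒱.D) (n : ℤ) :
    (toFrac 𝒱.D A).coeff n = algebraMap V (FractionRing V) (A.coeff n) := rfl

theorem toFrac_adjoint (A : PsiDO 𝒱.D) : toFrac 𝒱.D A.adjoint = (toFrac 𝒱.D A).adjoint :=
  PsiDO.map_adjoint _ (fun a => (fracDerivation_algebraMap 𝒱.D a).symm) A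

theorem frechetDer_frac (h : Fin ℓ) (f : V) :
    𝒱.frac.frechetDer h (algebraMap V (FractionRing V) f) = toFrac 𝒱.D (𝒱.frechetDer h f) := by
  ext m
  rw [coeff_frechetDer, coeff_toFrac, coeff_frechetDer, fracDerivation_algebraMap]
  split_ifs <;> simp

theorem lambdaBracket_frac (H : Matrix (Fin ℓ) (Fin ℓ) (PsiDO 𝒱.D)) (f g : V) :
    lambdaBracket 𝒱.frac (H.map (toFrac 𝒱.D)) (algebraMap V (FractionRing V) f)
      (algebraMap V (FractionRing V) g) = toFrac 𝒱.D (lambdaBracket 𝒱 H f g) := by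
  simp only [lambdaBracket_eq, map_sum, map_mul, frechetDer_frac, Matrix.map_apply]
  refine Finset.sum_congr rfl fun i _ => Finset.sum_congr rfl fun j _ => ?_
  congr 1
  exact (𝒱.toFrac_adjoint _).symm

theorem coeff_lambdaBracket_frac (H : Matrix (Fin ℓ) (Fin ℓ) (PsiDO 𝒱.D)) (f g : V) (n : ℤ) :
    (lambdaBracket 𝒱.frac (H.map (toFrac 𝒱.D)) (algebraMap V (FractionRing V) f)
      (algebraMap V (FractionRing V) g)).coeff n =
        algebraMap V (FractionRing V) ((lambdaBracket 𝒱 H f g).coeff n) :=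
  congrArg (fun A : PsiDO (fracDerivation 𝒱.D) => A.coeff n) (lambdaBracket_frac 𝒱 H f g)

theorem coeff_lambdaBracket_lambdaBracket_frac (H : Matrix (Fin ℓ) (Fin ℓ) (PsiDO 𝒱.D))
    (f g h : V) (r s : ℤ) :
    (lambdaBracket 𝒱.frac (H.map (toFrac 𝒱.D)) (algebraMap V (FractionRing V) f)
      ((lambdaBracket 𝒱.frac (H.map (toFrac 𝒱.D)) (algebraMap V (FractionRing V) g)
        (algebraMap V (FractionRing V) h)).coeff s)).coeff r =
        algebraMap V (FractionRing V)
          ((lambdaBracket 𝒱 H f ((lambdaBracket 𝒱 H g h).coeff s)).coeff r) :=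
  (congrArg (fun x => (lambdaBracket 𝒱.frac (H.map (toFrac 𝒱.D))
    (algebraMap V (FractionRing V) f) x).coeff r) (coeff_lambdaBracket_frac 𝒱 H g h s)).trans
    (coeff_lambdaBracket_frac 𝒱 H _ _ _)

theorem coeff_lambdaBracket_lambdaBracket_frac' (H : Matrix (Fin ℓ) (Fin ℓ) (PsiDO 𝒱.D))
    (f g h : V) (r s : ℤ) :
    (lambdaBracket 𝒱.frac (H.map (toFrac 𝒱.D)) ((lambdaBracket 𝒱.frac (H.map (toFrac 𝒱.D))
      (algebraMap V (FractionRing V) f) (algebraMap V (FractionRing V) g)).coeff r)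
        (algebraMap V (FractionRing V) h)).coeff s =
        algebraMap V (FractionRing V)
          ((lambdaBracket 𝒱 H ((lambdaBracket 𝒱 H f g).coeff r) h).coeff s) :=
  (congrArg (fun x => (lambdaBracket 𝒱.frac (H.map (toFrac 𝒱.D)) x
    (algebraMap V (FractionRing V) h)).coeff s) (coeff_lambdaBracket_frac 𝒱 H f g r)).trans
    (coeff_lambdaBracket_frac 𝒱 H _ _ _)

/-- V_{λ,μ} and the maps ι involve the coefficients only as an F-vector space. The inclusion V → 𝒦
therefore carries solutions to 𝒦, and any F-linear retraction carries them back, since the brackets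
of generators have coefficients in V. -/
theorem jacobiIdentity_frac (H : Matrix (Fin ℓ) (Fin ℓ) (PsiDO 𝒱.D)) (i j k : Fin ℓ) :
    JacobiIdentity 𝒱.frac (H.map (toFrac 𝒱.D)) i j k ↔ JacobiIdentity 𝒱 H i j k := by
  let φ : V →ₗ[F] FractionRing V := (IsScalarTower.toAlgHom F V (FractionRing V)).toLinearMap
  obtain ⟨π, hπ⟩ := LinearMap.exists_leftInverse_of_injective φ
    (LinearMap.ker_eq_bot.mpr (IsFractionRing.injective V (FractionRing V)))
  have hπ' : ∀ a, π (algebraMap V (FractionRing V) a) = a := fun a => LinearMap.congr_fun hπ a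
  have e1 := fun r s =>
    𝒱.coeff_lambdaBracket_lambdaBracket_frac H (𝒱.u i) (𝒱.u j) (𝒱.u k) r s
  have e2 := fun r s =>
    𝒱.coeff_lambdaBracket_lambdaBracket_frac H (𝒱.u j) (𝒱.u i) (𝒱.u k) s r
  have e3 := fun r s =>
    𝒱.coeff_lambdaBracket_lambdaBracket_frac' H (𝒱.u i) (𝒱.u j) (𝒱.u k) r s
  constructor
  · rintro ⟨J₁, J₂, J₃, h1, h2, h3, h4⟩
    refine ⟨VLambdaMu.mapCoeff π J₁, VLambdaMu.mapCoeff π J₂, VLambdaMu.mapCoeff π J₃,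
      fun r s => ?_, fun r s => ?_, fun r s => ?_, ?_⟩
    · rw [iotaMuLambda_mapCoeff, (h1 r s).trans (e1 r s), hπ']
    · rw [iotaLambdaMu_mapCoeff, (h2 r s).trans (e2 r s), hπ']
    · rw [iotaLambdaNu_mapCoeff, (h3 r s).trans (e3 r s), hπ']
    · rw [← map_sub, ← map_sub, h4, map_zero]
  · rintro ⟨J₁, J₂, J₃, h1, h2, h3, h4⟩
    refine ⟨VLambdaMu.mapCoeff φ J₁, VLambdaMu.mapCoeff φ J₂, VLambdaMu.mapCoeff φ J₃,
      fun r s => ?_, fun r s => ?_, fun r s => ?_, ?_⟩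
    · rw [iotaMuLambda_mapCoeff, h1]
      exact (e1 r s).symm
    · rw [iotaLambdaMu_mapCoeff, h2]
      exact (e2 r s).symm
    · rw [iotaLambdaNu_mapCoeff, h3]
      exact (e3 r s).symm
    · rw [← map_sub, ← map_sub, h4, map_zero]

/-- The admissible operators contain the differential operators and are closed under inverses, while
𝒦(∂) is the smallest such subalgebra. Inverses may have coefficients outside V, hence the passage to
𝒦. -/
theorem rationalFrac_le_admissible (h : Fin ℓ) : rationalFrac 𝒱.D ≤ 𝒱.frac.admissible h :=
  sInf_le ⟨fun A hA => 𝒱.frac.isDifferential_mem_admissible fun n hn => by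
    rw [coeff_toFrac, hA n hn, map_zero],
    fun _ hA _ hAB hBA => 𝒱.frac.inv_mem_admissible hA hAB hBA⟩

/-- The extension of coefficients from `V(∂)` to `𝒦(∂)` for matrices. -/
noncomputable def ratToFrac : Matrix (Fin ℓ) (Fin ℓ) (rational 𝒱.D) →ₐ[F]
    Matrix (Fin ℓ) (Fin ℓ) (rationalFrac 𝒱.D) :=
  (((toFrac 𝒱.D).comp (rational 𝒱.D).val).codRestrict (rationalFrac 𝒱.D)
    fun A => A.2).mapMatrix

theorem isHamiltonian_iff (H : Matrix (Fin ℓ) (Fin ℓ) (rational 𝒱.D)) : IsHamiltonian 𝒱 H ↔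
    (calculus (𝒱 := 𝒱.frac) (𝒜 := rationalFrac 𝒱.D)
      𝒱.rationalFrac_le_admissible).IsSkew (𝒱.ratToFrac H) ∧
      ∀ i j k, JacobiIdentity 𝒱.frac
        (toMatrix (𝒱 := 𝒱.frac) (rationalFrac 𝒱.D) (𝒱.ratToFrac H)) i j k := by
  refine and_congr ?_ (forall_congr' fun i => forall_congr' fun j => forall_congr' fun k =>
    (𝒱.jacobiIdentity_frac _ i j k).symm)
  have h1 : ∀ A : Matrix (Fin ℓ) (Fin ℓ) (PsiDO 𝒱.D), matrixAdjoint (A.map (toFrac 𝒱.D)) =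
      (matrixAdjoint A).map (toFrac 𝒱.D) := fun A => by
    ext1 i j
    exact (𝒱.toFrac_adjoint _).symm
  have h2 : ∀ A : Matrix (Fin ℓ) (Fin ℓ) (PsiDO 𝒱.D), -A.map (toFrac 𝒱.D) =
      (-A).map (toFrac 𝒱.D) := fun A => by
    ext1 i j
    exact (map_neg (toFrac 𝒱.D) _).symm
  change _ ↔ matrixAdjoint ((H.map (rational 𝒱.D).val).map (toFrac 𝒱.D)) =
    -(H.map (rational 𝒱.D).val).map (toFrac 𝒱.D)
  rw [h1, h2]
  exact (Matrix.map_injective 𝒱.toFrac_injective).eq_iff.symm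

end DiffFunAlgebra

/-- Writing the members as K ω_n K treats n = 0 and n ≥ 1 uniformly and makes linear combinations of
the hierarchy correspond to those of the two-forms. -/
theorem hierarchy_eq {d : Derivation F V V} (H : Matrix (Fin ℓ) (Fin ℓ) (rational d))
    (K : (Matrix (Fin ℓ) (Fin ℓ) (rational d))ˣ) (n : ℕ) : hierarchy H K n =
      K * (VariationCalculus.form H ((K⁻¹ : (Matrix (Fin ℓ) (Fin ℓ) (rational d))ˣ) :
        Matrix (Fin ℓ) (Fin ℓ) (rational d)) n * K) := by
  rw [VariationCalculus.form, mul_assoc, Units.inv_mul, mul_one]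
  rcases n with _ | n
  · rw [pow_zero, mul_one]
    rfl
  · change (H * _) ^ n * H = _
    induction n with
    | zero => rw [pow_zero, one_mul, zero_add, pow_one, Units.mul_inv_cancel_left]
    | succ n ih =>
      rw [pow_succ _ (n + 1), ← mul_assoc, ← ih, pow_succ]
      simp only [mul_assoc]

end FractionField

theorem theorem5p1 {F V : Type*} [Field F] [CharZero F] [CommRing V] [IsDomain V] [Algebra F V]
    {ℓ : ℕ} (𝒱 : DiffFunAlgebra F ℓ V)
    (H : Matrix (Fin ℓ) (Fin ℓ) (rational 𝒱.D))
    (K : (Matrix (Fin ℓ) (Fin ℓ) (rational 𝒱.D))ˣ)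
    (hHK : IsCompatibleFamily 𝒱 ![H, (K : Matrix (Fin ℓ) (Fin ℓ) (rational 𝒱.D))]) :
    IsCompatibleFamily 𝒱 (hierarchy H K) := by
  have h1 : IsHamiltonian 𝒱 H := hHK.1 0
  have h2 : IsHamiltonian 𝒱 (K : Matrix (Fin ℓ) (Fin ℓ) (rational 𝒱.D)) := hHK.1 1
  have h3 : IsHamiltonian 𝒱 (H + K) := by
    have := hHK.2 (Finsupp.equivFunOnFinite.symm fun _ => 1)
    rwa [Finsupp.sum_fintype _ (fun α x => x • ![H, (K : Matrix (Fin ℓ) (Fin ℓ) (rational 𝒱.D))] α)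
      (fun i => zero_smul _ _), Fin.sum_univ_two,
      show (Finsupp.equivFunOnFinite.symm fun _ => (1 : F)) (0 : Fin 2) = 1 from rfl,
      show (Finsupp.equivFunOnFinite.symm fun _ => (1 : F)) (1 : Fin 2) = 1 from rfl,
      one_smul, one_smul] at this
  rw [𝒱.isHamiltonian_iff] at h1 h2 h3
  rw [map_add] at h3
  -- A linear combination is K ω K with ω = ∑ c_n ω_n, a case of `jacobi_combination` over 𝒦; the
  -- members themselves are the combinations with a single coefficient 1.
  have key : ∀ c : ℕ →₀ F, IsHamiltonian 𝒱 (c.sum fun α x => x • hierarchy H K α) := fun c => by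
    have e : 𝒱.ratToFrac (c.sum fun α x => x • hierarchy H K α) = 𝒱.ratToFrac K *
        ((∑ n ∈ c.support, c n • VariationCalculus.form (𝒱.ratToFrac H) (𝒱.ratToFrac
          (K⁻¹ : (Matrix (Fin ℓ) (Fin ℓ) (rational 𝒱.D))ˣ)) n) * 𝒱.ratToFrac K) := by
      simp only [Finsupp.sum, hierarchy_eq, map_sum, map_smul, map_mul, map_pow,
        VariationCalculus.form, Finset.sum_mul, Finset.mul_sum, smul_mul_assoc, mul_smul_comm]
    rw [𝒱.isHamiltonian_iff, e]
    exact DiffFunAlgebra.jacobi_combination _ (by rw [← map_mul, Units.mul_inv, map_one])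
      (by rw [← map_mul, Units.inv_mul, map_one]) h1.1 h2.1 h1.2 h2.2 h3.1 h3.2 _ _
  refine ⟨fun n => ?_, key⟩
  have := key (Finsupp.single n 1)
  rwa [Finsupp.sum_single_index (h := fun α x => x • hierarchy H K α) (zero_smul _ _),
    one_smul] at this
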